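/- Fix $n>2$ robots $R_1,\dots,R_n$ at distinct points $x_1<\dots<x_n$ of the line, with $d=x_n-x_1=r^{k+\delta}$ for some integer $k\ge 1$ and $\delta\in(0,1]$ (that is, $d>r$). The positions and distances are unknown to the robots. Algorithm $\mathcal{MSR}$ with expansion radius $r>1$ is the following synchronous algorithm, in which all robots start at the same time. Let $f_{-1}=0$ and $f_m=r^m$ for $m\ge 0$. The algorithm proceeds in rounds $i=0,1,2,\dots$; phase 1 of round $i$ lasts $f_{2i}+f_{2i-1}$ time units and phase 2 lasts $f_{2i}+f_{2i+1}$. A searching robot $R_j$ with phase-1 direction $\mathrm{dir}_1$ moves at unit speed in direction $\mathrm{dir}_1$ to the point at distance $f_{2i}$ from $x_j$ on that side in phase 1, and in the opposite direction to the point at distance $f_{2i+1}$ from $x_j$ on the other side in phase 2; having reached its destination it waits for the end of the phase. Initially all robots are *single*. * A single robot flips a fair coin at the beginning of each round to choose $\mathrm{dir}_1$ (right on heads, left on tails); all coins are independent. * When two single robots meet, both become *temporary boundary* robots and wait for the end of the phase; each gets as its deterministic direction the direction opposite to the one in which it was searching when they met. In all later rounds it uses its deterministic direction as $\mathrm{dir}_1$.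 * A single robot that meets a temporary boundary robot sticks to it and moves along with it from then on. * A temporary boundary robot that meets another temporary boundary robot in its deterministic direction becomes *internal*: it (with the robots stuck to it) waits at that point until a temporary boundary robot meets it, after which it moves along with that robot. If it meets another temporary boundary robot in the opposite direction, it waits for the end of the phase and then continues. Rendezvous is achieved as soon as all robots are at the same point. The cost of the optimal offline solution is $d/2$. Let the distance competitive ratio $\rho_n$ be the supremum, over all such initial positions of $n$ robots and over all robots $R_j$, of the expected distance travelled by $R_j$ until rendezvous, divided by $d/2$. **Theorem.** Let $r=1.28$. For all $n>2$ and all such initial positions, $\mathcal{MSR}$ achieves rendezvous with probability $1$. Moreover there are bounds $B_n$ ($n>2$) with $\rho_n\le B_n$ for all $n>2$, whose largest value is $B_3=54.732$, and which satisfy $B_n\to 34.154$ as $n\to\infty$. In particular, $\rho_n\le 54.732$ for all $n>2$, and $\limsup_{n\to\infty}\rho_n\le 34.154$. -/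

import Mathlib

open Set Filter Topology MeasureTheory
open scoped ENNReal

namespace MSR

/-- The two directions on the line. -/
inductive Dir
  | left
  | right
  deriving DecidableEq

/-- The opposite direction. -/
def Dir.opp : Dir → Dir
  | .left => .right
  | .right => .left

/-- The signed unit vector of a direction. -/
def Dir.sign : Dir → ℝ
  | .left => -1
  | .right => 1

/-- Each round has two phases. -/
inductive Phase
  | one
  | two
  deriving DecidableEq

/-- The state of a robot, for a team of `n` robots.
* `single`: it has met no other robot yet (randomized mode);
* `bound δ`: temporary boundary robot, with deterministic direction `δ`;
* `internal`: waits where it is until a temporary boundary robot collects it;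
* `stuck k`: it has been collected by the temporary boundary robot `k` and moves along with it. -/
inductive Mode (n : ℕ)
  | single
  | bound (δ : Dir)
  | internal
  | stuck (k : Fin n)

/-- The search radii: `f m = r ^ m` for `m ≥ 0`, and `f (-1) = 0`. -/
noncomputable def f (r : ℝ) (m : ℤ) : ℝ := if m < 0 then 0 else r ^ m

/-- The time allotted to a phase of round `i`; all robots start every phase at the same time. -/
noncomputable def phaseTime (r : ℝ) (i : ℕ) : Phase → ℝ
  | .one => f r (2 * i) + f r (2 * i - 1)
  | .two => f r (2 * i) + f r (2 * i + 1)

/-- The distance from its own initial position at which a searching robot ends a phase. -/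
noncomputable def reach (r : ℝ) (i : ℕ) : Phase → ℝ
  | .one => f r (2 * i)
  | .two => f r (2 * i + 1)

/-- The outcomes of the coins: `ω (i, j)` is the coin of robot `j` in round `i`, `true` is heads. -/
abbrev Coins (n : ℕ) := ℕ × Fin n → Bool

/-- All coins are fair and independent. -/
noncomputable def coinLaw (n : ℕ) : Measure (Coins n) :=
  Measure.infinitePi fun _ : ℕ × Fin n => (PMF.uniformOfFintype Bool).toMeasure

/-- The joint configuration of the robots at a time during the execution.  Robots are numbered from
left to right; they never cross, so this is always their order on the line. -/
structure Config (n : ℕ) where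
  /-- current round -/
  round : ℕ
  /-- current phase -/
  phase : Phase
  /-- time left until the end of the phase -/
  timeLeft : ℝ
  /-- positions -/
  pos : Fin n → ℝ
  /-- distances travelled since the start -/
  dist : Fin n → ℝ
  /-- states -/
  mode : Fin n → Mode n
  /-- directions searched in phase one of the current round -/
  dir : Fin n → Dir
  /-- robots that wait where they are until the end of the phase, because they have reached their
  destination or have met a robot -/
  halted : Fin n → Bool

section Dynamics

variable {n : ℕ} (r : ℝ) (x : Fin n → ℝ) (ω : Coins n)

/-- The direction in phase one of round `i`: right on heads and left on tails for a single robot,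
the deterministic direction for a temporary boundary robot (irrelevant in the other states). -/
def roundDir (i : ℕ) (j : Fin n) : Mode n → Dir
  | .bound δ => δ
  | _ => if ω (i, j) then .right else .left

/-- Begin round `i` from the given positions, distances and states. -/
noncomputable def startRound (i : ℕ) (pos dist : Fin n → ℝ) (mode : Fin n → Mode n) : Config n where
  round := i
  phase := .one
  timeLeft := phaseTime r i .one
  pos := pos
  dist := dist
  mode := mode
  dir := fun j => roundDir ω i j (mode j)
  halted := fun _ => false

/-- The initial configuration: robot `j` is at `x j`, and all robots are single. -/
noncomputable def init : Config n := startRound r ω 0 x (fun _ => 0) (fun _ => .single)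

/-- Begin the next phase. -/
noncomputable def nextPhase (c : Config n) : Config n :=
  match c.phase with
  | .one => { c with
      phase := .two
      timeLeft := phaseTime r c.round .two
      halted := fun _ => false }
  | .two => startRound r ω (c.round + 1) c.pos c.dist c.mode

/-- The direction searched in the current phase. -/
def heading (c : Config n) (j : Fin n) : Dir :=
  match c.phase with
  | .one => c.dir j
  | .two => (c.dir j).opp

/-- The destination of robot `j` in the current phase, if it is searching. -/
noncomputable def target (c : Config n) (j : Fin n) : ℝ :=
  x j + (heading c j).sign * reach r c.round c.phase

/-- The velocity of a robot that is not stuck to another one: a searching robot moves at unit speed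
in its current direction until it has to wait. -/
def ownVel (c : Config n) (j : Fin n) : ℝ :=
  match c.mode j with
  | .single | .bound _ => if c.halted j then 0 else (heading c j).sign
  | .internal | .stuck _ => 0

/-- The robot that determines the motion of `j`: the one `j` is stuck to, or `j` itself. -/
def leader (c : Config n) (j : Fin n) : Fin n :=
  match c.mode j with
  | .stuck k => k
  | _ => j

/-- The velocity of a robot. -/
def vel (c : Config n) (j : Fin n) : ℝ := ownVel c (leader c j)

/-- All robots move with their present velocities during a time `τ`. -/
noncomputable def advance (c : Config n) (τ : ℝ) : Config n :=
  { c with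
    timeLeft := c.timeLeft - τ
    pos := fun j => c.pos j + τ * vel c j
    dist := fun j => c.dist j + τ * |vel c j| }

/-- Neighbours `j` and `k` meet: they are at the same point, and they reached it by moving towards
each other (one of them possibly being at rest). -/
def Contact (c : Config n) (j k : Fin n) : Prop :=
  k.val = j.val + 1 ∧ c.pos j = c.pos k ∧ vel c k < vel c j

/-- `Contact c j k`, and `(j, k)` is the leftmost such pair. -/
def FirstContact (c : Config n) (j k : Fin n) : Prop :=
  Contact c j k ∧ ∀ j' k', Contact c j' k' → j ≤ j'

/-- The searching robot `j` has reached its destination. -/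
def Arrived (c : Config n) (j : Fin n) : Prop :=
  ownVel c j ≠ 0 ∧ c.pos j = target r x c j

open Classical in
/-- The robots that have reached their destinations wait until the end of the phase. -/
noncomputable def settle (c : Config n) : Config n :=
  { c with halted := fun j => if Arrived r x c j then true else c.halted j }

/-- Robot `a` changes its state to `m`. -/
def setMode (c : Config n) (a : Fin n) (m : Mode n) : Config n :=
  { c with mode := Function.update c.mode a m }

/-- Robot `a` waits until the end of the phase. -/
def halt (c : Config n) (a : Fin n) : Config n :=
  { c with halted := Function.update c.halted a true }

/-- Robot `a` becomes internal; the robots that are stuck to it stay with it. -/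
def makeInternal (c : Config n) (a : Fin n) : Config n :=
  { c with mode := fun i => if leader c i = a then .internal else c.mode i }

/-- Effect on a single robot `a` of meeting another single robot: it becomes a temporary boundary
robot and waits until the end of the phase; its deterministic direction is opposite to the one in
which it was searching when they met. -/
def makeBound (c : Config n) (a : Fin n) : Config n :=
  halt (setMode c a (.bound (heading c a).opp)) a

/-- Effect on the temporary boundary robot `a` with deterministic direction `δ` of meeting another
temporary boundary robot in direction `e`. -/
def boundMeets (c : Config n) (a : Fin n) (δ e : Dir) : Config n :=
  if δ = e then makeInternal c a else halt c a

/-- The reaction of the neighbours `j` (on the left) and `k` (on the right) when they meet. -/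
def meet (c : Config n) (j k : Fin n) : Config n :=
  let a := leader c j
  let b := leader c k
  match c.mode a, c.mode b with
  | .single, .single => makeBound (makeBound c a) b
  | .single, .bound _ | .internal, .bound _ => setMode c a (.stuck b)
  | .bound _, .single | .bound _, .internal => setMode c b (.stuck a)
  | .bound δ, .bound ε => boundMeets (boundMeets c a δ .right) b ε .left
  -- The cases below do not occur in an execution.
  | .single, .internal => setMode c a .internal
  | .internal, .single => setMode c b .internal
  | _, _ => c

/-- The times until the next events of the phase: the end of the phase, the arrivals of robots at
their destinations, and the meetings of neighbours. -/
def eventTimes (c : Config n) : Set ℝ :=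
  {τ | τ = c.timeLeft ∨
    (∃ j, ownVel c j ≠ 0 ∧ τ = |target r x c j - c.pos j|) ∨
    (∃ j k : Fin n, k.val = j.val + 1 ∧ vel c k < vel c j ∧
      τ = (c.pos k - c.pos j) / (vel c j - vel c k))}

open Classical in
/-- One step of the execution: neighbours that have met react (the leftmost such pair first);
otherwise robots that have reached their destinations settle there; otherwise the next phase begins,
if the time of the present one is up; otherwise time passes until the next event. -/
noncomputable def step (c : Config n) : Config n :=
  if h : ∃ p : Fin n × Fin n, FirstContact c p.1 p.2 then meet c h.choose.1 h.choose.2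
  else if ∃ j, Arrived r x c j then settle r x c
  else if c.timeLeft ≤ 0 then nextPhase r ω c
  else advance c (sInf (eventTimes r x c))

/-- The execution of the algorithm with expansion radius `r` from the initial positions `x`, with
coins `ω`: the configuration after `s` steps. -/
noncomputable def run (s : ℕ) : Config n := (step r x ω)^[s] (init r x ω)

/-- All robots are at the same point. -/
def Gathered (c : Config n) : Prop := ∀ j k, c.pos j = c.pos k

/-- The execution achieves rendezvous. -/
def Rendezvous : Prop := ∃ s, Gathered (run r x ω s)

/-- The distance travelled by robot `j` until rendezvous (`∞` if rendezvous is never achieved).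
The distance travelled is nondecreasing, so the infimum is attained when the robots first gather. -/
noncomputable def cost (j : Fin n) : ℝ≥0∞ :=
  ⨅ (s : ℕ) (_ : Gathered (run r x ω s)), ENNReal.ofReal ((run r x ω s).dist j)

end Dynamics

/-- The initial distance between the leftmost and the rightmost robot. -/
noncomputable def span {n : ℕ} (x : Fin n → ℝ) : ℝ := (⨆ j, x j) - ⨅ j, x j

/-- Admissible initial positions: distinct points numbered from left to right whose extreme distance
is `d = r ^ (k + δ)` for a positive integer `k` and `δ ∈ (0, 1]`. -/
def Admissible (r : ℝ) {n : ℕ} (x : Fin n → ℝ) : Prop :=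
  StrictMono x ∧ ∃ (k : ℕ) (δ : ℝ), 1 ≤ k ∧ δ ∈ Ioc (0 : ℝ) 1 ∧ span x = r ^ ((k : ℝ) + δ)

/-- The cost of the optimal offline solution, in which all robots move to the midpoint. -/
noncomputable def offlineCost {n : ℕ} (x : Fin n → ℝ) : ℝ := span x / 2

/-- The distance competitive ratio of the algorithm with expansion radius `r` for `n` robots: the
largest ratio, over the initial positions and the robots, of the expected distance travelled by the
robot until rendezvous to the cost of the optimal offline solution. -/
noncomputable def competitiveRatio (r : ℝ) (n : ℕ) : ℝ≥0∞ :=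
  ⨆ (x : Fin n → ℝ) (_ : Admissible r x) (j : Fin n),
    (∫⁻ ω, cost r x ω j ∂(coinLaw n)) / ENNReal.ofReal (offlineCost x)

end MSR

/-! ### Directions, leaders and velocities -/

namespace MSR

variable {n : ℕ} {r : ℝ} {x : Fin n → ℝ} {c c' : Config n} {i j k a b : Fin n}

/-! Let `u = r ^ (2 * i)` be the phase-one radius of round `i` and `d` the initial spread. As soon
as `d ≤ 2 * u`, any two neighbours are less than `2 * u` apart, because there are at least three
robots. If two neighbours searched in opposite directions and both stayed single, their destinations
in phase one or in phase two would be in the wrong order. So the robots that stay single at one end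
of the line have all flipped the same coin, and a heads-tails pair among them costs even more
survivors (`IsRound.transition`). The right end is the reflection of the left one.

A round is successful if some robot is not single at its beginning and neither end run of single
robots contains a heads directly followed, on the right, by a tails. If moreover `d < 2 * u` and `d
≤ r * u`, the outermost boundary robots `a` and `b` sweep outwards in phase one and back in phase
two. In phase two `a` can be stopped before it has crossed the whole interval only by `b` or by
another robot coming from the right, and symmetrically for `b`. It is impossible that both are
stopped by others, and if at most one is, the order of `a` and `b` would be violated at time `u +
d`. Hence `a` and `b` meet, and all robots are gathered by then (`Scene.status_micro`,
`Scene.gathered`, `RoundStart.exists_gathered`).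

Gathering in round `i` costs at most `64 / 7 * u + d`, and `u` grows by `r ^ 2 = 1.6384` per round,
so the expectation of `1.6384 ^ K` has to be bounded, where `K` counts the failures. A potential
that depends only on the numbers of single robots at the two ends, capped at five, satisfies the
required supermartingale inequality (`avg_step_le`). Its proof is an enumeration of the coin
patterns of at most five robots, combined with the independence of the two ends. One preliminary
round, the first with `d ≤ 2 * u`, brings the expected potential down to `1.3 + 4.6 / 2 ^ n` from
any state (`avg_potentialNext_le`). The last term pays for the event that all coins agree, and is
the only dependence on `n`. -/

@[simp] lemma Dir.opp_opp (d : Dir) : d.opp.opp = d := by cases d <;> rfl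
@[simp] lemma Dir.sign_opp (d : Dir) : d.opp.sign = -d.sign := by cases d <;> simp [Dir.opp, Dir.sign]
@[simp] lemma Dir.opp_left : Dir.left.opp = .right := rfl
@[simp] lemma Dir.opp_right : Dir.right.opp = .left := rfl
@[simp] lemma Dir.sign_left : Dir.left.sign = -1 := rfl
@[simp] lemma Dir.sign_right : Dir.right.sign = 1 := rfl
lemma Dir.ne_left {d : Dir} : d ≠ .left ↔ d = .right := by cases d <;> simp
lemma Dir.ne_right {d : Dir} : d ≠ .right ↔ d = .left := by cases d <;> simp
lemma Dir.left_or_right (d : Dir) : d = .left ∨ d = .right := by cases d <;> simp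
lemma Dir.opp_injective : Function.Injective Dir.opp := by
  intro d e h; cases d <;> cases e <;> simp_all [Dir.opp]
@[simp] lemma Dir.opp_inj {d e : Dir} : d.opp = e.opp ↔ d = e := Dir.opp_injective.eq_iff

/-! ### Leaders and velocities -/

lemma leader_stuck (h : c.mode j = .stuck k) : leader c j = k := by simp [leader, h]
lemma leader_single (h : c.mode j = .single) : leader c j = j := by simp [leader, h]
lemma leader_internal (h : c.mode j = .internal) : leader c j = j := by simp [leader, h]
lemma leader_bound {δ : Dir} (h : c.mode j = .bound δ) : leader c j = j := by simp [leader, h]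

lemma leader_eq_or (c : Config n) (j : Fin n) : leader c j = j ∨ c.mode j = .stuck (leader c j) := by
  unfold leader; cases h : c.mode j <;> simp

/-- A robot that searches on its own account. -/
def Searching (c : Config n) (j : Fin n) : Prop :=
  c.mode j = .single ∨ ∃ δ, c.mode j = .bound δ

lemma Searching.leader (h : Searching c j) : leader c j = j := by
  rcases h with h | ⟨δ, h⟩
  · exact leader_single h
  · exact leader_bound h

lemma Searching.ownVel (h : Searching c j) :
    ownVel c j = if c.halted j then 0 else (heading c j).sign := by
  rcases h with h | ⟨δ, h⟩ <;> simp [MSR.ownVel, h]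

lemma Searching.vel (h : Searching c j) :
    vel c j = if c.halted j then 0 else (heading c j).sign := by
  rw [MSR.vel, h.leader, h.ownVel]

lemma searching_of_ownVel (h : ownVel c j ≠ 0) : Searching c j ∧ c.halted j = false := by
  unfold ownVel at h
  cases hm : c.mode j <;> simp [hm] at h
  · exact ⟨.inl hm, h.1⟩
  · exact ⟨.inr ⟨_, hm⟩, h.1⟩

lemma ownVel_internal (h : c.mode j = .internal) : ownVel c j = 0 := by simp [ownVel, h]

lemma vel_internal (h : c.mode j = .internal) : vel c j = 0 := by
  rw [vel, leader_internal h, ownVel_internal h]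

lemma Dir.abs_sign (d : Dir) : |d.sign| = 1 := by cases d <;> simp

lemma Dir.sign_mul_self (d : Dir) : d.sign * d.sign = 1 := by cases d <;> simp

lemma ownVel_cases (c : Config n) (j : Fin n) : ownVel c j = 0 ∨ ownVel c j = (heading c j).sign := by
  unfold ownVel; cases c.mode j <;> simp <;> by_cases h : c.halted j = true <;> simp [h]

lemma abs_ownVel_le (c : Config n) (j : Fin n) : |ownVel c j| ≤ 1 := by
  rcases ownVel_cases c j with h | h <;> simp [h, Dir.abs_sign]

lemma abs_vel_le (c : Config n) (j : Fin n) : |vel c j| ≤ 1 := abs_ownVel_le _ _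

/-! ### Faces: how the state of a robot constrains the states of its neighbours -/

/-- Whether the left side of a robot in this state lies inside a pair of boundary robots. -/
def Mode.leftFace : Mode n → Bool
  | .single | .bound .left => false
  | _ => true

/-- Whether the right side of a robot in this state lies inside a pair of boundary robots. -/
def Mode.rightFace : Mode n → Bool
  | .single | .bound .right => false
  | _ => true

/-- The state of the robot that determines the motion of `j`. -/
def lmode (c : Config n) (j : Fin n) : Mode n := c.mode (leader c j)

lemma lmode_single (h : c.mode j = .single) : lmode c j = .single := by
  rw [lmode, leader_single h, h]
lemma lmode_internal (h : c.mode j = .internal) : lmode c j = .internal := by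
  rw [lmode, leader_internal h, h]

/-! ### Invariants of an execution -/

/-- The invariants of all configurations that occur in an execution. -/
structure Valid (r : ℝ) (x : Fin n → ℝ) (c : Config n) : Prop where
  mono : Monotone c.pos
  stuck_bound : ∀ {j k}, c.mode j = .stuck k → ∃ δ, c.mode k = .bound δ
  stuck_pos : ∀ {j k}, c.mode j = .stuck k → c.pos j = c.pos k
  convex : ∀ {i j k}, i ≤ j → j ≤ k → leader c i = leader c k → leader c j = leader c i
  -- Neighbours with different leaders face each other either both inside a boundary pair or both
  -- outside. This excludes encounters such as single with internal.
  edge : ∀ {j k : Fin n}, k.val = j.val + 1 →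
    leader c j = leader c k ∨ (lmode c j).rightFace = (lmode c k).leftFace
  first : ∀ {j : Fin n}, j.val = 0 → (lmode c j).leftFace = false
  last : ∀ {j : Fin n}, j.val + 1 = n → (lmode c j).rightFace = false
  near : ∀ {j}, Searching c j → |c.pos j - x j| ≤ reach r c.round c.phase
  ahead : ∀ {j}, Searching c j → c.halted j = false →
    0 ≤ (heading c j).sign * (target r x c j - c.pos j)
  inTime : ∀ {j}, Searching c j → c.halted j = false →
    (heading c j).sign * (target r x c j - c.pos j) ≤ c.timeLeft
  -- A boundary robot heading against its deterministic direction is left out, since a meeting may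
  -- halt it before its destination.
  arrived : ∀ {j}, (c.mode j = .single ∨ c.mode j = .bound (heading c j)) → c.halted j = true →
    c.pos j = target r x c j
  timeLeft_nonneg : 0 ≤ c.timeLeft

section
variable (hv : Valid r x c)
include hv

lemma Valid.leader_cases (j : Fin n) :
    (leader c j = j ∧ c.mode j = .single) ∨ (leader c j = j ∧ c.mode j = .internal) ∨
      ∃ δ, c.mode (leader c j) = .bound δ := by
  cases h : c.mode j with
  | single => exact .inl ⟨leader_single h, rfl⟩
  | bound δ => exact .inr (.inr ⟨δ, by rw [leader_bound h, h]⟩)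
  | internal => exact .inr (.inl ⟨leader_internal h, rfl⟩)
  | stuck k => obtain ⟨δ, hk⟩ := hv.stuck_bound h; exact .inr (.inr ⟨δ, by rw [leader_stuck h, hk]⟩)

lemma Valid.pos_leader (j : Fin n) : c.pos j = c.pos (leader c j) := by
  rcases leader_eq_or c j with h | h
  · rw [h]
  · exact hv.stuck_pos h

lemma Valid.leader_leader (j : Fin n) : leader c (leader c j) = leader c j := by
  rcases leader_eq_or c j with h | h
  · rw [h, h]
  · obtain ⟨δ, hk⟩ := hv.stuck_bound h; exact leader_bound hk

/-- The robots stuck to a leader fill an interval containing the leader. -/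
lemma Valid.between (h₁ : i ≤ j) (h₂ : j ≤ leader c i) : leader c j = leader c i :=
  hv.convex h₁ h₂ (hv.leader_leader i).symm

lemma Valid.between' (h₁ : leader c i ≤ j) (h₂ : j ≤ i) : leader c j = leader c i := by
  have := hv.convex h₁ h₂ (hv.leader_leader i)
  rw [this, hv.leader_leader]

lemma Valid.target_left (hs : Searching c j) (hh : c.halted j = false) (hd : heading c j = .left) :
    target r x c j ≤ c.pos j ∧ c.pos j - target r x c j ≤ c.timeLeft := by
  have h1 := hv.ahead hs hh; have h2 := hv.inTime hs hh
  rw [hd] at h1 h2; simp at h1 h2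
  constructor <;> linarith

lemma Valid.le_pos (hs : Searching c j) : x j - reach r c.round c.phase ≤ c.pos j := by
  have := abs_le.1 (hv.near hs); linarith [this.1]

lemma Valid.pos_le (hs : Searching c j) : c.pos j ≤ x j + reach r c.round c.phase := by
  have := abs_le.1 (hv.near hs); linarith [this.2]

end

/-! ### The outcome of a meeting -/

/-- The possible outcomes `c'` of a meeting of the neighbours `j` and `k` in `c`. -/
inductive Meeting (c : Config n) (j k : Fin n) : Config n → Prop
  | pair (hj : c.mode j = .single) (hk : c.mode k = .single)
      (dj : heading c j = .right) (dk : heading c k = .left) :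
      Meeting c j k { c with
        mode := Function.update (Function.update c.mode j (.bound .left)) k (.bound .right)
        halted := Function.update (Function.update c.halted j true) k true }
  | stickRight (b : Fin n) (δ : Dir)
      (hj : c.mode j = .single ∧ δ = .left ∨ c.mode j = .internal ∧ δ = .right)
      (hk : leader c k = b) (hb : c.mode b = .bound δ) : Meeting c j k (setMode c j (.stuck b))
  | stickLeft (a : Fin n) (δ : Dir)
      (hk : c.mode k = .single ∧ δ = .right ∨ c.mode k = .internal ∧ δ = .left)
      (hj : leader c j = a) (ha : c.mode a = .bound δ) : Meeting c j k (setMode c k (.stuck a))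
  | pause (a b : Fin n) (hj : leader c j = a) (hk : leader c k = b)
      (ha : c.mode a = .bound .left) (hb : c.mode b = .bound .right) :
      Meeting c j k { c with
        halted := Function.update (Function.update c.halted a true) b true }
  | merge (a b : Fin n) (hj : leader c j = a) (hk : leader c k = b)
      (ha : c.mode a = .bound .right) (hb : c.mode b = .bound .left) :
      Meeting c j k { c with
        mode := fun i => if leader c i = a ∨ leader c i = b then .internal else c.mode i }

lemma heading_congr (h₁ : c'.phase = c.phase) (h₂ : c'.dir = c.dir) : heading c' j = heading c j := by
  unfold heading; rw [h₁, h₂]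

lemma Contact.leader_ne (h : Contact c j k) : leader c j ≠ leader c k := by
  intro he; have := h.2.2; simp [vel, he] at this

lemma Contact.lt (h : Contact c j k) : j < k := by
  have := h.1; exact Fin.lt_def.2 (by omega)

/-- Two single robots that meet move towards each other. -/
lemma Valid.heading_of_contact (hv : Valid r x c) (hx : StrictMono x) (h : Contact c j k)
    (hj : c.mode j = .single) (hk : c.mode k = .single) :
    heading c j = .right ∧ heading c k = .left := by
  have hlt := hx h.lt
  have hp := h.2.1
  have hvel := h.2.2
  have sj : Searching c j := .inl hj
  have sk : Searching c k := .inl hk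
  rw [sj.vel, sk.vel] at hvel
  have tj : target r x c j = x j + (heading c j).sign * reach r c.round c.phase := rfl
  have tk : target r x c k = x k + (heading c k).sign * reach r c.round c.phase := rfl
  have aj := hv.arrived (.inl hj)
  have ak := hv.arrived (.inl hk)
  have nj := hv.le_pos sj
  have nj' := hv.pos_le sj
  have nk := hv.le_pos sk
  have nk' := hv.pos_le sk
  -- If both head the same way, the robot in front must have stopped at its destination, but
  -- destinations are ordered like the starting points, so the other cannot have caught up. If they
  -- head apart, the velocities are in the wrong order for a contact.
  rcases (heading c j).left_or_right with dj | dj <;> rcases (heading c k).left_or_right with dk | dk <;>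
    rw [dj] at tj hvel <;> rw [dk] at tk hvel <;> rw [tj] at aj <;> rw [tk] at ak <;>
    cases h1 : c.halted j <;> cases h2 : c.halted k <;> simp [h1, h2, dj, dk] at * <;> linarith

lemma Mode.faces_single_bound {δ : Dir} (h : (Mode.single : Mode n).rightFace = (Mode.bound δ : Mode n).leftFace) :
    δ = .left := by cases δ <;> simp_all [Mode.leftFace, Mode.rightFace]

/-- After the first call the members of the group of `a` lead themselves. They are internal already,
so it is harmless that the second call sees different leaders. -/
lemma makeInternal_makeInternal (c : Config n) (a b : Fin n) :
    makeInternal (makeInternal c a) b =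
      { c with mode := fun i => if leader c i = a ∨ leader c i = b then .internal else c.mode i } := by
  have key : ∀ i, leader (makeInternal c a) i = if leader c i = a then i else leader c i := by
    intro i
    by_cases h : leader c i = a
    · simp only [h, if_true]; apply leader_internal; simp [makeInternal, h]
    · rw [if_neg h]
      have : (makeInternal c a).mode i = c.mode i := by simp [makeInternal, h]
      unfold leader; rw [this]
  have h0 : makeInternal (makeInternal c a) b = 
      { c with mode := (fun i =>
        if (leader (makeInternal c a) i) = b then .internal else (makeInternal c a).mode i) } := rfl
  rw [h0]
  congr 1
  funext i
  by_cases h : leader c i = a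
  · simp [makeInternal, h]
  · have k1 : leader (makeInternal c a) i = leader c i := by rw [key, if_neg h]
    have k2 : (makeInternal c a).mode i = c.mode i := by simp [makeInternal, h]
    simp only [k1, k2, h, false_or]

/-- When neighbours meet, the outcome is one of the five listed ones. -/
lemma Valid.meeting (hv : Valid r x c) (hx : StrictMono x) (h : Contact c j k) :
    Meeting c j k (meet c j k) := by
  have hne := h.leader_ne
  have hvel := h.2.2
  have hedge := (hv.edge h.1).resolve_left hne
  rcases hv.leader_cases j with ⟨lj, mj⟩ | ⟨lj, mj⟩ | ⟨δ, mj⟩ <;>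
  rcases hv.leader_cases k with ⟨lk, mk⟩ | ⟨lk, mk⟩ | ⟨ε, mk⟩
  · obtain ⟨dj, dk⟩ := hv.heading_of_contact hx h mj mk
    have : meet c j k = { c with
        mode := Function.update (Function.update c.mode j (.bound .left)) k (.bound .right)
        halted := Function.update (Function.update c.halted j true) k true } := by
      have e1 : heading (makeBound c j) k = .left := (heading_congr rfl rfl).trans dk
      have e2 : meet c j k = makeBound (makeBound c j) k := by
        unfold meet; simp only [lj, lk, mj, mk]
      rw [e2, makeBound, e1]
      simp [makeBound, halt, setMode, dj]
    rw [this]; exact .pair mj mk dj dk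
  · rw [lmode_single mj, lmode_internal mk] at hedge; simp [Mode.leftFace, Mode.rightFace] at hedge
  · have hd : ε = .left := by
      rw [lmode_single mj, lmode, mk] at hedge; exact Mode.faces_single_bound hedge
    have : meet c j k = setMode c j (.stuck (leader c k)) := by
      unfold meet; simp only [lj, mj, mk]
    rw [this]; exact .stickRight _ ε (.inl ⟨mj, hd⟩) rfl mk
  · rw [lmode_single mk, lmode_internal mj] at hedge; simp [Mode.leftFace, Mode.rightFace] at hedge
  · rw [vel_internal mj, vel_internal mk] at hvel; exact absurd hvel (lt_irrefl _)
  · have hd : ε = .right := by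
      rw [lmode_internal mj, lmode, mk] at hedge
      cases ε <;> simp_all [Mode.leftFace, Mode.rightFace]
    have : meet c j k = setMode c j (.stuck (leader c k)) := by
      unfold meet; simp only [lj, mj, mk]
    rw [this]; exact .stickRight _ ε (.inr ⟨mj, hd⟩) rfl mk
  · have hd : δ = .right := by
      rw [lmode_single mk, lmode, mj] at hedge
      cases δ <;> simp_all [Mode.leftFace, Mode.rightFace]
    have : meet c j k = setMode c k (.stuck (leader c j)) := by
      unfold meet; simp only [lk, mj, mk]
    rw [this]; exact .stickLeft _ δ (.inl ⟨mk, hd⟩) rfl mj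
  · have hd : δ = .left := by
      rw [lmode_internal mk, lmode, mj] at hedge
      cases δ <;> simp_all [Mode.leftFace, Mode.rightFace]
    have : meet c j k = setMode c k (.stuck (leader c j)) := by
      unfold meet; simp only [lk, mj, mk]
    rw [this]; exact .stickLeft _ δ (.inr ⟨mk, hd⟩) rfl mj
  · have h0 : meet c j k = boundMeets (boundMeets c (leader c j) δ .right) (leader c k) ε .left := by
      unfold meet; simp only [mj, mk]
    rw [lmode, lmode, mj, mk] at hedge
    cases δ <;> cases ε <;> simp [Mode.leftFace, Mode.rightFace] at hedge
    · have : meet c j k = { c with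
        halted := Function.update (Function.update c.halted (leader c j) true) (leader c k) true } := by
        rw [h0]; simp [boundMeets, halt]
      rw [this]; exact .pause _ _ rfl rfl mj mk
    · rw [h0]
      simp only [boundMeets, if_true]
      rw [makeInternal_makeInternal]
      exact .merge _ _ rfl rfl mj mk

end MSR

namespace MSR

variable {n : ℕ} {r : ℝ} {x : Fin n → ℝ} {c c' : Config n} {i j k a b : Fin n}

/-! ### Reflection of the line -/

/-- The reflected state. -/
def Mode.mir : Mode n → Mode n
  | .single => .single
  | .bound δ => .bound δ.opp
  | .internal => .internal
  | .stuck k => .stuck k.rev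

/-- The reflected initial positions. -/
def mirX (x : Fin n → ℝ) : Fin n → ℝ := fun j => -x j.rev

/-- The reflected configuration. -/
def mir (c : Config n) : Config n :=
  { c with
    pos := fun j => -c.pos j.rev
    dist := fun j => c.dist j.rev
    mode := fun j => (c.mode j.rev).mir
    dir := fun j => (c.dir j.rev).opp
    halted := fun j => c.halted j.rev }

@[simp] lemma Mode.mir_mir (m : Mode n) : m.mir.mir = m := by cases m <;> simp [Mode.mir]
@[simp] lemma Mode.mir_eq_single {m : Mode n} : m.mir = .single ↔ m = .single := by
  cases m <;> simp [Mode.mir]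
@[simp] lemma Mode.mir_eq_internal {m : Mode n} : m.mir = .internal ↔ m = .internal := by
  cases m <;> simp [Mode.mir]
lemma Mode.mir_eq_bound {m : Mode n} {δ : Dir} : m.mir = .bound δ ↔ m = .bound δ.opp := by
  cases m with
  | bound ε => simp only [Mode.mir, Mode.bound.injEq]; constructor <;> rintro rfl <;> simp
  | _ => simp [Mode.mir]
lemma Mode.mir_eq_stuck {m : Mode n} : m.mir = .stuck k ↔ m = .stuck k.rev := by
  cases m with
  | stuck l => simp only [Mode.mir, Mode.stuck.injEq]; constructor <;> rintro rfl <;> simp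
  | _ => simp [Mode.mir]

@[simp] lemma mir_pos (c : Config n) (j : Fin n) : (mir c).pos j = -c.pos j.rev := rfl
@[simp] lemma mir_mode (c : Config n) (j : Fin n) : (mir c).mode j = (c.mode j.rev).mir := rfl
@[simp] lemma mir_dir (c : Config n) (j : Fin n) : (mir c).dir j = (c.dir j.rev).opp := rfl
@[simp] lemma mir_halted (c : Config n) (j : Fin n) : (mir c).halted j = c.halted j.rev := rfl
@[simp] lemma mir_round (c : Config n) : (mir c).round = c.round := rfl
@[simp] lemma mir_phase (c : Config n) : (mir c).phase = c.phase := rfl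
@[simp] lemma mir_timeLeft (c : Config n) : (mir c).timeLeft = c.timeLeft := rfl

@[simp] lemma mirX_mirX (x : Fin n → ℝ) : mirX (mirX x) = x := by funext j; simp [mirX]
@[simp] lemma mir_mir (c : Config n) : mir (mir c) = c := by
  cases c; simp [mir]

lemma strictMono_mirX (hx : StrictMono x) : StrictMono (mirX x) := by
  intro j k h
  simp only [mirX]
  have := hx (Fin.rev_lt_rev.2 h)
  linarith

@[simp] lemma leader_mir (c : Config n) (j : Fin n) : leader (mir c) j = (leader c j.rev).rev := by
  unfold leader
  cases h : c.mode j.rev <;> simp [mir, h, Mode.mir]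

@[simp] lemma heading_mir (c : Config n) (j : Fin n) : heading (mir c) j = (heading c j.rev).opp := by
  unfold heading; simp only [mir]; cases c.phase <;> rfl

@[simp] lemma target_mir (c : Config n) (j : Fin n) :
    target r (mirX x) (mir c) j = -target r x c j.rev := by
  unfold target; rw [heading_mir]; simp [mirX, mir]; ring

@[simp] lemma ownVel_mir (c : Config n) (j : Fin n) : ownVel (mir c) j = -ownVel c j.rev := by
  unfold ownVel
  rw [heading_mir]
  cases h : c.mode j.rev <;> simp [mir, h, Mode.mir] <;>
    split_ifs <;> simp

@[simp] lemma vel_mir (c : Config n) (j : Fin n) : vel (mir c) j = -vel c j.rev := by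
  simp [vel]

@[simp] lemma lmode_mir (c : Config n) (j : Fin n) : lmode (mir c) j = (lmode c j.rev).mir := by
  rw [lmode, leader_mir]; simp [lmode, mir]

@[simp] lemma Mode.leftFace_mir (m : Mode n) : m.mir.leftFace = m.rightFace := by
  rcases m with _ | δ | _ | _
  · rfl
  · cases δ <;> rfl
  · rfl
  · rfl
@[simp] lemma Mode.rightFace_mir (m : Mode n) : m.mir.rightFace = m.leftFace := by
  rcases m with _ | δ | _ | _
  · rfl
  · cases δ <;> rfl
  · rfl
  · rfl

@[simp] lemma searching_mir : Searching (mir c) j ↔ Searching c j.rev := by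
  unfold Searching
  simp only [mir, Mode.mir_eq_single, Mode.mir_eq_bound]
  constructor
  · rintro (h | ⟨δ, h⟩)
    · exact .inl h
    · exact .inr ⟨_, h⟩
  · rintro (h | ⟨δ, h⟩)
    · exact .inl h
    · exact .inr ⟨δ.opp, by simpa using h⟩

lemma Contact.mir (h : Contact c j k) : Contact (mir c) k.rev j.rev := by
  obtain ⟨h1, h2, h3⟩ := h
  refine ⟨?_, ?_, ?_⟩
  · have := j.2; have := k.2; simp only [Fin.val_rev]; omega
  · simp [MSR.mir, h2]
  · simpa using h3

lemma contact_mir : Contact (mir c) j k ↔ Contact c k.rev j.rev := by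
  constructor
  · intro h; simpa using h.mir
  · intro h; simpa using h.mir

lemma arrived_mir : Arrived r (mirX x) (mir c) j ↔ Arrived r x c j.rev := by
  unfold Arrived; rw [ownVel_mir, target_mir]; simp [mir]

/-- Together with `Micro.mir`, this allows every claim about the right end to be deduced from the
one about the left end. -/
lemma Valid.mir (h : Valid r x c) : Valid r (mirX x) (mir c) where
  mono := by
    intro j k hjk
    have := h.mono (Fin.rev_le_rev.2 hjk)
    simp only [MSR.mir]; linarith
  stuck_bound := by
    intro j k hk
    simp only [MSR.mir, Mode.mir_eq_stuck] at hk ⊢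
    obtain ⟨δ, hb⟩ := h.stuck_bound hk
    exact ⟨δ.opp, by simp [hb, Mode.mir]⟩
  stuck_pos := by
    intro j k hk
    simp only [MSR.mir, Mode.mir_eq_stuck] at hk ⊢
    rw [h.stuck_pos hk]
  convex := by
    intro i j k hij hjk he
    simp only [leader_mir, Fin.rev_inj] at he ⊢
    rw [h.convex (Fin.rev_le_rev.2 hjk) (Fin.rev_le_rev.2 hij) he.symm, he]
  edge := by
    intro j k hjk
    have := h.edge (j := k.rev) (k := j.rev)
      (by have := j.2; have := k.2; simp only [Fin.val_rev]; omega)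
    rcases this with h1 | h1
    · left; simp [h1]
    · right; simp [h1]
  first := by
    intro j hj
    have := h.last (j := j.rev) (by have := j.2; simp only [Fin.val_rev]; omega)
    simpa using this
  last := by
    intro j hj
    have := h.first (j := j.rev) (by have := j.2; simp only [Fin.val_rev]; omega)
    simpa using this
  near := by
    intro j hj
    have := h.near (searching_mir.1 hj)
    simp only [MSR.mir, mirX]
    rw [show -c.pos j.rev - -x j.rev = -(c.pos j.rev - x j.rev) by ring, abs_neg]
    exact this
  ahead := by
    intro j hj hh
    have := h.ahead (searching_mir.1 hj) hh
    rw [heading_mir, target_mir]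
    simp only [MSR.mir, Dir.sign_opp]; linarith
  inTime := by
    intro j hj hh
    have := h.inTime (searching_mir.1 hj) hh
    rw [heading_mir, target_mir]
    simp only [MSR.mir, Dir.sign_opp]; linarith
  arrived := by
    intro j hj hh
    have := h.arrived (j := j.rev) (by
      simpa [Mode.mir_eq_bound] using hj) hh
    rw [target_mir]
    simp only [MSR.mir]; linarith
  timeLeft_nonneg := h.timeLeft_nonneg

lemma update_comp_rev {α : Type*} (g : Fin n → α) (a : Fin n) (v : α) :
    (fun j : Fin n => Function.update g a v j.rev) = Function.update (fun j => g j.rev) a.rev v := by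
  funext j
  by_cases h : j = a.rev
  · subst h; simp
  · have : j.rev ≠ a := fun h' => h (by rw [← h', Fin.rev_rev])
    simp [Function.update_of_ne h, Function.update_of_ne this]

lemma update_mir (g : Fin n → Mode n) (a : Fin n) (v : Mode n) :
    (fun j : Fin n => (Function.update g a v j.rev).mir) =
      Function.update (fun j => (g j.rev).mir) a.rev v.mir := by
  funext j
  by_cases h : j = a.rev
  · subst h; simp
  · have : j.rev ≠ a := fun h' => h (by rw [← h', Fin.rev_rev])
    simp [Function.update_of_ne h, Function.update_of_ne this]

lemma mir_update (c : Config n) (g : Fin n → Mode n) (h : Fin n → Bool) :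
    MSR.mir { c with mode := g, halted := h } =
      { MSR.mir c with mode := fun j => (g j.rev).mir, halted := fun j => h j.rev } := rfl

/-- Reflection interchanges `stickRight` and `stickLeft` and preserves the other three outcomes,
with the two participants exchanged. -/
lemma Meeting.mir (hjk : j ≠ k) (h : Meeting c j k c') : Meeting (mir c) k.rev j.rev (mir c') := by
  cases h with
  | pair hj hk dj dk =>
    have := Meeting.pair (c := MSR.mir c) (j := k.rev) (k := j.rev) (by simp [hk])
      (by simp [hj]) (by simp [dk]) (by simp [dj])
    have hne : k.rev ≠ j.rev := fun h' => hjk (Fin.rev_inj.1 h').symm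
    rw [Function.update_comm hne, Function.update_comm hne] at this
    have e := mir_update c (Function.update (Function.update c.mode j (.bound .left)) k
      (.bound .right)) (Function.update (Function.update c.halted j true) k true)
    rw [update_mir, update_mir, update_comp_rev, update_comp_rev] at e
    exact e ▸ this
  | stickRight b δ hj hk hb =>
    have := Meeting.stickLeft (c := MSR.mir c) (j := k.rev) (k := j.rev) b.rev δ.opp
      (by rcases hj with ⟨h, rfl⟩ | ⟨h, rfl⟩ <;> simp [h]) (by simp [hk])
      (by simp [hb, Mode.mir])
    have e := mir_update c (Function.update c.mode j (.stuck b)) c.halted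
    rw [update_mir] at e
    exact e ▸ this
  | stickLeft a δ hk hj ha =>
    have := Meeting.stickRight (c := MSR.mir c) (j := k.rev) (k := j.rev) a.rev δ.opp
      (by rcases hk with ⟨h, rfl⟩ | ⟨h, rfl⟩ <;> simp [h]) (by simp [hj])
      (by simp [ha, Mode.mir])
    have e := mir_update c (Function.update c.mode k (.stuck a)) c.halted
    rw [update_mir] at e
    exact e ▸ this
  | pause a b hj hk ha hb =>
    have := Meeting.pause (c := MSR.mir c) (j := k.rev) (k := j.rev) b.rev a.rev
      (by simp [hk]) (by simp [hj]) (by simp [hb, Mode.mir]) (by simp [ha, Mode.mir])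
    have hne : b.rev ≠ a.rev := by
      intro h'; have := Fin.rev_inj.1 h'; subst this; rw [ha] at hb; simp at hb
    rw [Function.update_comm hne] at this
    have e := mir_update c c.mode (Function.update (Function.update c.halted a true) b true)
    rw [update_comp_rev, update_comp_rev] at e
    exact e ▸ this
  | merge a b hj hk ha hb =>
    have := Meeting.merge (c := MSR.mir c) (j := k.rev) (k := j.rev) b.rev a.rev
      (by simp [hk]) (by simp [hj]) (by simp [hb, Mode.mir]) (by simp [ha, Mode.mir])
    have hm : (fun i : Fin n => (if leader c i.rev = a ∨ leader c i.rev = b then Mode.internal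
        else c.mode i.rev).mir) = fun i => if leader (MSR.mir c) i = b.rev ∨
          leader (MSR.mir c) i = a.rev then .internal else (MSR.mir c).mode i := by
      funext i
      simp only [leader_mir, Fin.rev_inj, mir_mode]
      by_cases h1 : leader c i.rev = a <;> by_cases h2 : leader c i.rev = b <;>
        simp [h1, h2, Mode.mir]
    have e := mir_update c (fun i => if leader c i = a ∨ leader c i = b then .internal
      else c.mode i) c.halted
    simp only [] at e
    rw [hm] at e
    exact e ▸ this

end MSR

namespace MSR

variable {n : ℕ} {r : ℝ} {x : Fin n → ℝ} {c c' : Config n} {i j k a b : Fin n}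

/-! ### Preservation of the invariants -/

lemma leader_congr (h : c'.mode j = c.mode j) : leader c' j = leader c j := by
  unfold leader; rw [h]

lemma searching_congr (h : c'.mode j = c.mode j) : Searching c' j ↔ Searching c j := by
  unfold Searching; rw [h]

lemma Valid.eq_of_leader_single (hv : Valid r x c) (hj : c.mode j = .single)
    (h : leader c i = j) : i = j := by
  rcases leader_eq_or c i with h' | h'
  · rw [← h', h]
  · rw [h] at h'; obtain ⟨δ, hb⟩ := hv.stuck_bound h'; rw [hj] at hb; simp at hb

lemma Valid.eq_of_leader_internal (hv : Valid r x c) (hj : c.mode j = .internal)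
    (h : leader c i = j) : i = j := by
  rcases leader_eq_or c i with h' | h'
  · rw [← h', h]
  · rw [h] at h'; obtain ⟨δ, hb⟩ := hv.stuck_bound h'; rw [hj] at hb; simp at hb

/-- A robot heading left that is met from the right has already been waiting. -/
lemma Contact.halted_of_left (hc : Contact c j k) (ha : Searching c (leader c j))
    (hd : heading c (leader c j) = .left) : c.halted (leader c j) = true := by
  by_contra hh
  have h1 : vel c j = -1 := by rw [vel, ha.ownVel]; simp [hh, hd]
  have := hc.2.2
  have h2 := (abs_le.1 (abs_vel_le c k)).1
  linarith

lemma Contact.halted_of_right (hc : Contact c j k) (hb : Searching c (leader c k))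
    (hd : heading c (leader c k) = .right) : c.halted (leader c k) = true := by
  by_contra hh
  have h1 : vel c k = 1 := by rw [vel, hb.ownVel]; simp [hh, hd]
  have := hc.2.2
  have h2 := (abs_le.1 (abs_vel_le c j)).2
  linarith

/-- No leader changes. The outer faces of the new boundary robots are outside, like those of single
robots, and the two faces between them become inside together, which preserves `edge`. -/
lemma Valid.meeting_pair (hv : Valid r x c) (hc : Contact c j k) (hj : c.mode j = .single)
    (hk : c.mode k = .single) (dj : heading c j = .right) (dk : heading c k = .left) :
    Valid r x { c with
        mode := Function.update (Function.update c.mode j (.bound .left)) k (.bound .right)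
        halted := Function.update (Function.update c.halted j true) k true } := by
  set c' : Config n := { c with
        mode := Function.update (Function.update c.mode j (.bound .left)) k (.bound .right)
        halted := Function.update (Function.update c.halted j true) k true } with hc'
  have hjk : j ≠ k := hc.lt.ne
  have mj : c'.mode j = .bound .left := by simp [hc', Function.update_of_ne hjk]
  have mk : c'.mode k = .bound .right := by simp [hc']
  have mo : ∀ i, i ≠ j → i ≠ k → c'.mode i = c.mode i := by
    intro i h1 h2; simp [hc', Function.update_of_ne h1, Function.update_of_ne h2]
  have hl : ∀ i, leader c' i = leader c i := by
    intro i
    by_cases h1 : i = j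
    · subst h1; rw [leader_bound mj, leader_single hj]
    by_cases h2 : i = k
    · subst h2; rw [leader_bound mk, leader_single hk]
    exact leader_congr (mo i h1 h2)
  have lo : ∀ i, i ≠ j → i ≠ k → lmode c' i = lmode c i := by
    intro i h1 h2
    rw [lmode, lmode, hl]
    exact mo _ (fun h => h1 (hv.eq_of_leader_single hj h)) (fun h => h2 (hv.eq_of_leader_single hk h))
  have lj : lmode c' j = .bound .left := by rw [lmode, leader_bound mj, mj]
  have lk : lmode c' k = .bound .right := by rw [lmode, leader_bound mk, mk]
  have lf : ∀ i, i ≠ k → (lmode c' i).leftFace = (lmode c i).leftFace := by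
    intro i h
    by_cases h1 : i = j
    · subst h1; rw [lj, lmode_single hj]; rfl
    · rw [lo i h1 h]
  have rf : ∀ i, i ≠ j → (lmode c' i).rightFace = (lmode c i).rightFace := by
    intro i h
    by_cases h1 : i = k
    · subst h1; rw [lk, lmode_single hk]; rfl
    · rw [lo i h h1]
  have hval := hc.1
  have ho : ∀ i, i ≠ j → i ≠ k → c'.halted i = c.halted i := by
    intro i h1 h2; simp [hc', Function.update_of_ne h1, Function.update_of_ne h2]
  have hhj : c'.halted j = true := by simp [hc', Function.update_of_ne hjk]
  have hhk : c'.halted k = true := by simp [hc']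
  have hs : ∀ i, Searching c' i → Searching c i := by
    intro i h
    by_cases h1 : i = j
    · subst h1; exact .inl hj
    by_cases h2 : i = k
    · subst h2; exact .inl hk
    exact (searching_congr (mo i h1 h2)).1 h
  refine ⟨hv.mono, ?_, ?_, ?_, ?_, ?_, ?_, ?_, ?_, ?_, ?_, hv.timeLeft_nonneg⟩
  · intro p q h
    have hp1 : p ≠ j := by rintro rfl; rw [mj] at h; simp at h
    have hp2 : p ≠ k := by rintro rfl; rw [mk] at h; simp at h
    rw [mo p hp1 hp2] at h
    obtain ⟨δ, hq⟩ := hv.stuck_bound h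
    refine ⟨δ, ?_⟩
    rw [mo q, hq]
    · rintro rfl; rw [hj] at hq; simp at hq
    · rintro rfl; rw [hk] at hq; simp at hq
  · intro p q h
    have hp1 : p ≠ j := by rintro rfl; rw [mj] at h; simp at h
    have hp2 : p ≠ k := by rintro rfl; rw [mk] at h; simp at h
    rw [mo p hp1 hp2] at h
    exact hv.stuck_pos h
  · intro p q s h1 h2 h3
    rw [hl, hl] at h3; rw [hl, hl]; exact hv.convex h1 h2 h3
  · intro p q hpq
    rw [hl, hl]
    by_cases hp : p = j
    · have hq : q = k := Fin.ext (by rw [hpq, hp, hval])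
      right; rw [hp, hq, lj, lk]; rfl
    · have hq : q ≠ k := by
        rintro rfl; exact hp (Fin.ext (by omega))
      rw [rf p hp, lf q hq]; exact hv.edge hpq
  · intro p hp
    rw [lf p]
    · exact hv.first hp
    · rintro rfl; omega
  · intro p hp
    rw [rf p]
    · exact hv.last hp
    · rintro rfl; have := k.2; omega
  · intro p hp; exact hv.near (hs p hp)
  · intro p hp hh
    have h1 : p ≠ j := by rintro rfl; rw [hhj] at hh; simp at hh
    have h2 : p ≠ k := by rintro rfl; rw [hhk] at hh; simp at hh
    rw [ho p h1 h2] at hh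
    exact hv.ahead (hs p hp) hh
  · intro p hp hh
    have h1 : p ≠ j := by rintro rfl; rw [hhj] at hh; simp at hh
    have h2 : p ≠ k := by rintro rfl; rw [hhk] at hh; simp at hh
    rw [ho p h1 h2] at hh
    exact hv.inTime (hs p hp) hh
  · intro p hp hh
    have e : heading c' p = heading c p := heading_congr rfl rfl
    by_cases h1 : p = j
    · subst h1; rw [mj, e, dj] at hp; simp at hp
    by_cases h2 : p = k
    · subst h2; rw [mk, e, dk] at hp; simp at hp
    rw [mo p h1 h2, e] at hp
    rw [ho p h1 h2] at hh
    exact hv.arrived hp hh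

/-- The condition linking the state of `j` to `δ` says that `j` keeps its left face when it adopts
the state of `b`. On its right it now shares a leader with `k`, so `edge` holds there trivially. -/
lemma Valid.meeting_stickRight (hv : Valid r x c) (hc : Contact c j k) {δ : Dir}
    (hj : c.mode j = .single ∧ δ = .left ∨ c.mode j = .internal ∧ δ = .right)
    (hk : leader c k = b) (hb : c.mode b = .bound δ) : Valid r x (setMode c j (.stuck b)) := by
  set c' : Config n := setMode c j (.stuck b) with hc'
  have hbj : b ≠ j := by rintro rfl; rw [hb] at hj; simp at hj
  have lj0 : leader c j = j := by
    rcases hj with ⟨h, -⟩ | ⟨h, -⟩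
    · exact leader_single h
    · exact leader_internal h
  have uniq : ∀ i, leader c i = j → i = j := by
    intro i h
    rcases hj with ⟨h', -⟩ | ⟨h', -⟩
    · exact hv.eq_of_leader_single h' h
    · exact hv.eq_of_leader_internal h' h
  have hnb : ∀ δ, c.mode j ≠ .bound δ := by
    intro δ h; rw [h] at hj; simp at hj
  have mj : c'.mode j = .stuck b := by simp [hc', setMode]
  have mo : ∀ i, i ≠ j → c'.mode i = c.mode i := by
    intro i h; simp [hc', setMode, Function.update_of_ne h]
  have lj : leader c' j = b := leader_stuck mj
  have lo : ∀ i, i ≠ j → leader c' i = leader c i := fun i h => leader_congr (mo i h)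
  have lmo : ∀ i, i ≠ j → lmode c' i = lmode c i := by
    intro i h
    rw [lmode, lmode, lo i h]
    exact mo _ (fun h' => h (uniq i h'))
  have lmj : lmode c' j = .bound δ := by rw [lmode, lj, mo b hbj, hb]
  have lf : ∀ i, (lmode c' i).leftFace = (lmode c i).leftFace := by
    intro i
    by_cases h : i = j
    · subst h; rw [lmj, lmode, lj0]
      rcases hj with ⟨h', rfl⟩ | ⟨h', rfl⟩ <;> rw [h'] <;> rfl
    · rw [lmo i h]
  have hval := hc.1
  have hkj : k ≠ j := hc.lt.ne'
  have hs : ∀ i, Searching c' i → Searching c i := by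
    intro i h
    by_cases h1 : i = j
    · subst h1; rw [Searching, mj] at h; simp at h
    exact (searching_congr (mo i h1)).1 h
  refine ⟨hv.mono, ?_, ?_, ?_, ?_, ?_, ?_, ?_, ?_, ?_, ?_, hv.timeLeft_nonneg⟩
  · intro p q h
    by_cases hp : p = j
    · subst hp; rw [mj] at h; obtain rfl : b = q := by simpa using h
      exact ⟨δ, by rw [mo b hbj, hb]⟩
    · rw [mo p hp] at h
      obtain ⟨ε, hq⟩ := hv.stuck_bound h
      exact ⟨ε, by rw [mo q (fun h' => hnb ε (h' ▸ hq)), hq]⟩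
  · intro p q h
    by_cases hp : p = j
    · subst hp; rw [mj] at h; obtain rfl : b = q := by simpa using h
      have := hv.pos_leader k
      rw [hk] at this
      change c.pos p = c.pos b
      rw [← this, hc.2.1]
    · rw [mo p hp] at h; exact hv.stuck_pos h
  · intro p q s h1 h2 h3
    by_cases hp : p = j
    · rw [hp] at h1 h3 ⊢
      by_cases hq : q = j
      · rw [hq]
      by_cases hs : s = j
      · exact absurd (le_antisymm (hs ▸ h2) h1) hq
      rw [lj, lo s hs] at h3
      rw [lj, lo q hq]
      have hkq : k ≤ q := by
        have : j < q := lt_of_le_of_ne h1 (Ne.symm hq)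
        exact Fin.le_def.2 (by have := Fin.lt_def.1 this; omega)
      rw [hv.convex hkq h2 (by rw [hk, h3]), hk]
    · by_cases hs : s = j
      · exfalso
        rw [hs, lo p hp, lj] at h3
        have hpj : p ≤ j := h1.trans (hs ▸ h2)
        have h4 := hv.convex hpj hc.lt.le (by rw [h3, hk])
        rw [lj0, h3] at h4
        exact hbj h4.symm
      · rw [lo p hp, lo s hs] at h3
        by_cases hq : q = j
        · exfalso
          have h4 := hv.convex h1 h2 h3
          rw [hq, lj0] at h4
          exact hp (uniq p h4.symm)
        · rw [lo p hp, lo q hq]; exact hv.convex h1 h2 h3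
  · intro p q hpq
    by_cases hp : p = j
    · have hq : q = k := Fin.ext (by rw [hpq, hp, hval])
      left; rw [hp, hq, lj, lo k hkj, hk]
    · rw [lmo p hp, lf q]
      by_cases hq : q = j
      · right
        refine (hv.edge hpq).resolve_left ?_
        rw [hq, lj0]; exact fun h => hp (uniq p h)
      · rw [lo p hp, lo q hq]; exact hv.edge hpq
  · intro p hp; rw [lf p]; exact hv.first hp
  · intro p hp
    rw [lmo p]
    · exact hv.last hp
    · rintro rfl; have := k.2; omega
  · intro p hp; exact hv.near (hs p hp)
  · intro p hp hh; exact hv.ahead (hs p hp) hh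
  · intro p hp hh; exact hv.inTime (hs p hp) hh
  · intro p hp hh
    have h1 : p ≠ j := by rintro rfl; rw [mj] at hp; simp at hp
    rw [mo p h1] at hp
    exact hv.arrived hp hh

/-- Only `arrived` is at stake, and only for a boundary robot heading in its deterministic
direction. Such a robot would run away from its partner at full speed, so it must have been halted
before. -/
lemma Valid.meeting_pause (hv : Valid r x c) (hc : Contact c j k) (hj : leader c j = a)
    (hk : leader c k = b) (ha : c.mode a = .bound .left) (hb : c.mode b = .bound .right) :
    Valid r x { c with halted := Function.update (Function.update c.halted a true) b true } := by
  have hab : a ≠ b := by rintro rfl; rw [ha] at hb; simp at hb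
  refine ⟨hv.mono, hv.stuck_bound, hv.stuck_pos, hv.convex, hv.edge, hv.first, hv.last, hv.near,
    ?_, ?_, ?_, hv.timeLeft_nonneg⟩
  · intro p hp hh
    refine hv.ahead hp ?_
    by_cases h2 : p = b
    · subst h2; simp at hh
    by_cases h1 : p = a
    · subst h1; simp [Function.update_of_ne h2] at hh
    simpa [Function.update_of_ne h1, Function.update_of_ne h2] using hh
  · intro p hp hh
    refine hv.inTime hp ?_
    by_cases h2 : p = b
    · subst h2; simp at hh
    by_cases h1 : p = a
    · subst h1; simp [Function.update_of_ne h2] at hh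
    simpa [Function.update_of_ne h1, Function.update_of_ne h2] using hh
  · intro p hp hh
    refine hv.arrived hp ?_
    by_cases h2 : p = b
    · subst h2
      have hd : heading c p = .right := by
        have : c.mode p = .single ∨ c.mode p = .bound (heading c p) := hp
        rw [hb] at this; simpa [eq_comm] using this
      subst hk
      exact hc.halted_of_right (.inr ⟨_, hb⟩) hd
    by_cases h1 : p = a
    · subst h1
      have hd : heading c p = .left := by
        have : c.mode p = .single ∨ c.mode p = .bound (heading c p) := hp
        rw [ha] at this; simpa [eq_comm] using this
      subst hj
      exact hc.halted_of_left (.inr ⟨_, ha⟩) hd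
    simpa [Function.update_of_ne h1, Function.update_of_ne h2] using hh

/-- The groups of `a` and `b` are adjacent intervals. The left face of `a` and the right face of `b`
are inside, as are both faces of an internal robot, so nothing changes for the robots next to the
two groups. -/
lemma Valid.meeting_merge (hv : Valid r x c) (hc : Contact c j k) (hj : leader c j = a)
    (hk : leader c k = b) (ha : c.mode a = .bound .right) (hb : c.mode b = .bound .left) :
    Valid r x { c with
        mode := fun i => if leader c i = a ∨ leader c i = b then .internal else c.mode i } := by
  set c' : Config n := { c with
        mode := fun i => if leader c i = a ∨ leader c i = b then .internal else c.mode i } with hc'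
  have hab : a ≠ b := by rintro rfl; rw [ha] at hb; simp at hb
  have mi : ∀ i, (leader c i = a ∨ leader c i = b) → c'.mode i = .internal := by
    intro i h; simp [hc', h]
  have mo : ∀ i, ¬ (leader c i = a ∨ leader c i = b) → c'.mode i = c.mode i := by
    intro i h; simp [hc', h]
  have lo : ∀ i, ¬ (leader c i = a ∨ leader c i = b) → leader c' i = leader c i :=
    fun i h => leader_congr (mo i h)
  have lmo : ∀ i, ¬ (leader c i = a ∨ leader c i = b) → lmode c' i = lmode c i := by
    intro i h
    rw [lmode, lmode, lo i h]
    exact mo _ (by rwa [hv.leader_leader])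
  have lmi : ∀ i, (leader c i = a ∨ leader c i = b) → lmode c' i = .internal :=
    fun i h => lmode_internal (mi i h)
  have hval := hc.1
  have hmode : ∀ i δ, c'.mode i = .bound δ → c.mode i = .bound δ := by
    intro i δ h
    by_cases h1 : leader c i = a ∨ leader c i = b
    · rw [mi i h1] at h; simp at h
    · rwa [mo i h1] at h
  have hsin : ∀ i, c'.mode i = .single → c.mode i = .single := by
    intro i h
    by_cases h1 : leader c i = a ∨ leader c i = b
    · rw [mi i h1] at h; simp at h
    · rwa [mo i h1] at h
  have hs : ∀ i, Searching c' i → Searching c i := by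
    rintro i (h | ⟨δ, h⟩)
    · exact .inl (hsin i h)
    · exact .inr ⟨δ, hmode i δ h⟩
  -- the right neighbour of the run of `a` belongs to the run of `b`
  have adjA : ∀ p q : Fin n, q.val = p.val + 1 → leader c p = a →
      leader c q = a ∨ leader c q = b := by
    intro p q hpq hp
    by_cases h1 : p = j
    · right; rw [show q = k from Fin.ext (by rw [hpq, h1, hval]), hk]
    rcases lt_or_gt_of_ne h1 with h2 | h2
    · left
      have := hv.convex (i := p) (j := q) (k := j) (Fin.le_def.2 (by omega))
        (Fin.le_def.2 (by have := Fin.lt_def.1 h2; omega)) (by rw [hp, hj])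
      rw [this, hp]
    · exfalso
      have := hv.convex (i := j) (j := k) (k := p) hc.lt.le
        (Fin.le_def.2 (by have := Fin.lt_def.1 h2; omega)) (by rw [hp, hj])
      rw [hk, hj] at this; exact hab this.symm
  have adjB : ∀ p q : Fin n, q.val = p.val + 1 → leader c q = b →
      leader c p = a ∨ leader c p = b := by
    intro p q hpq hq
    by_cases h1 : q = k
    · left; rw [show p = j from Fin.ext (by rw [h1] at hpq; omega), hj]
    rcases lt_or_gt_of_ne h1 with h2 | h2
    · exfalso
      have := hv.convex (i := q) (j := j) (k := k)
        (Fin.le_def.2 (by have := Fin.lt_def.1 h2; omega)) hc.lt.le (by rw [hq, hk])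
      rw [hq, hj] at this; exact hab this
    · right
      have := hv.convex (i := k) (j := p) (k := q)
        (Fin.le_def.2 (by have := Fin.lt_def.1 h2; omega)) (Fin.le_def.2 (by omega)) (by rw [hq, hk])
      rw [this, hk]
  refine ⟨hv.mono, ?_, ?_, ?_, ?_, ?_, ?_, ?_, ?_, ?_, ?_, hv.timeLeft_nonneg⟩
  · intro p q h
    by_cases h1 : leader c p = a ∨ leader c p = b
    · rw [mi p h1] at h; simp at h
    · rw [mo p h1] at h
      obtain ⟨δ, hq⟩ := hv.stuck_bound h
      refine ⟨δ, ?_⟩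
      rw [mo q, hq]
      rw [← leader_stuck h, hv.leader_leader]; exact h1
  · intro p q h
    by_cases h1 : leader c p = a ∨ leader c p = b
    · rw [mi p h1] at h; simp at h
    · rw [mo p h1] at h; exact hv.stuck_pos h
  · intro p q s h1 h2 h3
    by_cases hp : leader c p = a ∨ leader c p = b
    · rw [leader_internal (mi p hp)] at h3 ⊢
      by_cases hs : leader c s = a ∨ leader c s = b
      · rw [leader_internal (mi s hs)] at h3
        subst h3
        obtain rfl := le_antisymm h1 h2
        rw [leader_internal (mi p hp)]
      · exfalso
        rw [lo s hs] at h3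
        rw [← hv.leader_leader, ← h3] at hs; exact hs hp
    · rw [lo p hp] at h3 ⊢
      by_cases hs : leader c s = a ∨ leader c s = b
      · exfalso
        rw [leader_internal (mi s hs)] at h3
        rw [← hv.leader_leader, h3] at hp; exact hp hs
      · rw [lo s hs] at h3
        have h4 := hv.convex h1 h2 h3
        rw [lo q (by rw [h4]; exact hp), h4]
  · intro p q hpq
    by_cases hp : leader c p = a ∨ leader c p = b
    · right
      by_cases hq : leader c q = a ∨ leader c q = b
      · rw [lmi p hp, lmi q hq]; rfl
      · rcases hp with hp | hp
        · exact absurd (adjA p q hpq hp) hq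
        · have h5 := (hv.edge hpq).resolve_left (by rw [hp]; exact fun h => hq (.inr h.symm))
          rw [lmode, hp, hb] at h5
          rw [lmi p (.inr hp), lmo q hq, ← h5]; rfl
    · by_cases hq : leader c q = a ∨ leader c q = b
      · right
        rcases hq with hq | hq
        · have h5 := (hv.edge hpq).resolve_left (by rw [hq]; exact fun h => hp (.inl h))
          rw [lmode.eq_def c q, hq, ha] at h5
          rw [lmi q (.inl hq), lmo p hp, h5]; rfl
        · exact absurd (adjB p q hpq hq) hp
      · rw [lmo p hp, lmo q hq, lo p hp, lo q hq]; exact hv.edge hpq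
  · intro p hp
    by_cases h1 : leader c p = a ∨ leader c p = b
    · exfalso
      have h2 := hv.first hp
      rcases h1 with h1 | h1
      · rw [lmode, h1, ha] at h2; simp [Mode.leftFace] at h2
      · have := hv.convex (i := p) (j := j) (k := k) (Fin.le_def.2 (by omega)) hc.lt.le
          (by rw [h1, hk])
        rw [hj, h1] at this; exact hab this
    · rw [lmo p h1]; exact hv.first hp
  · intro p hp
    by_cases h1 : leader c p = a ∨ leader c p = b
    · exfalso
      have h2 := hv.last hp
      rcases h1 with h1 | h1
      · have := hv.convex (i := j) (j := k) (k := p) hc.lt.le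
          (Fin.le_def.2 (by have := k.2; omega)) (by rw [h1, hj])
        rw [hj, hk] at this; exact hab this.symm
      · rw [lmode, h1, hb] at h2; simp [Mode.rightFace] at h2
    · rw [lmo p h1]; exact hv.last hp
  · intro p hp; exact hv.near (hs p hp)
  · intro p hp hh; exact hv.ahead (hs p hp) hh
  · intro p hp hh; exact hv.inTime (hs p hp) hh
  · intro p hp hh
    exact hv.arrived (hp.imp (hsin p) (hmode p _)) hh

lemma Valid.of_meeting (hv : Valid r x c) (hc : Contact c j k) (h : Meeting c j k c') :
    Valid r x c' := by
  cases h with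
  | pair hj hk dj dk => exact hv.meeting_pair hc hj hk dj dk
  | stickRight b δ hj hk hb => exact hv.meeting_stickRight hc hj hk hb
  | pause a b hj hk ha hb => exact hv.meeting_pause hc hj hk ha hb
  | merge a b hj hk ha hb => exact hv.meeting_merge hc hj hk ha hb
  | stickLeft a δ hk hj ha =>
    -- The remaining outcome is the reflection of `stickRight`.
    have e := mir_update c (Function.update c.mode k (.stuck a)) c.halted
    rw [update_mir] at e
    have h1 : Valid r (mirX x) (MSR.mir (setMode c k (.stuck a))) := by
      have := hv.mir.meeting_stickRight hc.mir (b := a.rev) (δ := δ.opp)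
        (by rcases hk with ⟨h, rfl⟩ | ⟨h, rfl⟩ <;> simp [h]) (by simp [hj]) (by simp [ha, Mode.mir])
      exact e ▸ this
    have := h1.mir
    simpa using this

end MSR

namespace MSR

variable {n : ℕ} {r : ℝ} {x : Fin n → ℝ} {c c' : Config n} {i j k a b : Fin n}

lemma monotone_of_adjacent {p : Fin n → ℝ} (h : ∀ j k : Fin n, k.val = j.val + 1 → p j ≤ p k) :
    Monotone p := by
  have key : ∀ (m : ℕ) (j k : Fin n), k.val = j.val + m → p j ≤ p k := by
    intro m
    induction m with
    | zero => intro j k hjk; rw [Fin.ext (a := j) (b := k) (by omega)]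
    | succ m ih =>
      intro j k hjk
      have hk := k.2
      exact (ih j ⟨j.val + m, by omega⟩ rfl).trans (h _ _ (by simp; omega))
  intro j k hjk
  exact key (k.val - j.val) j k (by have := Fin.le_def.1 hjk; omega)

/-! ### Settling, passing of time, new phases -/

lemma settle_halted_of_arrived (h : Arrived r x c j) : (settle r x c).halted j = true := by
  simp [settle, h]

lemma settle_halted_of_not (h : ¬ Arrived r x c j) : (settle r x c).halted j = c.halted j := by
  simp [settle, h]

lemma Valid.settle (hv : Valid r x c) : Valid r x (settle r x c) := by
  refine ⟨hv.mono, hv.stuck_bound, hv.stuck_pos, hv.convex, hv.edge, hv.first, hv.last, hv.near,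
    ?_, ?_, ?_, hv.timeLeft_nonneg⟩
  · intro p hp hh
    by_cases h : Arrived r x c p
    · rw [settle_halted_of_arrived h] at hh; simp at hh
    · rw [settle_halted_of_not h] at hh; exact hv.ahead hp hh
  · intro p hp hh
    by_cases h : Arrived r x c p
    · rw [settle_halted_of_arrived h] at hh; simp at hh
    · rw [settle_halted_of_not h] at hh; exact hv.inTime hp hh
  · intro p hp hh
    by_cases h : Arrived r x c p
    · exact h.2
    · rw [settle_halted_of_not h] at hh; exact hv.arrived hp hh

/-- The time `τ` does not go beyond the next event. -/
def BeforeEvents (r : ℝ) (x : Fin n → ℝ) (c : Config n) (τ : ℝ) : Prop :=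
  0 ≤ τ ∧ τ ≤ c.timeLeft ∧ (∀ j, ownVel c j ≠ 0 → τ ≤ |target r x c j - c.pos j|) ∧
    ∀ j k : Fin n, k.val = j.val + 1 → vel c k < vel c j → τ * (vel c j - vel c k) ≤ c.pos k - c.pos j

lemma Searching.ownVel_ne (h : Searching c j) (hh : c.halted j = false) :
    MSR.ownVel c j = (heading c j).sign ∧ MSR.ownVel c j ≠ 0 := by
  have : MSR.ownVel c j = (heading c j).sign := by rw [h.ownVel, hh]; simp
  refine ⟨this, ?_⟩
  rw [this]; cases heading c j <;> simp

lemma Valid.tau_le (hv : Valid r x c) {τ : ℝ} (hτ : BeforeEvents r x c τ) (h : Searching c j)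
    (hh : c.halted j = false) : τ ≤ (heading c j).sign * (target r x c j - c.pos j) := by
  have h1 := hτ.2.2.1 j (h.ownVel_ne hh).2
  have h2 := hv.ahead h hh
  rwa [← abs_of_nonneg h2, abs_mul, Dir.abs_sign, one_mul]

lemma Valid.advance (hv : Valid r x c) {τ : ℝ}
    (hτ : BeforeEvents r x c τ) : Valid r x (advance c τ) := by
  have hvel : ∀ p, Searching c p → vel c p = ownVel c p := fun p hp => by rw [vel, hp.leader]
  refine ⟨?_, hv.stuck_bound, ?_, hv.convex, hv.edge, hv.first, hv.last, ?_,
    ?_, ?_, ?_, ?_⟩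
  · apply monotone_of_adjacent
    intro p q hpq
    simp only [MSR.advance]
    have h0 := hv.mono (show p ≤ q from Fin.le_def.2 (by omega))
    -- If the left robot is faster, `τ` is at most the time until the two meet; otherwise the gap
    -- does not shrink.
    rcases lt_or_ge (vel c q) (vel c p) with h | h
    · have := hτ.2.2.2 p q hpq h; nlinarith
    · have := mul_le_mul_of_nonneg_left h hτ.1; linarith
  · intro p q h
    have h1 := hv.stuck_pos h
    obtain ⟨δ, h2⟩ := hv.stuck_bound h
    have h3 : vel c p = vel c q := by
      unfold vel; rw [leader_stuck (c := c) h, leader_bound h2]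
    simp only [MSR.advance]; rw [h1, h3]
  · intro p hp
    have hp' : Searching c p := hp
    simp only [MSR.advance, hvel p hp']
    cases hh : c.halted p
    · rw [(hp'.ownVel_ne hh).1]
      have h1 := hv.tau_le hτ hp' hh
      have h2 := abs_le.1 (hv.near hp')
      have h3 : target r x c p = x p + (heading c p).sign * reach r c.round c.phase := rfl
      rw [h3] at h1
      have h4 := hτ.1
      rw [abs_le]
      rcases (heading c p).left_or_right with h | h <;> rw [h] at h1 ⊢ <;> simp at h1 ⊢ <;>
        constructor <;> linarith
    · rw [hp'.ownVel, hh]; simpa using hv.near hp'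
  · intro p hp hh
    have hp' : Searching c p := hp
    have hh' : c.halted p = false := hh
    have h1 := hv.tau_le hτ hp' hh'
    have e1 : heading (MSR.advance c τ) p = heading c p := rfl
    have e2 : target r x (MSR.advance c τ) p = target r x c p := rfl
    rw [e1, e2]
    simp only [MSR.advance, hvel p hp', (hp'.ownVel_ne hh').1]
    rcases (heading c p).left_or_right with h | h <;> rw [h] at h1 ⊢ <;> simp at h1 ⊢ <;> linarith
  · intro p hp hh
    have hp' : Searching c p := hp
    have hh' : c.halted p = false := hh
    have h1 := hv.inTime hp' hh'
    have e1 : heading (MSR.advance c τ) p = heading c p := rfl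
    have e2 : target r x (MSR.advance c τ) p = target r x c p := rfl
    rw [e1, e2]
    simp only [MSR.advance, hvel p hp', (hp'.ownVel_ne hh').1]
    rcases (heading c p).left_or_right with h | h <;> rw [h] at h1 ⊢ <;> simp at h1 ⊢ <;> linarith
  · intro p hp hh
    have hh' : c.halted p = true := hh
    have hp' : Searching c p := hp.imp id (fun h => ⟨_, h⟩)
    have e2 : target r x (MSR.advance c τ) p = target r x c p := rfl
    rw [e2, ← hv.arrived hp hh']
    simp only [MSR.advance, hvel p hp', hp'.ownVel, hh']; simp
  · simp only [MSR.advance]; linarith [hτ.2.1]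

/-- The invariants hold at the beginning of a phase if they held at the end of the one before. -/
lemma Valid.restart (hv : Valid r x c) (hm : c'.mode = c.mode) (hp : c'.pos = c.pos)
    (hh : c'.halted = fun _ => false)
    (hr : reach r c.round c.phase ≤ reach r c'.round c'.phase)
    (ht : c'.timeLeft = reach r c'.round c'.phase + reach r c.round c.phase)
    (ht0 : 0 ≤ c'.timeLeft) :
    Valid r x c' := by
  have hl : ∀ i, leader c' i = leader c i := fun i => leader_congr (by rw [hm])
  have hlm : ∀ i, lmode c' i = lmode c i := fun i => by rw [lmode, lmode, hl, hm]
  have hs : ∀ {i}, Searching c' i → Searching c i := fun {i} => (searching_congr (by rw [hm])).1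
  -- At the start of the phase a robot is within the old radius of `x p`. Its way to the new
  -- destination is therefore at least the difference of the radii and at most their sum, which is
  -- the time allotted.
  have bounds : ∀ p, Searching c' p →
      0 ≤ (heading c' p).sign * (target r x c' p - c'.pos p) ∧
      (heading c' p).sign * (target r x c' p - c'.pos p) ≤ c'.timeLeft := by
    intro p h
    have h1 := hv.near (hs h)
    have h2 := abs_le.1 h1
    have h3 : target r x c' p = x p + (heading c' p).sign * reach r c'.round c'.phase := rfl
    rw [h3, hp, ht]
    rcases (heading c' p).left_or_right with h | h <;> rw [h] <;> simp <;> constructor <;> linarith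
  refine ⟨?_, ?_, ?_, ?_, ?_, ?_, ?_, ?_, fun {p} h _ => (bounds p h).1, fun {p} h _ => (bounds p h).2,
    ?_, ?_⟩
  · rw [hp]; exact hv.mono
  · intro p q h; rw [hm] at h ⊢; exact hv.stuck_bound h
  · intro p q h; rw [hm] at h; rw [hp]; exact hv.stuck_pos h
  · intro p q s h1 h2 h3; rw [hl, hl] at *; exact hv.convex h1 h2 h3
  · intro p q h; rw [hl, hl, hlm, hlm]; exact hv.edge h
  · intro p h; rw [hlm]; exact hv.first h
  · intro p h; rw [hlm]; exact hv.last h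
  · intro p h; rw [hp]; exact (hv.near (hs h)).trans hr
  · intro p _ h; rw [hh] at h; simp at h
  · exact ht0

/-! ### Micro-steps -/

/-- The elementary steps within a phase: neighbours that have met react, robots settle at their
destinations, or time passes. -/
inductive Micro (r : ℝ) (x : Fin n → ℝ) (c : Config n) : Config n → Prop
  | meet (j k : Fin n) (c' : Config n) (hc : Contact c j k) (hm : Meeting c j k c') : Micro r x c c'
  | settle : Micro r x c (settle r x c)
  | advance (τ : ℝ) (hn : ∀ j k, ¬ Contact c j k) (ha : ∀ j, ¬ Arrived r x c j)
      (hτ : BeforeEvents r x c τ) : Micro r x c (advance c τ)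

lemma Valid.micro (hv : Valid r x c) (h : Micro r x c c') : Valid r x c' := by
  cases h with
  | meet j k _ hc hm => exact hv.of_meeting hc hm
  | settle => exact hv.settle
  | advance τ hn ha hτ => exact hv.advance hτ

lemma BeforeEvents.mir {τ : ℝ} (h : BeforeEvents r x c τ) :
    BeforeEvents r (mirX x) (MSR.mir c) τ := by
  refine ⟨h.1, h.2.1, ?_, ?_⟩
  · intro j hj
    have := h.2.2.1 j.rev (by simpa using hj)
    rw [target_mir, mir_pos, ← abs_neg]
    rw [show -(-target r x c j.rev - -c.pos j.rev) = target r x c j.rev - c.pos j.rev by ring]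
    exact this
  · intro j k hjk hv
    simp only [vel_mir] at hv
    have := h.2.2.2 k.rev j.rev (by have := j.2; have := k.2; simp only [Fin.val_rev]; omega)
      (by linarith)
    simp only [vel_mir, mir_pos]; linarith

lemma mir_settle : MSR.mir (settle r x c) = settle r (mirX x) (MSR.mir c) := by
  unfold settle MSR.mir
  congr 1
  funext j
  have := arrived_mir (r := r) (x := x) (c := c) (j := j)
  unfold MSR.mir at this
  by_cases h : Arrived r x c j.rev
  · simp only [if_pos h, if_pos (this.2 h)]
  · simp only [if_neg h, if_neg (mt this.1 h)]

lemma mir_advance (τ : ℝ) : MSR.mir (advance c τ) = advance (MSR.mir c) τ := by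
  have h1 : (MSR.mir (advance c τ)).pos = (advance (MSR.mir c) τ).pos := by
    funext j; simp [advance]; ring
  have h2 : (MSR.mir (advance c τ)).dist = (advance (MSR.mir c) τ).dist := by
    funext j; simp only [advance, vel_mir, abs_neg]; rfl
  calc MSR.mir (advance c τ) = { MSR.mir (advance c τ) with pos := (advance (MSR.mir c) τ).pos
                                                            dist := (advance (MSR.mir c) τ).dist } := by
        rw [← h1, ← h2]
    _ = advance (MSR.mir c) τ := rfl

/-- Reflection invariance holds because any pair in contact may react in `Micro`. The function
`step` prefers the leftmost pair and is not symmetric. -/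
lemma Micro.mir (h : Micro r x c c') : Micro r (mirX x) (MSR.mir c) (MSR.mir c') := by
  cases h with
  | meet j k _ hc hm => exact .meet k.rev j.rev _ hc.mir (hm.mir hc.lt.ne)
  | settle => rw [mir_settle]; exact .settle
  | advance τ hn ha hτ =>
    rw [mir_advance]
    refine .advance τ (fun j k h => hn _ _ (contact_mir.1 h)) (fun j h => ha _ (arrived_mir.1 h)) hτ.mir

lemma Micro.phase_eq (h : Micro r x c c') : c'.phase = c.phase := by
  cases h with
  | meet j k _ hc hm => cases hm <;> rfl
  | settle => rfl
  | advance τ hn ha hτ => rfl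

lemma Micro.round_eq (h : Micro r x c c') : c'.round = c.round := by
  cases h with
  | meet j k _ hc hm => cases hm <;> rfl
  | settle => rfl
  | advance τ hn ha hτ => rfl

lemma Micro.dir_eq (h : Micro r x c c') : c'.dir = c.dir := by
  cases h with
  | meet j k _ hc hm => cases hm <;> rfl
  | settle => rfl
  | advance τ hn ha hτ => rfl

/-- The phase is over. -/
def PhaseEnd (r : ℝ) (x : Fin n → ℝ) (c : Config n) : Prop :=
  (∀ j k, ¬ Contact c j k) ∧ (∀ j, ¬ Arrived r x c j) ∧ c.timeLeft ≤ 0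

lemma PhaseEnd.mir (h : PhaseEnd r x c) : PhaseEnd r (mirX x) (MSR.mir c) :=
  ⟨fun _ _ h' => h.1 _ _ (contact_mir.1 h'), fun _ h' => h.2.1 _ (arrived_mir.1 h'), h.2.2⟩

/-- When no time is left, `ahead` and `inTime` force the remaining distance of a moving robot to be
zero, so it would have arrived. -/
lemma PhaseEnd.halted (h : PhaseEnd r x c) (hv : Valid r x c) (hj : Searching c j) :
    c.halted j = true := by
  by_contra hh
  have hh : c.halted j = false := by simpa using hh
  have h1 := hv.ahead hj hh
  have h2 := hv.inTime hj hh
  have h3 := h.2.2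
  refine h.2.1 j ⟨(hj.ownVel_ne hh).2, ?_⟩
  rcases (heading c j).left_or_right with h | h <;> rw [h] at h1 h2 <;> simp at h1 h2 <;> linarith

lemma PhaseEnd.pos_eq (h : PhaseEnd r x c) (hv : Valid r x c)
    (hj : c.mode j = .single ∨ c.mode j = .bound (heading c j)) : c.pos j = target r x c j :=
  hv.arrived hj (h.halted hv (hj.imp id fun h => ⟨_, h⟩))

/-- A step of the execution within a phase. -/
def Tick (r : ℝ) (x : Fin n → ℝ) (c c' : Config n) : Prop :=
  Micro r x c c' ∧ ∀ ω, step r x ω c = c'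

/-! ### Termination of a phase -/

/-- Weight of a state, for termination. -/
def Mode.weight : Mode n → ℕ
  | .single => 2
  | .bound _ => 1
  | _ => 0

/-- Secondary weight of a state, for termination. -/
def Mode.weight' : Mode n → ℕ
  | .internal => 1
  | _ => 0

/-- The total weight of a configuration. -/
def weight (c : Config n) : ℕ := ∑ j, (c.mode j).weight

/-- The secondary weight of a configuration. -/
def weight' (c : Config n) : ℕ := ∑ j, ((c.mode j).weight' + if c.halted j then 0 else 1)

/-- The primary weight drops when single robots bind or get stuck and when two boundary robots
become internal. The secondary weight handles the collection of an internal robot and the pause. -/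
lemma Meeting.weight_lt (hc : Contact c j k) (h : Meeting c j k c') :
    weight c' < weight c ∨ weight c' = weight c ∧ weight' c' < weight' c := by
  have hjk := hc.lt.ne
  cases h with
  | pair hj hk dj dk =>
    left
    refine Finset.sum_lt_sum (fun i _ => ?_) ⟨k, Finset.mem_univ _, by simp [hk, Mode.weight]⟩
    by_cases h2 : i = k
    · subst h2; simp [hk, Mode.weight]
    by_cases h1 : i = j
    · subst h1; simp [hj, Function.update_of_ne h2, Mode.weight]
    simp [Function.update_of_ne h1, Function.update_of_ne h2]
  | stickRight b δ hj hk hb =>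
    rcases hj with ⟨hj, -⟩ | ⟨hj, -⟩
    · left
      refine Finset.sum_lt_sum (fun i _ => ?_) ⟨j, Finset.mem_univ _, by simp [setMode, hj, Mode.weight]⟩
      by_cases h1 : i = j
      · subst h1; simp [setMode, hj, Mode.weight]
      simp [setMode, Function.update_of_ne h1]
    · right
      constructor
      · refine Finset.sum_congr rfl (fun i _ => ?_)
        by_cases h1 : i = j
        · subst h1; simp [setMode, hj, Mode.weight]
        simp [setMode, Function.update_of_ne h1]
      · refine Finset.sum_lt_sum (fun i _ => ?_) ⟨j, Finset.mem_univ _, by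
          cases h : c.halted j <;> simp [setMode, hj, Mode.weight', h]⟩
        by_cases h1 : i = j
        · subst h1; cases h : c.halted i <;> simp [setMode, hj, Mode.weight', h]
        cases h : c.halted i <;> simp [setMode, Function.update_of_ne h1, h]
  | stickLeft a δ hk hj ha =>
    rcases hk with ⟨hk, -⟩ | ⟨hk, -⟩
    · left
      refine Finset.sum_lt_sum (fun i _ => ?_) ⟨k, Finset.mem_univ _, by simp [setMode, hk, Mode.weight]⟩
      by_cases h1 : i = k
      · subst h1; simp [setMode, hk, Mode.weight]
      simp [setMode, Function.update_of_ne h1]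
    · right
      constructor
      · refine Finset.sum_congr rfl (fun i _ => ?_)
        by_cases h1 : i = k
        · subst h1; simp [setMode, hk, Mode.weight]
        simp [setMode, Function.update_of_ne h1]
      · refine Finset.sum_lt_sum (fun i _ => ?_) ⟨k, Finset.mem_univ _, by
          cases h : c.halted k <;> simp [setMode, hk, Mode.weight', h]⟩
        by_cases h1 : i = k
        · subst h1; cases h : c.halted i <;> simp [setMode, hk, Mode.weight', h]
        cases h : c.halted i <;> simp [setMode, Function.update_of_ne h1, h]
  | pause a b hj hk ha hb =>
    right
    refine ⟨rfl, ?_⟩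
    have hab : a ≠ b := by rintro rfl; rw [ha] at hb; simp at hb
    have hle : ∀ i ∈ (Finset.univ : Finset (Fin n)),
        (c.mode i).weight' + (if (Function.update (Function.update c.halted a true) b true i) then 0
          else 1) ≤ (c.mode i).weight' + if c.halted i then 0 else 1 := by
      intro i _
      by_cases h2 : i = b
      · subst h2; simp
      by_cases h1 : i = a
      · subst h1; simp [Function.update_of_ne h2]
      simp [Function.update_of_ne h1, Function.update_of_ne h2]
    -- Velocities differ at a contact, so `a` and `b` have not both been halted already.
    have hv := hc.2.2
    rw [vel, vel, hj, hk, Searching.ownVel (.inr ⟨_, ha⟩), Searching.ownVel (.inr ⟨_, hb⟩)] at hv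
    cases h1 : c.halted a
    · refine Finset.sum_lt_sum hle ⟨a, Finset.mem_univ _, ?_⟩
      simp [Function.update_of_ne hab, h1]
    · cases h2 : c.halted b
      · refine Finset.sum_lt_sum hle ⟨b, Finset.mem_univ _, ?_⟩
        simp [h2]
      · simp [h1, h2] at hv
  | merge a b hj hk ha hb =>
    left
    refine Finset.sum_lt_sum (fun i _ => ?_) ⟨a, Finset.mem_univ _, ?_⟩
    · simp only; split_ifs <;> simp [Mode.weight]
    · simp [leader_bound ha, ha, Mode.weight]

lemma weight'_settle (h : Arrived r x c j) : weight' (settle r x c) < weight' c := by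
  refine Finset.sum_lt_sum (fun i _ => ?_) ⟨j, Finset.mem_univ _, ?_⟩
  · by_cases hi : Arrived r x c i
    · rw [settle_halted_of_arrived hi]; simp [settle]
    · rw [settle_halted_of_not hi]; simp [settle]
  · rw [settle_halted_of_arrived h, (searching_of_ownVel h.1).2]; simp [settle]

lemma finite_eventTimes (r : ℝ) (x : Fin n → ℝ) (c : Config n) : (eventTimes r x c).Finite := by
  have : eventTimes r x c ⊆ {c.timeLeft} ∪ (Set.range fun j => |target r x c j - c.pos j|) ∪
      (Set.range fun p : Fin n × Fin n => (c.pos p.2 - c.pos p.1) / (vel c p.1 - vel c p.2)) := by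
    rintro τ (h | ⟨j, -, h⟩ | ⟨j, k, -, -, h⟩)
    · left; left; exact h
    · left; right; exact ⟨j, h.symm⟩
    · right; exact ⟨(j, k), h.symm⟩
  exact (((Set.finite_singleton _).union (Set.finite_range _)).union (Set.finite_range _)).subset this

lemma sInf_eventTimes_mem (r : ℝ) (x : Fin n → ℝ) (c : Config n) :
    sInf (eventTimes r x c) ∈ eventTimes r x c :=
  Set.Nonempty.csInf_mem ⟨c.timeLeft, .inl rfl⟩ (finite_eventTimes r x c)

lemma sInf_eventTimes_le {τ : ℝ} (h : τ ∈ eventTimes r x c) : sInf (eventTimes r x c) ≤ τ :=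
  csInf_le (finite_eventTimes r x c).bddBelow h

lemma Valid.beforeEvents_sInf (hv : Valid r x c) : BeforeEvents r x c (sInf (eventTimes r x c)) := by
  refine ⟨?_, sInf_eventTimes_le (.inl rfl), fun j h => sInf_eventTimes_le (.inr (.inl ⟨j, h, rfl⟩)), ?_⟩
  · rcases sInf_eventTimes_mem r x c with h | ⟨j, -, h⟩ | ⟨j, k, hjk, hlt, h⟩ <;> rw [h]
    · exact hv.timeLeft_nonneg
    · exact abs_nonneg _
    · have := hv.mono (show j ≤ k from Fin.le_def.2 (by omega))
      exact div_nonneg (by linarith) (by linarith)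
  · intro j k hjk hlt
    have h := sInf_eventTimes_le (r := r) (x := x) (.inr (.inr ⟨j, k, hjk, hlt, rfl⟩))
    rwa [le_div_iff₀ (by linarith)] at h

lemma exists_firstContact (h : ∃ j k, Contact c j k) : ∃ p : Fin n × Fin n, FirstContact c p.1 p.2 := by
  classical
  obtain ⟨j₀, hj₀⟩ := h
  have hne : (Finset.univ.filter fun j => ∃ k, Contact c j k).Nonempty := ⟨j₀, by simpa using hj₀⟩
  obtain ⟨j, hj, hmin⟩ := Finset.exists_min_image _ id hne
  obtain ⟨k, hk⟩ := (Finset.mem_filter.1 hj).2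
  exact ⟨(j, k), hk, fun j' k' h' => hmin j' (by simpa using ⟨k', h'⟩)⟩

lemma Valid.tick_meet (hv : Valid r x c) (hx : StrictMono x) (h : ∃ j k, Contact c j k) :
    ∃ c', Tick r x c c' ∧ (weight c' < weight c ∨ weight c' = weight c ∧ weight' c' < weight' c) := by
  have hf := exists_firstContact h
  have hc := hf.choose_spec.1
  have hm := hv.meeting hx hc
  refine ⟨_, ⟨.meet _ _ _ hc hm, fun ω => ?_⟩, hm.weight_lt hc⟩
  unfold step; rw [dif_pos hf]

lemma not_firstContact (h : ∀ j k, ¬ Contact c j k) : ¬ ∃ p : Fin n × Fin n, FirstContact c p.1 p.2 :=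
  fun ⟨_, hp⟩ => h _ _ hp.1

/-- Every phase ends after finitely many steps. -/
theorem Valid.exists_phaseEnd (hv : Valid r x c) (hx : StrictMono x) :
    ∃ e, Relation.ReflTransGen (Tick r x) c e ∧ PhaseEnd r x e := by
  have key : ∀ (A B : ℕ) (c : Config n), Valid r x c → weight c = A → weight' c = B →
      ∃ e, Relation.ReflTransGen (Tick r x) c e ∧ PhaseEnd r x e := by
    intro A
    induction A using Nat.strong_induction_on with
    | _ A ihA =>
    intro B
    induction B using Nat.strong_induction_on with
    | _ B ihB =>
    intro c hv hA hB
    have next : ∀ c c' : Config n, Valid r x c → weight c = A → weight' c = B → Tick r x c c' →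
        (weight c' < weight c ∨ weight c' = weight c ∧ weight' c' < weight' c) →
        ∃ e, Relation.ReflTransGen (Tick r x) c e ∧ PhaseEnd r x e := by
      intro c c' hv hA hB ht hw
      have hv' := hv.micro ht.1
      rcases hw with hw | ⟨hw, hw'⟩
      · obtain ⟨e, h1, h2⟩ := ihA _ (hA ▸ hw) _ c' hv' rfl rfl
        exact ⟨e, .head ht h1, h2⟩
      · obtain ⟨e, h1, h2⟩ := ihB _ (hB ▸ hw') c' hv' (hw.trans hA) rfl
        exact ⟨e, .head ht h1, h2⟩
    -- If an event is pending, a weight drops at once or the phase is over. Otherwise one `advance`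
    -- up to the next event makes one pending without changing the weights.
    have busy : ∀ c : Config n, Valid r x c → weight c = A → weight' c = B →
        ((∃ j k, Contact c j k) ∨ (∃ j, Arrived r x c j) ∨ c.timeLeft ≤ 0) →
        ∃ e, Relation.ReflTransGen (Tick r x) c e ∧ PhaseEnd r x e := by
      intro c hv hA hB h
      by_cases hc : ∃ j k, Contact c j k
      · obtain ⟨c', ht, hw⟩ := hv.tick_meet hx hc
        exact next c c' hv hA hB ht hw
      · have hn : ∀ j k, ¬ Contact c j k := fun j k h => hc ⟨j, k, h⟩
        by_cases ha : ∃ j, Arrived r x c j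
        · refine next c (MSR.settle r x c) hv hA hB ⟨.settle, fun ω => ?_⟩
            (.inr ⟨rfl, weight'_settle ha.choose_spec⟩)
          unfold step; rw [dif_neg (not_firstContact hn), if_pos ha]
        · refine ⟨c, .refl, hn, fun j h => ha ⟨j, h⟩, ?_⟩
          rcases h with h | h | h
          · exact absurd h hc
          · exact absurd h ha
          · exact h
    by_cases h : (∃ j k, Contact c j k) ∨ (∃ j, Arrived r x c j) ∨ c.timeLeft ≤ 0
    · exact busy c hv hA hB h
    · push Not at h
      obtain ⟨hn, ha, ht⟩ := h
      have hb := hv.beforeEvents_sInf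
      have htick : Tick r x c (MSR.advance c (sInf (eventTimes r x c))) := by
        refine ⟨.advance _ hn ha hb, fun ω => ?_⟩
        unfold step
        rw [dif_neg (not_firstContact hn), if_neg (by simpa using ha), if_neg (by linarith)]
      have hv' := hv.micro htick.1
      have hvel : ∀ j, vel (MSR.advance c (sInf (eventTimes r x c))) j = vel c j := fun _ => rfl
      obtain ⟨e, h1, h2⟩ := busy _ hv' hA hB (by
        rcases sInf_eventTimes_mem r x c with h | ⟨j, hj, h⟩ | ⟨j, k, hjk, hlt, h⟩
        · right; right
          change c.timeLeft - sInf (eventTimes r x c) ≤ 0; rw [h]; simp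
        · right; left
          refine ⟨j, hj, ?_⟩
          obtain ⟨hs, hh⟩ := searching_of_ownVel hj
          have h3 := hv.ahead hs hh
          have h4 : |target r x c j - c.pos j| = (heading c j).sign * (target r x c j - c.pos j) := by
            rw [← abs_of_nonneg h3, abs_mul, Dir.abs_sign, one_mul]
          change c.pos j + sInf (eventTimes r x c) * vel c j = target r x c j
          rw [vel, hs.leader, (hs.ownVel_ne hh).1, h, h4]
          rcases (heading c j).left_or_right with h | h <;> rw [h] <;> simp
        · left
          refine ⟨j, k, hjk, ?_, hlt⟩
          change c.pos j + sInf (eventTimes r x c) * vel c j =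
            c.pos k + sInf (eventTimes r x c) * vel c k
          have h5 : sInf (eventTimes r x c) * (vel c j - vel c k) = c.pos k - c.pos j := by
            rw [h, div_mul_cancel₀ _ (sub_pos.2 hlt).ne']
          linarith)
      exact ⟨e, .head htick h1, h2⟩
  exact key _ _ c hv rfl rfl

end MSR

namespace MSR

variable {n : ℕ} {r : ℝ} {x : Fin n → ℝ} {c c' : Config n} {i j k a b : Fin n} {ω : Coins n}

/-! ### The search radii -/

lemma f_natCast (r : ℝ) (m : ℕ) : f r (m : ℤ) = r ^ m := by
  unfold f; rw [if_neg (by omega), zpow_natCast]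

lemma f_even (r : ℝ) (i : ℕ) : f r (2 * (i : ℤ)) = r ^ (2 * i) := by
  rw [← f_natCast]; push_cast; rfl

lemma f_odd (r : ℝ) (i : ℕ) : f r (2 * (i : ℤ) + 1) = r ^ (2 * i + 1) := by
  rw [← f_natCast]; push_cast; rfl

lemma f_odd_pred_zero (r : ℝ) : f r (2 * ((0 : ℕ) : ℤ) - 1) = 0 := by
  unfold f; rw [if_pos (by norm_num)]

lemma f_odd_pred_succ (r : ℝ) (i : ℕ) : f r (2 * ((i + 1 : ℕ) : ℤ) - 1) = r ^ (2 * i + 1) := by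
  rw [← f_odd]; congr 1; push_cast; ring

lemma reach_one (r : ℝ) (i : ℕ) : reach r i .one = r ^ (2 * i) := f_even r i
lemma reach_two (r : ℝ) (i : ℕ) : reach r i .two = r ^ (2 * i + 1) := f_odd r i
lemma phaseTime_two (r : ℝ) (i : ℕ) : phaseTime r i .two = r ^ (2 * i) + r ^ (2 * i + 1) := by
  simp only [phaseTime]; rw [f_even, f_odd]
lemma phaseTime_one_zero (r : ℝ) : phaseTime r 0 .one = 1 := by
  simp only [phaseTime]; rw [f_even, f_odd_pred_zero]; norm_num
lemma phaseTime_one_succ (r : ℝ) (i : ℕ) :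
    phaseTime r (i + 1) .one = r ^ (2 * i + 2) + r ^ (2 * i + 1) := by
  simp only [phaseTime]; rw [f_even, f_odd_pred_succ]; ring

/-! ### The configurations at the ends of the phases -/

open Classical in
/-- The configuration at the end of the present phase. -/
noncomputable def phaseEndOf (r : ℝ) (x : Fin n → ℝ) (c : Config n) : Config n :=
  if h : ∃ e, Relation.ReflTransGen (Tick r x) c e ∧ PhaseEnd r x e then h.choose else c

lemma Valid.phaseEndOf_spec (hv : Valid r x c) (hx : StrictMono x) :
    Relation.ReflTransGen (Tick r x) c (phaseEndOf r x c) ∧ PhaseEnd r x (phaseEndOf r x c) := by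
  have h := hv.exists_phaseEnd hx
  rw [phaseEndOf, dif_pos h]; exact h.choose_spec

/-- The beginning of phase two. -/
noncomputable def phaseTwo (r : ℝ) (c : Config n) : Config n :=
  { c with
    phase := .two
    timeLeft := phaseTime r c.round .two
    halted := fun _ => false }

/-- The configuration at the beginning of phase two of the present round. -/
noncomputable def middle (r : ℝ) (x : Fin n → ℝ) (c : Config n) : Config n :=
  phaseTwo r (phaseEndOf r x c)

/-- The configuration at the end of the present round. -/
noncomputable def roundEnd (r : ℝ) (x : Fin n → ℝ) (c : Config n) : Config n :=
  phaseEndOf r x (middle r x c)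

/-- The configuration at the beginning of round `i`. -/
noncomputable def start (r : ℝ) (x : Fin n → ℝ) (ω : Coins n) : ℕ → Config n
  | 0 => init r x ω
  | i + 1 =>
    let e := roundEnd r x (start r x ω i)
    startRound r ω (i + 1) e.pos e.dist e.mode

/-- The present configuration is reached within the phase from `c`. -/
abbrev Path (r : ℝ) (x : Fin n → ℝ) : Config n → Config n → Prop :=
  Relation.ReflTransGen (Tick r x)

lemma Path.valid (h : Path r x c c') (hv : Valid r x c) : Valid r x c' := by
  induction h with
  | refl => exact hv
  | tail _ ht ih => exact ih.micro ht.1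

lemma Path.const {α : Type*} {g : Config n → α} (hg : ∀ c c', Micro r x c c' → g c' = g c)
    (h : Path r x c c') : g c' = g c := by
  induction h with
  | refl => rfl
  | tail _ ht ih => rw [hg _ _ ht.1, ih]

lemma Path.round_eq (h : Path r x c c') : c'.round = c.round := h.const fun _ _ => Micro.round_eq
lemma Path.phase_eq (h : Path r x c c') : c'.phase = c.phase := h.const fun _ _ => Micro.phase_eq

lemma Meeting.dist_eq (h : Meeting c j k c') : c'.dist = c.dist := by cases h <;> rfl
lemma Meeting.pos_eq (h : Meeting c j k c') : c'.pos = c.pos := by cases h <;> rfl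
lemma Meeting.timeLeft_eq (h : Meeting c j k c') : c'.timeLeft = c.timeLeft := by cases h <;> rfl

/-- Speeds are at most one, so the distance travelled grows by no more than the time that passes.
All cost bounds come from this. -/
lemma Micro.clock (h : Micro r x c c') (j : Fin n) :
    c'.dist j + c'.timeLeft ≤ c.dist j + c.timeLeft := by
  cases h with
  | meet j k _ hc hm => rw [hm.dist_eq, hm.timeLeft_eq]
  | settle => exact le_rfl
  | advance τ hn ha hτ =>
    simp only [MSR.advance]
    have := abs_vel_le c j
    have := mul_le_mul_of_nonneg_left this hτ.1
    linarith

lemma Path.clock (h : Path r x c c') (j : Fin n) :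
    c'.dist j + c'.timeLeft ≤ c.dist j + c.timeLeft := by
  induction h with
  | refl => exact le_rfl
  | tail _ ht ih => exact (ht.1.clock j).trans ih

lemma Path.run (h : Path r x c c') (s : ℕ) (hs : run r x ω s = c) : ∃ s', run r x ω s' = c' := by
  induction h with
  | refl => exact ⟨s, hs⟩
  | tail _ ht ih =>
    obtain ⟨s', hs'⟩ := ih
    refine ⟨s' + 1, ?_⟩
    unfold MSR.run at hs' ⊢
    rw [Function.iterate_succ_apply', hs', ht.2]

lemma PhaseEnd.step (h : PhaseEnd r x c) : step r x ω c = nextPhase r ω c := by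
  unfold MSR.step
  rw [dif_neg (not_firstContact h.1), if_neg (not_exists.2 h.2.1), if_pos h.2.2]

lemma PhaseEnd.run (h : PhaseEnd r x c) (s : ℕ) (hs : run r x ω s = c) :
    MSR.run r x ω (s + 1) = nextPhase r ω c := by
  unfold MSR.run at hs ⊢
  rw [Function.iterate_succ_apply', hs, h.step]

lemma Valid.init (hx : StrictMono x) : Valid r x (init r x ω) := by
  have h1 : reach r 0 .one = 1 := by rw [reach_one]; norm_num
  have hpos : ∀ p, (MSR.init r x ω).pos p = x p := fun _ => rfl
  have hl : ∀ p, leader (MSR.init r x ω) p = p := fun p => leader_single rfl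
  have hlm : ∀ p, lmode (MSR.init r x ω) p = .single := fun p => lmode_single rfl
  have ht : ∀ p, (heading (MSR.init r x ω) p).sign *
      (target r x (MSR.init r x ω) p - (MSR.init r x ω).pos p) = 1 := by
    intro p
    have : target r x (MSR.init r x ω) p =
      x p + (heading (MSR.init r x ω) p).sign * reach r 0 .one := rfl
    rw [this, h1, hpos]
    have := Dir.sign_mul_self (heading (MSR.init r x ω) p)
    linarith
  have htl : (MSR.init r x ω).timeLeft = 1 := phaseTime_one_zero r
  have hr : (MSR.init r x ω).round = 0 := rfl
  have hp : (MSR.init r x ω).phase = .one := rfl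
  refine ⟨hx.monotone, ?_, ?_, ?_, ?_, ?_, ?_, ?_, ?_, ?_, ?_, ?_⟩
  · intro p q h; simp [MSR.init, startRound] at h
  · intro p q h; simp [MSR.init, startRound] at h
  · intro p q s h1 h2 h3; rw [hl, hl] at *; subst h3; exact le_antisymm h2 h1
  · intro p q _; right; rw [hlm, hlm]; rfl
  · intro p _; rw [hlm]; rfl
  · intro p _; rw [hlm]; rfl
  · intro p _; rw [hpos, hr, hp, h1]; simp
  · intro p _ _; rw [ht]; norm_num
  · intro p _ _; rw [ht, htl]
  · intro p _ h; simp [MSR.init, startRound] at h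
  · rw [htl]; norm_num

lemma Valid.phaseTwo (hv : Valid r x c) (hr : 1 ≤ r) (hp : c.phase = .one) :
    Valid r x (phaseTwo r c) := by
  refine hv.restart rfl rfl rfl ?_ ?_ ?_
  · rw [hp]; change reach r c.round .one ≤ reach r c.round .two
    rw [reach_one, reach_two]; exact pow_le_pow_right₀ hr (by omega)
  · rw [hp]; change phaseTime r c.round .two = reach r c.round .two + reach r c.round .one
    rw [reach_one, reach_two, phaseTime_two]; ring
  · change 0 ≤ phaseTime r c.round .two
    rw [phaseTime_two]; positivity

lemma Valid.startRound (hv : Valid r x c) (hr : 1 ≤ r) (hp : c.phase = .two) :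
    Valid r x (startRound r ω (c.round + 1) c.pos c.dist c.mode) := by
  refine hv.restart rfl rfl rfl ?_ ?_ ?_
  · rw [hp]; change reach r c.round .two ≤ reach r (c.round + 1) .one
    rw [reach_one, reach_two]; exact pow_le_pow_right₀ hr (by omega)
  · rw [hp]; change phaseTime r (c.round + 1) .one = reach r (c.round + 1) .one + reach r c.round .two
    rw [reach_one, reach_two, phaseTime_one_succ]; ring
  · change 0 ≤ phaseTime r (c.round + 1) .one
    rw [phaseTime_one_succ]; positivity

/-! ### Beginnings of rounds along an execution, and the cost of gathering in a given round -/

/-- A configuration at the beginning of a round. -/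
structure RoundStart (r : ℝ) (x : Fin n → ℝ) (c : Config n) : Prop where
  valid : Valid r x c
  phase : c.phase = .one
  halted : c.halted = fun _ => false
  timeLeft : c.timeLeft = phaseTime r c.round .one
  dir : ∀ {j δ}, c.mode j = .bound δ → c.dir j = δ

section
variable (hr : 1 ≤ r) (hx : StrictMono x) (hc : RoundStart r x c)
include hx hc

lemma RoundStart.path : Path r x c (phaseEndOf r x c) := (hc.valid.phaseEndOf_spec hx).1
lemma RoundStart.phaseEnd : PhaseEnd r x (phaseEndOf r x c) := (hc.valid.phaseEndOf_spec hx).2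
lemma RoundStart.valid_phaseEndOf : Valid r x (phaseEndOf r x c) := (hc.path hx).valid hc.valid

lemma RoundStart.phase_phaseEndOf : (phaseEndOf r x c).phase = .one := by
  rw [(hc.path hx).phase_eq, hc.phase]

lemma RoundStart.round_middle : (middle r x c).round = c.round := (hc.path hx).round_eq

include hr

lemma RoundStart.valid_middle : Valid r x (middle r x c) :=
  (hc.valid_phaseEndOf hx).phaseTwo hr (hc.phase_phaseEndOf hx)

lemma RoundStart.path_middle : Path r x (middle r x c) (roundEnd r x c) :=
  ((hc.valid_middle hr hx).phaseEndOf_spec hx).1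
lemma RoundStart.phaseEnd_roundEnd : PhaseEnd r x (roundEnd r x c) :=
  ((hc.valid_middle hr hx).phaseEndOf_spec hx).2
lemma RoundStart.valid_roundEnd : Valid r x (roundEnd r x c) :=
  (hc.path_middle hr hx).valid (hc.valid_middle hr hx)
lemma RoundStart.phase_roundEnd : (roundEnd r x c).phase = .two := (hc.path_middle hr hx).phase_eq
lemma RoundStart.round_roundEnd : (roundEnd r x c).round = c.round := by
  rw [(hc.path_middle hr hx).round_eq, hc.round_middle hx]

end

lemma start_succ (i : ℕ) : start r x ω (i + 1) = startRound r ω (i + 1)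
    (roundEnd r x (start r x ω i)).pos (roundEnd r x (start r x ω i)).dist
    (roundEnd r x (start r x ω i)).mode := rfl

@[simp] lemma start_round (i : ℕ) : (start r x ω i).round = i := by cases i <;> rfl

lemma start_dir (i : ℕ) (j : Fin n) :
    (start r x ω i).dir j = roundDir ω i j ((start r x ω i).mode j) := by cases i <;> rfl

lemma roundStart_start (hr : 1 ≤ r) (hx : StrictMono x) (ω : Coins n) (i : ℕ) :
    RoundStart r x (start r x ω i) := by
  induction i with
  | zero =>
    refine ⟨.init hx, rfl, rfl, rfl, ?_⟩
    intro j δ h; simp [start, init, startRound] at h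
  | succ i ih =>
    have h1 := ih.valid_roundEnd hr hx
    have h2 := ih.round_roundEnd hr hx
    have h3 := h1.startRound (ω := ω) hr (ih.phase_roundEnd hr hx)
    rw [h2, start_round] at h3
    refine ⟨h3, rfl, rfl, rfl, ?_⟩
    intro j δ h
    rw [start_dir, h]; rfl

/-- The time at which round `i` begins. -/
noncomputable def beginTime (r : ℝ) : ℕ → ℝ
  | 0 => 0
  | i + 1 => beginTime r i + phaseTime r i .one + phaseTime r i .two

lemma start_dist_le (hr : 1 ≤ r) (hx : StrictMono x) (ω : Coins n) (i : ℕ) (j : Fin n) :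
    (start r x ω i).dist j ≤ beginTime r i := by
  induction i with
  | zero => exact le_rfl
  | succ i ih =>
    have hs := roundStart_start hr hx ω i
    have h1 := (hs.path hx).clock j
    have h2 := (hs.path_middle hr hx).clock j
    have h3 := (hs.valid_phaseEndOf hx).timeLeft_nonneg
    have h4 := (hs.valid_roundEnd hr hx).timeLeft_nonneg
    have h5 : (middle r x (start r x ω i)).dist j = (phaseEndOf r x (start r x ω i)).dist j := rfl
    have h6 : (middle r x (start r x ω i)).timeLeft =
      phaseTime r (middle r x (start r x ω i)).round .two := rfl
    rw [hs.round_middle hx, start_round] at h6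
    rw [hs.timeLeft, start_round] at h1
    change (roundEnd r x (start r x ω i)).dist j ≤ _
    rw [beginTime]; linarith

lemma exists_run_start (hr : 1 ≤ r) (hx : StrictMono x) (ω : Coins n) (i : ℕ) :
    ∃ s, run r x ω s = start r x ω i := by
  induction i with
  | zero => exact ⟨0, rfl⟩
  | succ i ih =>
    obtain ⟨s, h⟩ := ih
    have hs := roundStart_start hr hx ω i
    obtain ⟨s1, h1⟩ := (hs.path hx).run s h
    have h2 := (hs.phaseEnd hx).run s1 h1
    have h3 : nextPhase r ω (phaseEndOf r x (start r x ω i)) = middle r x (start r x ω i) := by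
      unfold nextPhase; rw [hs.phase_phaseEndOf hx]; rfl
    rw [h3] at h2
    obtain ⟨s4, h4⟩ := (hs.path_middle hr hx).run _ h2
    have h5 := (hs.phaseEnd_roundEnd hr hx).run s4 h4
    refine ⟨_, h5.trans ?_⟩
    unfold nextPhase; rw [hs.phase_roundEnd hr hx]
    simp only [hs.round_roundEnd hr hx, start_round, start_succ]

/-- Gathering during phase two of round `i`. -/
lemma cost_le_of_gathered (hr : 1 ≤ r) (hx : StrictMono x) (ω : Coins n) (i : ℕ) {c : Config n}
    (hp : Path r x (middle r x (start r x ω i)) c) (hg : Gathered c) (j : Fin n) :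
    Rendezvous r x ω ∧ cost r x ω j ≤ ENNReal.ofReal
      (beginTime r i + phaseTime r i .one + (phaseTime r i .two - c.timeLeft)) := by
  obtain ⟨s, h⟩ := exists_run_start hr hx ω i
  have hs := roundStart_start hr hx ω i
  obtain ⟨s1, h1⟩ := (hs.path hx).run s h
  have h2 := (hs.phaseEnd hx).run s1 h1
  have h3 : nextPhase r ω (phaseEndOf r x (start r x ω i)) = middle r x (start r x ω i) := by
    unfold nextPhase; rw [hs.phase_phaseEndOf hx]; rfl
  rw [h3] at h2
  obtain ⟨s4, h4⟩ := hp.run _ h2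
  subst h4
  refine ⟨⟨s4, hg⟩, (iInf₂_le s4 hg).trans (ENNReal.ofReal_le_ofReal ?_)⟩
  have c1 := (hs.path hx).clock j
  have c2 := hp.clock j
  have c3 := (hs.valid_phaseEndOf hx).timeLeft_nonneg
  have c4 := start_dist_le hr hx ω i j
  have h5 : (middle r x (start r x ω i)).dist j = (phaseEndOf r x (start r x ω i)).dist j := rfl
  have h6 : (middle r x (start r x ω i)).timeLeft =
    phaseTime r (middle r x (start r x ω i)).round .two := rfl
  rw [hs.round_middle hx, start_round] at h6
  rw [hs.timeLeft, start_round] at c1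
  linarith

/-- The states at the beginning of round `i` depend only on the coins of the earlier rounds. -/
lemma start_congr {ω ω' : Coins n} : ∀ {i : ℕ}, (∀ m < i, ∀ j, ω (m, j) = ω' (m, j)) →
    (start r x ω i).pos = (start r x ω' i).pos ∧ (start r x ω i).dist = (start r x ω' i).dist ∧
      (start r x ω i).mode = (start r x ω' i).mode
  | 0, _ => ⟨rfl, rfl, rfl⟩
  | i + 1, h => by
    have ih := start_congr (i := i) fun m hm => h m (by omega)
    have h1 : start r x ω i = start r x ω' i := by
      have hd : (start r x ω i).dir = (start r x ω' i).dir := by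
        funext j; rw [start_dir, start_dir, ih.2.2]
        unfold roundDir; rw [h i (by omega) j]
      cases i with
      | zero =>
        simp only [start, init, startRound] at *
        rw [hd]
      | succ i =>
        simp only [start, startRound] at *
        rw [hd, ih.1, ih.2.1, ih.2.2]
    rw [start_succ, start_succ, h1]
    exact ⟨rfl, rfl, rfl⟩

end MSR

namespace MSR

variable {n : ℕ} {r : ℝ} {x : Fin n → ℝ} {c c' e m e' : Config n} {i j k a b : Fin n} {ω : Coins n}

/-! ### Sequences of micro-steps -/

/-- The present configuration is reached from `c` by micro-steps. -/
abbrev Micros (r : ℝ) (x : Fin n → ℝ) : Config n → Config n → Prop :=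
  Relation.ReflTransGen (Micro r x)

lemma Path.micros (h : Path r x c c') : Micros r x c c' := Relation.ReflTransGen.mono (fun _ _ h => h.1) _ _ h

lemma Micros.valid (h : Micros r x c c') (hv : Valid r x c) : Valid r x c' := by
  induction h with
  | refl => exact hv
  | tail _ ht ih => exact ih.micro ht

lemma Micros.const {α : Type*} {g : Config n → α} (hg : ∀ c c', Micro r x c c' → g c' = g c)
    (h : Micros r x c c') : g c' = g c := by
  induction h with
  | refl => rfl
  | tail _ ht ih => rw [hg _ _ ht, ih]

lemma Micros.round_eq (h : Micros r x c c') : c'.round = c.round := h.const fun _ _ => Micro.round_eq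
lemma Micros.phase_eq (h : Micros r x c c') : c'.phase = c.phase := h.const fun _ _ => Micro.phase_eq
lemma Micros.dir_eq (h : Micros r x c c') : c'.dir = c.dir := h.const fun _ _ => Micro.dir_eq

lemma Micros.mir (h : Micros r x c c') : Micros r (mirX x) (MSR.mir c) (MSR.mir c') := by
  induction h with
  | refl => exact .refl
  | tail _ ht ih => exact ih.tail ht.mir

lemma setMode_mode_of_ne {m : Mode n} (h : i ≠ a) : (setMode c a m).mode i = c.mode i :=
  Function.update_of_ne h _ _

/-- Robots never become single again. -/
lemma Micro.single (h : Micro r x c c') (hj : c'.mode j = .single) : c.mode j = .single := by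
  cases h with
  | settle => exact hj
  | advance τ hn ha hτ => exact hj
  | meet p q _ hc hm =>
    cases hm with
    | pair hp hq _ _ =>
      by_cases h1 : j = q
      · rw [h1]; exact hq
      by_cases h2 : j = p
      · rw [h2]; exact hp
      simpa [Function.update_of_ne h1, Function.update_of_ne h2] using hj
    | stickRight b δ hp hq hb =>
      by_cases h2 : j = p
      · subst h2; simp [setMode] at hj
      simpa [setMode, Function.update_of_ne h2] using hj
    | stickLeft b δ hp hq hb =>
      by_cases h2 : j = q
      · subst h2; simp [setMode] at hj
      simpa [setMode, Function.update_of_ne h2] using hj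
    | pause a b hj' hk ha hb => exact hj
    | merge a b hj' hk ha hb =>
      simp only at hj
      split_ifs at hj; exact hj

lemma Micros.single (h : Micros r x c c') (hj : c'.mode j = .single) : c.mode j = .single := by
  induction h with
  | refl => exact hj
  | tail _ ht ih => exact ih (ht.single hj)

/-! ### The block of the leftmost boundary robot -/

/-- Robot `a` is bound to the left, and all robots on its left are single or stuck to it. -/
structure LeftBlock (c : Config n) (a : Fin n) : Prop where
  bound : c.mode a = .bound .left
  below : ∀ j < a, c.mode j = .single ∨ c.mode j = .stuck a

lemma LeftBlock.leader_below (h : LeftBlock c a) (hj : j ≤ a) :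
    leader c j = a ∨ leader c j = j ∧ c.mode j = .single := by
  rcases hj.lt_or_eq with h1 | h1
  · rcases h.below j h1 with h2 | h2
    · exact .inr ⟨leader_single h2, h2⟩
    · exact .inl (leader_stuck h2)
  · left; rw [h1, leader_bound h.bound]

lemma LeftBlock.bound_above {δ : Dir} (h : LeftBlock c a) (hb : c.mode b = .bound δ) (hne : b ≠ a) :
    a < b := by
  by_contra hlt
  rcases h.below b (lt_of_le_of_ne (not_lt.1 hlt) hne) with h1 | h1 <;> rw [hb] at h1 <;> simp at h1

/-- The leftmost robot bound to the left stays so if no single robots meet on its left. -/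
lemma LeftBlock.micro (h : LeftBlock c a) (hv : Valid r x c) (hm : Micro r x c c')
    (hn : ∀ j k, Contact c j k → c.mode j = .single → c.mode k = .single → k < a →
      c'.mode j = .single) : LeftBlock c' a := by
  cases hm with
  | settle => exact ⟨h.bound, h.below⟩
  | advance τ _ _ hτ => exact ⟨h.bound, h.below⟩
  | meet p q _ hc hm =>
    cases hm with
    | pair hp hq _ _ =>
      -- The meeting would bind `p`, which `hn` excludes. Stating `hn` through the outcome `c'`
      -- makes it usable when a robot is only known to be single later.
      have h1 : ¬ q < a := fun hlt => by
        have := hn p q hc hp hq hlt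
        simp [Function.update_of_ne hc.lt.ne] at this
      have hqa : a ≠ q := by rintro rfl; rw [h.bound] at hq; simp at hq
      have hpa : a ≠ p := by rintro rfl; rw [h.bound] at hp; simp at hp
      have hq' : a < q := lt_of_le_of_ne (not_lt.1 h1) hqa
      have hp' : a < p := lt_of_le_of_ne (Fin.le_def.2 (by
        have := hc.1; have := Fin.lt_def.1 hq'; omega)) hpa
      have key : ∀ i ≤ a, Function.update (Function.update c.mode p (.bound .left)) q (.bound .right) i
          = c.mode i := fun i hi => by
        rw [Function.update_of_ne (hi.trans_lt hq').ne, Function.update_of_ne (hi.trans_lt hp').ne]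
      exact ⟨(key a le_rfl).trans h.bound, fun j hj => by simp only [key j hj.le]; exact h.below j hj⟩
    | stickRight b δ hp hq hb =>
      have hpa : a ≠ p := by rintro rfl; rw [h.bound] at hp; simp at hp
      refine ⟨by rw [setMode_mode_of_ne hpa]; exact h.bound, fun j hj => ?_⟩
      by_cases hjp : j = p
      · subst hjp
        have hqa : q ≤ a := Fin.le_def.2 (by have := hc.1; have := Fin.lt_def.1 hj; omega)
        rcases h.leader_below hqa with h2 | ⟨h2, h3⟩
        · right; simp [setMode, ← hq, h2]
        · rw [← hq, h2, h3] at hb; simp at hb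
      · rw [setMode_mode_of_ne hjp]; exact h.below j hj
    | stickLeft b δ hq hp hb =>
      have hqa : a ≠ q := by rintro rfl; rw [h.bound] at hq; simp at hq
      refine ⟨by rw [setMode_mode_of_ne hqa]; exact h.bound, fun j hj => ?_⟩
      by_cases hjq : j = q
      · subst hjq
        exfalso
        rcases h.leader_below (hc.lt.le.trans hj.le) with h2 | ⟨h2, h3⟩
        · rw [← hp, h2, h.bound] at hb
          rcases h.below j hj with h4 | h4 <;> rw [h4] at hq <;> simp at hq
          rw [hq] at hb; simp at hb
        · rw [← hp, h2, h3] at hb; simp at hb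
      · rw [setMode_mode_of_ne hjq]; exact h.below j hj
    | pause _ _ _ _ _ _ => exact ⟨h.bound, h.below⟩
    | merge b b' hp hq hb hb' =>
      have hba : b ≠ a := by rintro rfl; rw [h.bound] at hb; simp at hb
      have hlt := h.bound_above hb hba
      have hb'a : b' ≠ a := by
        rintro rfl
        have h1 : b' < p := by
          by_contra hlt'
          rcases h.leader_below (not_lt.1 hlt') with h2 | ⟨h2, h3⟩
          · exact hba (hp.symm.trans h2)
          · rw [← hp, h2, h3] at hb; simp at hb
        have := hv.between' (i := q) (j := p) (by rw [hq]; exact h1.le) hc.lt.le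
        exact hc.leader_ne this
      have key : ∀ i ≤ a, (if leader c i = b ∨ leader c i = b' then Mode.internal else c.mode i)
          = c.mode i := fun i hi => by
        rw [if_neg]
        rintro (h1 | h1) <;> rcases h.leader_below hi with h2 | ⟨h2, h3⟩
        · exact hba (h1.symm.trans h2)
        · rw [← h1, h2, h3] at hb; simp at hb
        · exact hb'a (h1.symm.trans h2)
        · rw [← h1, h2, h3] at hb'; simp at hb'
      exact ⟨(key a le_rfl).trans h.bound, fun j hj => by simp only [key j hj.le]; exact h.below j hj⟩

/-- A single robot heading left is never in contact with its right neighbour. -/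
lemma Valid.not_contact_of_left (hv : Valid r x c) (hx : StrictMono x) (hj : c.mode j = .single)
    (hd : heading c j = .left) : ¬ Contact c j k := by
  intro hc
  have lj := leader_single hj
  have hne := hc.leader_ne
  have hlt : j < leader c k := by
    by_contra h
    exact hne (hv.between' (not_lt.1 h) hc.lt.le)
  have hh := hc.halted_of_left (by rw [lj]; exact .inl hj) (by rw [lj]; exact hd)
  rw [lj] at hh
  have hvel := hc.2.2
  have vj : vel c j = 0 := by rw [Searching.vel (.inl hj), hh]; simp
  rw [vj] at hvel
  have hne0 : ownVel c (leader c k) ≠ 0 := hvel.ne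
  obtain ⟨hs, hh'⟩ := searching_of_ownVel hne0
  have h1 : heading c (leader c k) = .left := by
    rcases (heading c (leader c k)).left_or_right with h | h
    · exact h
    · rw [vel, hs.ownVel, hh', h] at hvel; simp at hvel; linarith
  have h2 := (hv.target_left hs hh' h1).1
  have h3 := hv.arrived (.inl hj) hh
  have h4 := hc.2.1
  rw [hv.pos_leader k] at h4
  simp only [target, hd, h1] at h2 h3
  have := hx hlt
  simp at h2 h3; linarith

/-! ### Rounds -/

/-- The configurations at the beginnings and ends of the two phases of a round. -/
structure IsRound (r : ℝ) (x : Fin n → ℝ) (c e m e' : Config n) : Prop where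
  valid : Valid r x c
  phase : c.phase = .one
  bound_dir : ∀ {j δ}, c.mode j = .bound δ → c.dir j = δ
  path : Micros r x c e
  ended : PhaseEnd r x e
  middle : m = phaseTwo r e
  path' : Micros r x m e'
  ended' : PhaseEnd r x e'

/-- `IsRound` is phrased with `Micros` rather than `Path` in order to be closed under reflection. -/
lemma RoundStart.isRound (hr : 1 ≤ r) (hx : StrictMono x) (h : RoundStart r x c) :
    IsRound r x c (phaseEndOf r x c) (middle r x c) (roundEnd r x c) :=
  ⟨h.valid, h.phase, h.dir, (h.path hx).micros, h.phaseEnd hx, rfl, (h.path_middle hr hx).micros,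
    h.phaseEnd_roundEnd hr hx⟩

namespace IsRound

lemma mir (h : IsRound r x c e m e') :
    IsRound r (mirX x) (MSR.mir c) (MSR.mir e) (MSR.mir m) (MSR.mir e') := by
  refine ⟨h.valid.mir, h.phase, ?_, h.path.mir, h.ended.mir, ?_, h.path'.mir, h.ended'.mir⟩
  · intro j δ hj
    rw [mir_mode, Mode.mir_eq_bound] at hj
    rw [mir_dir, h.bound_dir hj, Dir.opp_opp]
  · rw [h.middle]; rfl

variable (h : IsRound r x c e m e')
include h

lemma valid_e : Valid r x e := h.path.valid h.valid
lemma phase_e : e.phase = .one := by rw [h.path.phase_eq, h.phase]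
lemma round_e : e.round = c.round := h.path.round_eq
lemma dir_e : e.dir = c.dir := h.path.dir_eq
lemma mode_m : m.mode = e.mode := by rw [h.middle]; rfl
lemma pos_m : m.pos = e.pos := by rw [h.middle]; rfl
lemma dir_m : m.dir = c.dir := by rw [h.middle, ← h.dir_e]; rfl
lemma round_m : m.round = c.round := by rw [h.middle, ← h.round_e]; rfl
lemma phase_m : m.phase = .two := by rw [h.middle]; rfl
lemma valid_m (hr : 1 ≤ r) : Valid r x m := by rw [h.middle]; exact h.valid_e.phaseTwo hr h.phase_e
lemma valid_e' (hr : 1 ≤ r) : Valid r x e' := h.path'.valid (h.valid_m hr)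
lemma heading_one (hm : Micros r x c c') (j : Fin n) : heading c' j = c.dir j := by
  rw [heading_congr hm.phase_eq hm.dir_eq, heading, h.phase]
lemma heading_two (hm : Micros r x m c') (j : Fin n) : heading c' j = (c.dir j).opp := by
  rw [heading_congr hm.phase_eq hm.dir_eq, heading, h.phase_m, h.dir_m]
lemma target_one (hm : Micros r x c c') (j : Fin n) :
    target r x c' j = x j + (c.dir j).sign * r ^ (2 * c.round) := by
  rw [target, h.heading_one hm, hm.phase_eq, hm.round_eq, h.phase, reach_one]
lemma target_two (hm : Micros r x m c') (j : Fin n) :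
    target r x c' j = x j - (c.dir j).sign * r ^ (2 * c.round + 1) := by
  rw [target, h.heading_two hm, hm.phase_eq, hm.round_eq, h.phase_m, h.round_m, reach_two]; simp; ring

lemma single_e (hj : e'.mode j = .single) : e.mode j = .single := by
  rw [← h.mode_m]; exact h.path'.single hj

lemma single_c (hj : e'.mode j = .single) : c.mode j = .single := h.path.single (h.single_e hj)

lemma pos_e (hj : e.mode j = .single ∨ e.mode j = .bound (c.dir j)) :
    e.pos j = x j + (c.dir j).sign * r ^ (2 * c.round) := by
  rw [h.ended.pos_eq h.valid_e (by rw [h.heading_one h.path]; exact hj), h.target_one h.path]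

lemma pos_e' (hr : 1 ≤ r) (hj : e'.mode j = .single ∨ e'.mode j = .bound (c.dir j).opp) :
    e'.pos j = x j - (c.dir j).sign * r ^ (2 * c.round + 1) := by
  rw [h.ended'.pos_eq (h.valid_e' hr) (by rw [h.heading_two h.path']; exact hj),
    h.target_two h.path']

/-- Both robots would end phase one at their destinations, which have crossed because the gap is
smaller than twice the radius. -/
lemma dir_ne_right_left (hjk : j < k) (hj : e.mode j = .single) (hk : e.mode k = .single)
    (hgap : x k - x j < 2 * r ^ (2 * c.round)) : ¬ (c.dir j = .right ∧ c.dir k = .left) := by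
  rintro ⟨dj, dk⟩
  have h1 := h.pos_e (.inl hj)
  have h2 := h.pos_e (.inl hk)
  have h3 := h.valid_e.mono hjk.le
  rw [dj] at h1; rw [dk] at h2; simp at h1 h2; linarith

lemma dir_ne_left_right (hr : 1 ≤ r) (hjk : j < k) (hj : e'.mode j = .single)
    (hk : e'.mode k = .single ∨ e'.mode k = .bound (c.dir k).opp)
    (hgap : x k - x j < 2 * r ^ (2 * c.round)) : ¬ (c.dir j = .left ∧ c.dir k = .right) := by
  rintro ⟨dj, dk⟩
  have h1 := h.pos_e' hr (.inl hj)
  have h2 := h.pos_e' hr hk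
  have h3 := (h.valid_e' hr).mono hjk.le
  have h4 : r ^ (2 * c.round) ≤ r ^ (2 * c.round + 1) := pow_le_pow_right₀ hr (by omega)
  rw [dj] at h1; rw [dk] at h2; simp at h1 h2; linarith

/-- If two neighbours are single at the end of the round, then they searched in the same
direction. -/
lemma dir_eq (hr : 1 ≤ r) (hjk : j < k) (hj : e'.mode j = .single)
    (hk : e'.mode k = .single) (hgap : x k - x j < 2 * r ^ (2 * c.round)) : c.dir j = c.dir k := by
  have h1 := h.dir_ne_right_left hjk (h.single_e hj) (h.single_e hk) hgap
  have h2 := h.dir_ne_left_right hr hjk hj (.inl hk) hgap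
  rcases (c.dir j).left_or_right with dj | dj <;> rcases (c.dir k).left_or_right with dk | dk <;>
    simp_all

/-- The leftmost pair of neighbours searching towards each other in phase one: its left member
becomes bound to the left. -/
lemma leftBlock_e (hx : StrictMono x) (hk : k.val = j.val + 1) (hs : ∀ i ≤ k, c.mode i = .single)
    (hd : ∀ p q : Fin n, q.val = p.val + 1 → q ≤ j → ¬ (c.dir p = .right ∧ c.dir q = .left))
    (dk : c.dir k = .left) (dj : c.dir j = .right)
    (hgap : x k - x j < 2 * r ^ (2 * c.round)) : LeftBlock e j := by
  have hjk : j < k := Fin.lt_def.2 (by omega)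
  -- Until `j` and `k` meet, all robots up to `k` remain single: `k` heads left and so is in no
  -- contact on its right, and no pair further left searches towards each other.
  have key : ∀ c', Micros r x c c' → (∀ i ≤ k, c'.mode i = .single) ∨ LeftBlock c' j := by
    intro c' hm
    induction hm with
    | refl => exact .inl hs
    | @tail c' c'' hm hstep ih =>
      have hv := Micros.valid hm h.valid
      have hd' : ∀ p q, Contact c' p q → c'.mode p = .single → c'.mode q = .single → ¬ q ≤ j := by
        intro p q hc hp hq hqj
        obtain ⟨d1, d2⟩ := hv.heading_of_contact hx hc hp hq
        rw [h.heading_one hm] at d1 d2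
        exact hd p q hc.1 hqj ⟨d1, d2⟩
      rcases ih with ih | ih
      · cases hstep with
        | settle => exact .inl ih
        | advance τ _ _ hτ => exact .inl ih
        | meet p q _ hc hmeet =>
          by_cases hpk : p ≤ k
          · have hpk' : p ≠ k := by
              rintro rfl
              exact hv.not_contact_of_left hx (ih _ le_rfl) (by rw [h.heading_one hm, dk]) hc
            have hqk : q ≤ k := Fin.le_def.2 (by
              have := hc.1; have := Fin.lt_def.1 (lt_of_le_of_ne hpk hpk'); omega)
            have mp := ih p hpk
            have mq := ih q hqk
            have hqj := hd' p q hc mp mq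
            have e1 : q = k := le_antisymm hqk (Fin.le_def.2 (by
              have := Fin.lt_def.1 (not_le.1 hqj); omega))
            have e2 : p = j := Fin.ext (by have := hc.1; rw [e1] at this; omega)
            subst e1 e2
            right
            cases hmeet with
            | pair _ _ _ _ =>
              refine ⟨by simp [Function.update_of_ne hjk.ne], fun i hi => .inl ?_⟩
              simp only
              rw [Function.update_of_ne (hi.trans hjk).ne, Function.update_of_ne hi.ne]
              exact ih i (hi.trans hjk).le
            | stickRight b δ _ hk hb =>
              rw [← hk, leader_single mq, mq] at hb; simp at hb
            | stickLeft b δ _ hk hb =>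
              rw [← hk, leader_single mp, mp] at hb; simp at hb
            | pause a b hj _ hb _ => rw [← hj, leader_single mp, mp] at hb; simp at hb
            | merge a b hj _ hb _ => rw [← hj, leader_single mp, mp] at hb; simp at hb
          · left
            intro i hi
            have hip : i ≠ p := (hi.trans_lt (not_le.1 hpk)).ne
            have hiq : i ≠ q := (hi.trans_lt ((not_le.1 hpk).trans hc.lt)).ne
            cases hmeet with
            | pair _ _ _ _ => simp only; rw [Function.update_of_ne hiq, Function.update_of_ne hip, ih i hi]
            | stickRight b δ _ hk hb => rw [setMode_mode_of_ne hip, ih i hi]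
            | stickLeft b δ _ hk hb => rw [setMode_mode_of_ne hiq, ih i hi]
            | pause a b hj _ hb _ => exact ih i hi
            | merge a b _ _ ha hb =>
              simp only; rw [if_neg, ih i hi]
              rw [leader_single (ih i hi)]
              rintro (rfl | rfl)
              · rw [ih _ hi] at ha; simp at ha
              · rw [ih _ hi] at hb; simp at hb
      · exact .inr (ih.micro hv hstep fun p q hc hp hq hlt => absurd hlt.le (hd' p q hc hp hq))
  rcases key e h.path with h1 | h1
  · exact absurd ⟨dj, dk⟩ (h.dir_ne_right_left hjk (h1 j hjk.le) (h1 k le_rfl) hgap)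
  · exact h1

/-- In the situation of `leftBlock_e`, the last of the robots that searched to the left meets a
robot in phase two. -/
lemma not_single_of_leftBlock (hr : 1 ≤ r) (hx : StrictMono x) (hb : LeftBlock e j)
    (hij : i < j) (di : c.dir i = .left) (dj : c.dir j = .right)
    (hl : ∀ p ≤ i, c.dir p = .left) (hr' : ∀ p, i < p → p ≤ j → c.dir p = .right)
    (hgap : x j - x i < 2 * r ^ (2 * c.round)) : e'.mode i ≠ .single := by
  -- In phase two the only single neighbours below `j` that can search towards each other are `i`
  -- and its right neighbour, and their meeting would bind `i`. Hence the block of `j` persists as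
  -- long as `i` is single.
  have key : ∀ c', Micros r x m c' → c'.mode i ≠ .single ∨ LeftBlock c' j := by
    intro c' hm
    induction hm with
    | refl => exact .inr ⟨by rw [h.mode_m]; exact hb.bound, by rw [h.mode_m]; exact hb.below⟩
    | @tail c' c'' hm hstep ih =>
      have hv := Micros.valid hm (h.valid_m hr)
      by_cases hi : c''.mode i = .single
      swap
      · exact .inl hi
      right
      have ih' := ih.resolve_left (not_not.2 (hstep.single hi))
      refine ih'.micro hv hstep fun p q hc hp hq hlt => ?_
      obtain ⟨d1, d2⟩ := hv.heading_of_contact hx hc hp hq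
      rw [h.heading_two hm, ← Dir.opp_left, Dir.opp_inj] at d1
      rw [h.heading_two hm, ← Dir.opp_right, Dir.opp_inj] at d2
      have hpi : p ≤ i := by
        by_contra hpi
        rw [hr' p (not_le.1 hpi) (hc.lt.le.trans hlt.le)] at d1; simp at d1
      have hqi : i < q := by
        by_contra hqi
        rw [hl q (not_lt.1 hqi)] at d2; simp at d2
      have e1 : p = i := le_antisymm hpi (Fin.le_def.2 (by
        have := hc.1; have := Fin.lt_def.1 hqi; omega))
      rw [e1]; exact hi
  intro hi
  have h1 := (key e' h.path').resolve_left (not_not.2 hi)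
  -- Were `i` single at the end, both `i` and `j` would have reached their phase-two destinations,
  -- which are in the wrong order.
  exact h.dir_ne_left_right hr hij hi (.inr (by rw [dj]; exact h1.bound)) hgap ⟨di, dj⟩

end IsRound

end MSR

namespace MSR

variable {n : ℕ} {r : ℝ} {x : Fin n → ℝ} {c c' e m e' : Config n} {i j k a b : Fin n} {ω : Coins n}

/-! ### The survival of single robots on the left -/

/-- The `s` leftmost robots are single. -/
def Leading (g : Fin n → Mode n) (s : ℕ) : Prop := ∀ j : Fin n, j.val < s → g j = .single

/-- Non-extreme distances are smaller than twice the search radius. -/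
def Narrow (x : Fin n → ℝ) (D : ℝ) : Prop :=
  ∀ i j : Fin n, i < j → (j.val + 1 < n ∨ 0 < i.val) → x j - x i < D

namespace IsRound

variable (h : IsRound r x c e m e')
include h

lemma dir_eq_of_leading (hr : 1 ≤ r) (hn : 2 < n) (hgap : Narrow x (2 * r ^ (2 * c.round)))
    {s : ℕ} (hs : Leading e'.mode s) (hi : i.val < s) (hj : j.val < s) : c.dir i = c.dir j := by
  have key : ∀ t (ht : t < n), t < s → c.dir ⟨t, ht⟩ = c.dir ⟨0, by omega⟩ := by
    intro t
    induction t with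
    | zero => intro _ _; rfl
    | succ t ih =>
      intro ht hts
      rw [← ih (by omega) (by omega)]
      refine (h.dir_eq hr (Fin.lt_def.2 (by simp)) (hs _ (by simp; omega)) (hs _ hts)
        (hgap _ _ (Fin.lt_def.2 (by simp)) ?_)).symm
      simp; omega
  exact (key i i.2 hi).trans (key j j.2 hj).symm

/-- Consider the leftmost right-left pair `p`, `q`. Up to `p` the directions are a run of lefts
followed by a run of rights. If there are no lefts, then `p` itself is bound in phase one. Otherwise
the last robot of the run of lefts meets somebody in phase two. Either way the survivors, and even
the robot after them, lie within one run. -/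
lemma dir_eq_of_turn (hr : 1 ≤ r) (hx : StrictMono x) (hn : 2 < n)
    (hgap : Narrow x (2 * r ^ (2 * c.round))) {M s : ℕ} (hM : Leading c.mode M)
    (hjk : k.val = j.val + 1) (hk : k.val < M) (dj : c.dir j = .right) (dk : c.dir k = .left)
    (hs : Leading e'.mode s) :
    s < M ∧ ∀ p q : Fin n, p.val ≤ s → q.val ≤ s → c.dir p = c.dir q := by
  classical
  have hex : ∃ t, ∃ p q : Fin n, p.val = t ∧ q.val = t + 1 ∧ c.dir p = .right ∧ c.dir q = .left :=
    ⟨j.val, j, k, rfl, hjk, dj, dk⟩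
  obtain ⟨p, q, hp, hq, dp, dq⟩ := Nat.find_spec hex
  have hmin : ∀ p' q' : Fin n, q'.val = p'.val + 1 → q' ≤ p →
      ¬ (c.dir p' = .right ∧ c.dir q' = .left) := fun p' q' h1 h2 h3 =>
    Nat.find_min hex (m := p'.val) (by have := Fin.le_def.1 h2; omega) ⟨p', q', rfl, h1, h3⟩
  have hpj : p.val ≤ j.val := by
    rw [hp]; exact Nat.find_min' hex ⟨j, k, rfl, hjk, dj, dk⟩
  have hpq : p < q := Fin.lt_def.2 (by omega)
  have hblock := h.leftBlock_e hx (j := p) (k := q) (by omega)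
    (fun i hi => hM i (by have := Fin.le_def.1 hi; omega)) hmin dq dp
    -- Since `n > 2`, two neighbours are never the two extreme robots.
    (hgap _ _ hpq (by have := q.2; omega))
  have hsingle : ∀ i : Fin n, e'.mode i ≠ .single → s ≤ i.val := fun i hi => by
    by_contra hlt; exact hi (hs i (not_le.1 hlt))
  have hmono : ∀ t t' : ℕ, ∀ (ht : t < n) (ht' : t + t' < n), t + t' ≤ p.val →
      c.dir ⟨t, ht⟩ = .right → c.dir ⟨t + t', ht'⟩ = .right := by
    intro t t'
    induction t' with
    | zero => intro _ _ _ hd; exact hd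
    | succ t' ih =>
      intro ht ht' hle hd
      have h1 := ih ht (by omega) (by omega) hd
      by_contra h2
      exact hmin ⟨t + t', by omega⟩ ⟨t + (t' + 1), ht'⟩ (by simp; omega) (Fin.le_def.2 hle)
        ⟨h1, Dir.ne_right.1 h2⟩
  by_cases hall : ∀ i ≤ p, c.dir i = .right
  · have hsp : s ≤ p.val := hsingle p fun hp => by
      have := h.single_e hp
      rw [hblock.bound] at this; simp at this
    exact ⟨by omega, fun i j hi hj => by
      rw [hall i (Fin.le_def.2 (by omega)), hall j (Fin.le_def.2 (by omega))]⟩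
  · push Not at hall
    obtain ⟨i₀, hi₀, hd₀⟩ := hall
    obtain ⟨i, hi, hmax⟩ := Finset.exists_max_image
      (Finset.univ.filter fun i : Fin n => i ≤ p ∧ c.dir i ≠ .right) id
      ⟨i₀, by simp [hi₀, hd₀]⟩
    simp only [Finset.mem_filter, Finset.mem_univ, true_and, id] at hi hmax
    have hip : i < p := lt_of_le_of_ne hi.1 (by rintro rfl; exact hi.2 dp)
    have hleft : ∀ t ≤ i, c.dir t = .left := by
      intro t ht
      by_contra hd
      have := hmono t.val (i.val - t.val) t.2 (by have := i.2; omega)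
        (by have := Fin.lt_def.1 hip; have := Fin.le_def.1 ht; omega) (Dir.ne_left.1 hd)
      apply hi.2
      rw [← this]; congr 1; ext; simp only; have := Fin.le_def.1 ht; omega
    have hns := h.not_single_of_leftBlock hr hx hblock hip (hleft i le_rfl) dp hleft
      (fun t h1 h2 => by
        by_contra hd
        exact absurd (hmax t ⟨h2, hd⟩) (not_le.2 h1))
      (hgap _ _ hip (by have := q.2; omega))
    have hsi := hsingle i hns
    have := Fin.lt_def.1 hip
    exact ⟨by omega, fun t t' ht ht' => by
      rw [hleft t (Fin.le_def.2 (by omega)), hleft t' (Fin.le_def.2 (by omega))]⟩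

end IsRound

/-! ### Rounds that lead to rendezvous -/

/-- Robot `j` searches towards the right in phase two, and has met no robot in phase two that
would turn it around. -/
def Inbound (c : Config n) (j : Fin n) : Prop :=
  c.dir j = .left ∧ (c.mode j = .single ∨ c.mode j = .bound .left)

lemma Inbound.searching (h : Inbound c j) : Searching c j := h.2.imp id fun h => ⟨_, h⟩

lemma Micro.searching (h : Micro r x c c') (hj : Searching c' j) : Searching c j := by
  cases h with
  | settle => exact hj
  | advance τ hn ha hτ => exact hj
  | meet p q _ hc hm =>
    cases hm with
    | pair hp hq _ _ =>
      by_cases h1 : j = q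
      · rw [h1]; exact .inl hq
      by_cases h2 : j = p
      · rw [h2]; exact .inl hp
      simpa [Searching, Function.update_of_ne h1, Function.update_of_ne h2] using hj
    | stickRight b δ hp hq hb =>
      by_cases h2 : j = p
      · subst h2; simp [Searching, setMode] at hj
      simpa [Searching, setMode, Function.update_of_ne h2] using hj
    | stickLeft b δ hp hq hb =>
      by_cases h2 : j = q
      · subst h2; simp [Searching, setMode] at hj
      simpa [Searching, setMode, Function.update_of_ne h2] using hj
    | pause a b hj' hk ha hb => exact hj
    | merge a b hj' hk ha hb =>
      unfold Searching at hj
      simp only at hj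
      split_ifs at hj
      · simp at hj
      · exact hj

lemma Micro.halted (h : Micro r x c c') (hj : c.halted j = true) : c'.halted j = true := by
  cases h with
  | settle => simp [MSR.settle, hj]
  | advance τ hn ha hτ => exact hj
  | meet p q _ hc hm =>
    cases hm with
    | pair hp hq _ _ => simp only [Function.update_apply, hj, ite_self]
    | stickRight b δ hp hq hb => exact hj
    | stickLeft b δ hp hq hb => exact hj
    | pause a b hj' hk ha hb => simp only [Function.update_apply, hj, ite_self]
    | merge a b hj' hk ha hb => exact hj

lemma Micro.inbound (h : Micro r x c c') (hj : Inbound c' j) : Inbound c j := by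
  have hd : c.dir j = .left := by rw [← h.dir_eq]; exact hj.1
  refine ⟨hd, ?_⟩
  rcases hj.2 with hs | hs
  · exact .inl (h.single hs)
  cases h with
  | settle => exact .inr hs
  | advance τ hn ha hτ => exact .inr hs
  | meet p q _ hc hm =>
    cases hm with
    | pair hp hq _ _ =>
      by_cases h1 : j = q
      · rw [h1]; exact .inl hq
      by_cases h2 : j = p
      · rw [h2]; exact .inl hp
      right
      simpa [Function.update_of_ne h1, Function.update_of_ne h2] using hs
    | stickRight b δ hp hq hb =>
      by_cases h2 : j = p
      · subst h2; simp [setMode] at hs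
      right; rwa [setMode_mode_of_ne h2] at hs
    | stickLeft b δ hp hq hb =>
      by_cases h2 : j = q
      · subst h2; simp [setMode] at hs
      right; rwa [setMode_mode_of_ne h2] at hs
    | pause a b hj' hk ha hb => exact .inr hs
    | merge a b hj' hk ha hb =>
      simp only at hs
      split_ifs at hs
      exact .inr hs

/-- The state of the left part of the team in phase two of a round leading to rendezvous: `a` is
the leftmost bound robot, `u` the search radius of phase one, `T` the duration of phase two. -/
structure Half (x : Fin n → ℝ) (u T : ℝ) (Y : Fin n → Prop) (a : Fin n) (c : Config n) : Prop where
  block : LeftBlock c a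
  dir : c.dir a = .left
  dir_single : ∀ j < a, c.mode j = .single → c.dir j = .left
  sub : ∀ j, Inbound c j → Y j
  le : ∀ j, Inbound c j → c.pos j ≤ x j - u + (T - c.timeLeft)
  eq : ∀ j, Inbound c j → c.halted j = false → c.pos j = x j - u + (T - c.timeLeft)

lemma Half.inbound {u T : ℝ} {Y : Fin n → Prop} (h : Half x u T Y a c) : Inbound c a :=
  ⟨h.dir, .inr h.block.bound⟩

lemma Half.micro {u T : ℝ} {Y : Fin n → Prop} (h : Half x u T Y a c) (hv : Valid r x c)
    (hx : StrictMono x) (hp : c.phase = .two) (hm : Micro r x c c') : Half x u T Y a c' := by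
  have hin : ∀ j, Inbound c' j → Inbound c j := fun _ => hm.inbound
  have hkin : ∀ j, Inbound c' j → c'.pos j ≤ x j - u + (T - c'.timeLeft) ∧
      (c'.halted j = false → c'.pos j = x j - u + (T - c'.timeLeft)) := by
    intro j hj
    have hj' := hin j hj
    have h1 := h.le j hj'
    have h2 := h.eq j hj'
    have h3 : c'.halted j = false → c.halted j = false := fun hf => by
      by_contra ht
      rw [hm.halted (by simpa using ht)] at hf; simp at hf
    cases hm with
    | settle => exact ⟨h1, fun hf => h2 (h3 hf)⟩
    | meet p q _ hc hmeet =>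
      rw [hmeet.pos_eq, hmeet.timeLeft_eq]
      exact ⟨h1, fun hf => h2 (h3 hf)⟩
    | advance τ hn ha hτ =>
      have hd : heading c j = .right := by rw [heading, hp]; simp [hj'.1]
      have hvel := hj'.searching.vel
      simp only [advance, hvel, hd]
      cases hh : c.halted j
      · have := h2 hh
        refine ⟨?_, fun _ => ?_⟩ <;> simp <;> linarith
      · refine ⟨?_, fun hf => ?_⟩
        · simp; have := hτ.1; linarith
        · simp at hf
  refine ⟨h.block.micro hv hm ?_, ?_, ?_, fun j hj => h.sub j (hin j hj), fun j hj => (hkin j hj).1,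
    fun j hj => (hkin j hj).2⟩
  -- All single robots below `a` head right in phase two, so no two of them meet.
  · intro p q hc hp' hq' hlt
    exfalso
    obtain ⟨d1, d2⟩ := hv.heading_of_contact hx hc hp' hq'
    have h2 := h.dir_single q hlt hq'
    rw [heading, hp] at d2
    simp [h2] at d2
  · rw [hm.dir_eq]; exact h.dir
  · intro j hj hs
    rw [hm.dir_eq]; exact h.dir_single j hj (hm.single hs)

end MSR

/-! ### The outermost boundary robots in phase two of a successful round -/

namespace MSR

variable {n : ℕ} {r : ℝ} {x : Fin n → ℝ} {c c' e m e' : Config n} {i j k a b : Fin n} {ω : Coins n}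
variable {lo hi u T : ℝ} {Y X : Fin n → Prop}

/-- Robot `a` moves on in phase two, or has left the interval of the initial positions. -/
def Passed (hi : ℝ) (a : Fin n) (c : Config n) : Prop := c.halted a = false ∨ hi ≤ c.pos a

/-- Robot `a` has met an inbound robot in phase two. -/
def Caught (lo : ℝ) (X : Fin n → Prop) (a : Fin n) (c : Config n) : Prop :=
  c.halted a = true ∧ lo < c.pos a ∧ ∃ ρ, X ρ ∧ a < ρ ∧ ∀ i, a < i → i < ρ → ¬ Searching c i

/-- The outermost bound robots have met. -/
def Joined (lo hi : ℝ) (a b : Fin n) (c : Config n) : Prop :=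
  c.halted a = true ∧ c.halted b = true ∧ c.pos a = c.pos b ∧ lo < c.pos a ∧ c.pos a < hi

/-- The possible states of the outermost bound robots in phase two. -/
def Status (lo hi : ℝ) (Y X : Fin n → Prop) (a b : Fin n) (c : Config n) : Prop :=
  Joined lo hi a b c ∨ (Passed hi a c ∧ Passed (-lo) b.rev (mir c)) ∨
    (Caught lo X a c ∧ Passed (-lo) b.rev (mir c)) ∨
    (Passed hi a c ∧ Caught (-hi) (fun j => Y j.rev) b.rev (mir c))

lemma passed_mir : Passed (-lo) b.rev (mir c) ↔ c.halted b = false ∨ c.pos b ≤ lo := by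
  simp [Passed]

lemma caught_mir : Caught (-hi) (fun j => Y j.rev) b.rev (mir c) ↔ c.halted b = true ∧
    c.pos b < hi ∧ ∃ ρ, Y ρ ∧ ρ < b ∧ ∀ i, ρ < i → i < b → ¬ Searching c i := by
  simp only [Caught, mir_halted, Fin.rev_rev, mir_pos, neg_lt_neg_iff, searching_mir]
  refine and_congr_right fun _ => and_congr_right fun _ => ⟨?_, ?_⟩
  · rintro ⟨ρ, h1, h2, h3⟩
    refine ⟨ρ.rev, h1, by rwa [← Fin.rev_lt_rev, Fin.rev_rev], fun i hi hi' => ?_⟩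
    have := h3 i.rev (Fin.rev_lt_rev.2 hi') (by rwa [← Fin.rev_lt_rev, Fin.rev_rev])
    rwa [Fin.rev_rev] at this
  · rintro ⟨ρ, h1, h2, h3⟩
    refine ⟨ρ.rev, by rwa [Fin.rev_rev], Fin.rev_lt_rev.2 h2, fun i hi hi' => ?_⟩
    exact h3 i.rev (by rwa [← Fin.rev_lt_rev, Fin.rev_rev]) (by rwa [← Fin.rev_lt_rev, Fin.rev_rev])

lemma joined_mir : Joined (-hi) (-lo) b.rev a.rev (mir c) ↔ Joined lo hi a b c := by
  simp only [Joined, mir_halted, Fin.rev_rev, mir_pos, neg_inj, neg_lt_neg_iff]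
  constructor
  · rintro ⟨h1, h2, h3, h4, h5⟩; exact ⟨h2, h1, h3.symm, by rwa [← h3], by rwa [← h3]⟩
  · rintro ⟨h1, h2, h3, h4, h5⟩; exact ⟨h2, h1, h3.symm, by rwa [← h3], by rwa [← h3]⟩

/-- The situation in phase two of a round leading to rendezvous. -/
structure Scene (r : ℝ) (x : Fin n → ℝ) (lo hi u T : ℝ) (Y X : Fin n → Prop) (a b : Fin n)
    (c : Config n) : Prop where
  valid : Valid r x c
  phase : c.phase = .two
  strictMono : StrictMono x
  lo_le : ∀ j, lo ≤ x j
  le_hi : ∀ j, x j ≤ hi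
  reach_le : hi - lo ≤ reach r c.round .two
  sep : ∀ y z, Y y → X z → y < z
  left : Half x u T Y a c
  right : Half (mirX x) u T (fun j => X j.rev) b.rev (mir c)

namespace Scene

lemma mir (h : Scene r x lo hi u T Y X a b c) :
    Scene r (mirX x) (-hi) (-lo) u T (fun j => X j.rev) (fun j => Y j.rev) b.rev a.rev
      (MSR.mir c) := by
  refine ⟨h.valid.mir, h.phase, strictMono_mirX h.strictMono, fun j => neg_le_neg (h.le_hi _),
    fun j => neg_le_neg (h.lo_le _), by have := h.reach_le; simp only [mir_round]; linarith,
    fun y z hy hz => Fin.rev_lt_rev.1 (h.sep _ _ hz hy), h.right, ?_⟩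
  simp only [mirX_mirX, mir_mir, Fin.rev_rev]; exact h.left

lemma micro (h : Scene r x lo hi u T Y X a b c) (hm : Micro r x c c') :
    Scene r x lo hi u T Y X a b c' :=
  ⟨h.valid.micro hm, by rw [hm.phase_eq, h.phase], h.strictMono, h.lo_le, h.le_hi,
    by rw [hm.round_eq]; exact h.reach_le, h.sep, h.left.micro h.valid h.strictMono h.phase hm,
    h.right.micro h.valid.mir (strictMono_mirX h.strictMono) h.phase hm.mir⟩

variable (h : Scene r x lo hi u T Y X a b c)
include h

lemma mode_b : c.mode b = .bound .right := by
  have := h.right.block.bound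
  rw [mir_mode, Fin.rev_rev, Mode.mir_eq_bound] at this; exact this

lemma dir_b : c.dir b = .right := by
  have := h.right.dir
  rw [mir_dir, Fin.rev_rev] at this
  rw [← Dir.opp_opp (c.dir b), this]; rfl

lemma a_lt_b : a < b :=
  h.left.block.bound_above h.mode_b (by
    rintro rfl; have h1 := h.mode_b; rw [h.left.block.bound] at h1; simp at h1)

lemma lo_lt (hab : a < k) : lo < x k := (h.lo_le a).trans_lt (h.strictMono hab)
lemma lt_hi (hab : k < b) : x k < hi := (h.strictMono hab).trans_le (h.le_hi b)

/-- The kinematics of inbound robots on the right. -/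
lemma right_le (hd : c.dir k = .right) (hm : c.mode k = .single ∨ c.mode k = .bound .right) :
    X k ∧ x k + u - (T - c.timeLeft) ≤ c.pos k ∧
      (c.halted k = false → c.pos k = x k + u - (T - c.timeLeft)) := by
  have hin : Inbound (MSR.mir c) k.rev := ⟨by simp [hd], by
    simp only [mir_mode, Fin.rev_rev, Mode.mir_eq_single, Mode.mir_eq_bound]; exact hm⟩
  have h1 := h.right.sub _ hin
  have h2 := h.right.le _ hin
  have h3 := h.right.eq _ hin
  simp only [Fin.rev_rev, mir_pos, mirX, mir_timeLeft, mir_halted] at h1 h2 h3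
  exact ⟨h1, by linarith, fun hh => by have := h3 hh; linarith⟩

/-- The phase-two radius is at least `hi - lo`, so a robot that reaches its destination on the right
has crossed the interval. -/
lemma hi_le_of_arrived (hd : c.dir k = .left) (ht : c.pos k = target r x c k) : hi ≤ c.pos k := by
  have h1 : target r x c k = x k + reach r c.round .two := by
    simp [target, heading, h.phase, hd]
  have := h.lo_le k
  have := h.reach_le
  linarith

/-- When the outermost bound robots meet, this happens inside the interval. -/
lemma joined_of_contact (hc : Contact c j k) (hj : leader c j = a) (hk : leader c k = b)
    (hla : c.halted a = true → lo < c.pos a) (hlb : c.halted b = true → c.pos b < hi) :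
    c.pos a = c.pos b ∧ lo < c.pos a ∧ c.pos a < hi := by
  have hp : c.pos a = c.pos b := by
    rw [← hj, ← hk, ← h.valid.pos_leader, ← h.valid.pos_leader]; exact hc.2.1
  have hne : ¬ (c.halted a = true ∧ c.halted b = true) := by
    rintro ⟨h1, h2⟩
    have hv := hc.2.2
    rw [vel, vel, hj, hk, Searching.ownVel (.inr ⟨_, h.left.block.bound⟩),
      Searching.ownVel (.inr ⟨_, h.mode_b⟩), h1, h2] at hv
    simp at hv
  have la := h.left.le a h.left.inbound
  have ea := h.left.eq a h.left.inbound
  obtain ⟨-, lb, eb⟩ := h.right_le h.dir_b (.inr h.mode_b)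
  have k1 := h.lo_lt h.a_lt_b
  have k2 := h.lt_hi h.a_lt_b
  have k3 := h.lo_le a
  have k4 := h.le_hi b
  refine ⟨hp, ?_, ?_⟩
  -- While `a` moves it is at `x a - u + t` after time `t`, and `b` is at `x b + u - t` or further
  -- right. Adding up, the meeting point is not to the left of the midpoint of `x a` and `x b`.
  · cases ha : c.halted a
    · have := ea ha; linarith
    · exact hla ha
  · cases hb : c.halted b
    · have := eb hb; linarith
    · rw [hp]; exact hlb hb

lemma vel_a_of_halted (ha : c.halted a = true) : vel c a = 0 := by
  rw [Searching.vel (.inr ⟨_, h.left.block.bound⟩), ha]; simp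

lemma pos_a_micro (ha : c.halted a = true) (hm : Micro r x c c') : c'.pos a = c.pos a := by
  cases hm with
  | settle => rfl
  | meet p q _ hc hmeet => rw [hmeet.pos_eq]
  | advance τ hn _ hτ => simp [advance, h.vel_a_of_halted ha]

lemma pos_b_micro (hb : c.halted b = true) (hm : Micro r x c c') : c'.pos b = c.pos b := by
  have := h.mir.pos_a_micro (by simpa using hb) hm.mir
  simpa using this

lemma caught_micro (hca : Caught lo X a c) (hm : Micro r x c c') : Caught lo X a c' := by
  obtain ⟨h1, h2, ρ, h3, h4, h5⟩ := hca
  exact ⟨hm.halted h1, by rwa [h.pos_a_micro h1 hm], ρ, h3, h4,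
    fun i hi hi' hs => h5 i hi hi' (hm.searching hs)⟩

/-- Apart from arriving at or beyond `hi`, only a pause with some robot `ρ` halts `a`. If `ρ = b`,
the two have joined. If `ρ` searched left in phase one, it now heads right and can be met only where
it rests, at or beyond `hi`. Otherwise `ρ` comes from the right and `a` is caught. Then `b` is not
caught: its catcher would be left of `ρ` by `sep`, while no searching robot may lie between that
catcher and `b`. -/
lemma passed_micro (hla : c.halted a = true → lo < c.pos a) (hlb : c.halted b = true → c.pos b < hi)
    (hm : Micro r x c c') (hpa : Passed hi a c) :
    Passed hi a c' ∨ (Caught lo X a c' ∧ ¬ Caught (-hi) (fun j => Y j.rev) b.rev (MSR.mir c) ∧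
      (Passed (-lo) b.rev (MSR.mir c) → Passed (-lo) b.rev (MSR.mir c'))) ∨
      Joined lo hi a b c' := by
  by_cases hh : c'.halted a = c.halted a
  · by_cases hstay : c.halted a = false
    · exact .inl (.inl (hh.trans hstay))
    · left; right
      have ha : c.halted a = true := by simpa using hstay
      rw [h.pos_a_micro ha hm]
      exact hpa.resolve_left hstay
  have hna : c.halted a = false := by
    by_contra hf
    have : c.halted a = true := by simpa using hf
    exact hh (by rw [hm.halted this, this])
  have haa := h.left.inbound
  cases hm with
  | settle =>
    left; right
    by_cases harr : Arrived r x c a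
    · exact h.hi_le_of_arrived h.left.dir harr.2
    · exact absurd (settle_halted_of_not harr) hh
  | advance τ hn _ hτ => exact absurd rfl hh
  | meet p q _ hc hmeet =>
    cases hmeet with
    | pair hp hq _ _ =>
      exfalso; apply hh
      have h1 : a ≠ p := by rintro rfl; rw [h.left.block.bound] at hp; simp at hp
      have h2 : a ≠ q := by rintro rfl; rw [h.left.block.bound] at hq; simp at hq
      simp only; rw [Function.update_of_ne h2, Function.update_of_ne h1]
    | stickRight _ _ _ _ _ => exact absurd rfl hh
    | stickLeft _ _ _ _ _ => exact absurd rfl hh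
    | merge _ _ _ _ _ _ => exact absurd rfl hh
    | pause a' ρ hp hq ma mρ =>
      have e1 : a' = a := by
        by_contra hne
        apply hh
        have h2 : a ≠ ρ := by rintro rfl; rw [h.left.block.bound] at mρ; simp at mρ
        simp only; rw [Function.update_of_ne h2, Function.update_of_ne (Ne.symm hne)]
      subst e1
      by_cases hρb : ρ = b
      · subst hρb
        right; right
        obtain ⟨k1, k2, k3⟩ := h.joined_of_contact hc hp hq hla hlb
        refine ⟨?_, by simp, k1, k2, k3⟩
        simp [Function.update_of_ne h.a_lt_b.ne]
      have hpp : c.pos a' = c.pos ρ := by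
        rw [← hp, ← hq, ← h.valid.pos_leader, ← h.valid.pos_leader]; exact hc.2.1
      have haρ : a' < ρ := h.left.block.bound_above mρ (by
        rintro rfl; rw [ma] at mρ; simp at mρ)
      have lρ := leader_bound mρ
      have la := leader_bound ma
      have hqρ : q ≤ ρ := by
        by_contra hlt
        have := h.valid.between' (i := q) (j := p) (by
          rw [hq]; exact Fin.le_def.2 (by have := hc.1; have := Fin.lt_def.1 (not_le.1 hlt); omega))
          hc.lt.le
        exact hc.leader_ne this
      have hap : a' ≤ p := by
        by_contra hlt
        have := h.valid.between (i := p) (j := q) hc.lt.le (by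
          rw [hp]; exact Fin.le_def.2 (by have := hc.1; have := Fin.lt_def.1 (not_le.1 hlt); omega))
        exact hc.leader_ne this.symm
      have hρb' : ρ < b := by
        have := h.mir.left.block.bound_above (b := ρ.rev) (δ := .left) (by simp [mρ, Mode.mir_eq_bound])
          (by simpa using hρb)
        exact Fin.rev_lt_rev.1 this
      cases hdρ : c.dir ρ with
      | left =>
        left; right
        have hv := hc.2.2
        have sρ : Searching c ρ := .inr ⟨_, mρ⟩
        have hheadρ : heading c ρ = .right := by simp [heading, h.phase, hdρ]
        rw [vel, vel, hp, hq, sρ.ownVel, Searching.ownVel (.inr ⟨_, ma⟩), hna, hheadρ] at hv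
        have hρh : c.halted ρ = true := by
          by_contra hf
          rw [if_neg hf] at hv
          have := Dir.abs_sign (heading c a')
          simp at hv
          have := (abs_le.1 this.le).2
          linarith
        have harr := h.valid.arrived (.inr (by rw [hheadρ]; exact mρ)) hρh
        change hi ≤ c.pos a'
        rw [hpp]
        exact h.hi_le_of_arrived hdρ harr
      | right =>
        right; left
        obtain ⟨hX, k1, -⟩ := h.right_le hdρ (.inr mρ)
        have k2 := h.left.eq a' haa hna
        have k3 := h.lo_lt haρ
        have k4 := h.lo_le a'
        -- The meeting point is not to the left of the midpoint of `x a'` and `x ρ`, hence to the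
        -- right of `lo`.
        refine ⟨⟨?_, by change lo < c.pos a'; linarith, ρ, hX, haρ, ?_⟩, ?_, ?_⟩
        · simp [Function.update_of_ne haρ.ne]
        · rintro i hi1 hi2 (hs : Searching c i)
          have li := hs.leader
          rcases le_or_gt i p with hip | hip
          · have := h.valid.convex hi1.le hip (la.trans hp.symm)
            rw [li, la] at this; exact hi1.ne' this
          · have hqi : q ≤ i := Fin.le_def.2 (by have := hc.1; have := Fin.lt_def.1 hip; omega)
            have := h.valid.convex hqi hi2.le (hq.trans lρ.symm)
            rw [li, hq] at this; exact hi2.ne this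
        · rw [caught_mir]
          rintro ⟨-, -, y, hy, hyb, hns⟩
          exact hns ρ (h.sep y ρ hy hX) hρb' (.inr ⟨_, mρ⟩)
        · rw [passed_mir, passed_mir]
          have : b ≠ a' := h.a_lt_b.ne'
          simp [Function.update_of_ne this, Function.update_of_ne (Ne.symm hρb)]

/-- `passed_micro` and its reflection describe the two ends; their exclusion clauses rule out that
both become caught, which is the one combination missing from `Status`. -/
lemma status_micro (hm : Micro r x c c') (hs : Status lo hi Y X a b c) : Status lo hi Y X a b c' := by
  have hmir := h.mir
  have hlohi : lo < hi := (h.lo_lt h.a_lt_b).trans_le (h.le_hi b)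
  by_cases hJ : Joined lo hi a b c
  · obtain ⟨h1, h2, h3, h4, h5⟩ := hJ
    left
    refine ⟨hm.halted h1, hm.halted h2, ?_, ?_, ?_⟩
    · rw [h.pos_a_micro h1 hm, h.pos_b_micro h2 hm, h3]
    · rwa [h.pos_a_micro h1 hm]
    · rwa [h.pos_a_micro h1 hm]
  have hs := hs.resolve_left hJ
  have hla : c.halted a = true → lo < c.pos a := by
    intro ha
    have hP : Passed hi a c → lo < c.pos a := fun hP =>
      hlohi.trans_le (hP.resolve_left (by simp [ha]))
    rcases hs with hs | hs | hs
    · exact hP hs.1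
    · exact hs.1.2.1
    · exact hP hs.1
  have hlb : c.halted b = true → c.pos b < hi := by
    intro hb
    have hP : Passed (-lo) b.rev (MSR.mir c) → c.pos b < hi := fun hP =>
      ((passed_mir.1 hP).resolve_left (by simp [hb])).trans_lt hlohi
    rcases hs with hs | hs | hs
    · exact hP hs.2
    · exact hP hs.2
    · exact (caught_mir.1 hs.2).2.1
  have La := h.passed_micro hla hlb hm
  have Lb := hmir.passed_micro (c' := MSR.mir c') (by simpa using hlb) (by simpa using hla) hm.mir
  simp only [joined_mir, mir_mir, Fin.rev_rev, neg_neg] at Lb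
  have Ca := fun hc => h.caught_micro hc hm
  have Cb := fun hc => hmir.caught_micro hc hm.mir
  rcases hs with ⟨h1, h2⟩ | ⟨h1, h2⟩ | ⟨h1, h2⟩
  · rcases La h1 with k1 | ⟨k1, -, k2⟩ | k1
    · rcases Lb h2 with k3 | ⟨k3, -, -⟩ | k3
      · exact .inr (.inl ⟨k1, k3⟩)
      · exact .inr (.inr (.inr ⟨k1, k3⟩))
      · exact .inl k3
    · exact .inr (.inr (.inl ⟨k1, k2 h2⟩))
    · exact .inl k1
  · rcases Lb h2 with k3 | ⟨-, k3, -⟩ | k3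
    · exact .inr (.inr (.inl ⟨Ca h1, k3⟩))
    · exact absurd h1 k3
    · exact .inl k3
  · rcases La h1 with k1 | ⟨-, k1, -⟩ | k1
    · exact .inr (.inr (.inr ⟨k1, Cb h2⟩))
    · exact absurd h2 k1
    · exact .inl k1

/-- By this time a robot that has passed is at or beyond the far end of the interval, and a caught
one is strictly inside its own end. Each alternative to being joined puts `a` to the right of `b`.
-/
lemma joined_of_time (hs : Status lo hi Y X a b c) (ht : u + (hi - lo) ≤ T - c.timeLeft) :
    Joined lo hi a b c := by
  have hab := h.valid.mono h.a_lt_b.le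
  have hlohi : lo < hi := (h.lo_lt h.a_lt_b).trans_le (h.le_hi b)
  have Pa : Passed hi a c → hi ≤ c.pos a := by
    rintro (hp | hp)
    · have := h.left.eq a h.left.inbound hp; have := h.lo_le a; linarith
    · exact hp
  have Pb : Passed (-lo) b.rev (MSR.mir c) → c.pos b ≤ lo := by
    rw [passed_mir]
    rintro (hp | hp)
    · have := (h.right_le h.dir_b (.inr h.mode_b)).2.2 hp; have := h.le_hi b; linarith
    · exact hp
  rcases hs with h1 | ⟨h1, h2⟩ | ⟨h1, h2⟩ | ⟨h1, h2⟩
  · exact h1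
  · have := Pa h1; have := Pb h2; linarith
  · have := h1.2.1; have := Pb h2; linarith
  · have := Pa h1; have := (caught_mir.1 h2).2.1; linarith

/-- A robot below `a` that is still single would have reached `hi` by now, beyond the meeting point.
So every robot below `a` is stuck to it. -/
lemma pos_eq_of_joined_left (hJ : Joined lo hi a b c) (ht : u + (hi - lo) ≤ T - c.timeLeft)
    (hja : j ≤ a) : c.pos j = c.pos a := by
  rcases hja.lt_or_eq with hja | rfl
  swap
  · rfl
  rcases h.left.block.below j hja with hs | hs
  · exfalso
    have hd := h.left.dir_single j hja hs
    have hle := h.valid.mono hja.le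
    have hhi := hJ.2.2.2.2
    cases hh : c.halted j
    · have := h.left.eq j ⟨hd, .inl hs⟩ hh; have := h.lo_le j; linarith
    · have := h.hi_le_of_arrived hd (h.valid.arrived (.inl hs) hh); linarith
  · exact h.valid.stuck_pos hs

/-- All robots have gathered by the time `u + (hi - lo)`. -/
lemma gathered (hs : Status lo hi Y X a b c) (ht : u + (hi - lo) ≤ T - c.timeLeft) : Gathered c := by
  have hJ := h.joined_of_time hs ht
  have key : ∀ j, c.pos j = c.pos a := by
    intro j
    rcases le_or_gt j a with hja | hja
    · exact h.pos_eq_of_joined_left hJ ht hja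
    rcases le_or_gt b j with hjb | hjb
    · have := h.mir.pos_eq_of_joined_left (j := j.rev) (joined_mir.2 hJ)
        (by simp only [mir_timeLeft]; linarith) (Fin.rev_le_rev.2 hjb)
      simp only [mir_pos, Fin.rev_rev, neg_inj] at this
      rw [this, hJ.2.2.1]
    · have h1 := h.valid.mono hja.le
      have h2 := h.valid.mono hjb.le
      have h3 := hJ.2.2.1
      linarith
  intro j k
  rw [key j, key k]

end Scene

end MSR

/-! ### Gathering in a successful round -/

namespace MSR

variable {n : ℕ} {r : ℝ} {x : Fin n → ℝ} {c c' e m e' : Config n} {i j k a b : Fin n} {ω : Coins n}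

/-- Two neighbours among the single robots on the left search towards each other in phase one. -/
def Turn (g : Fin n → Mode n) (d : Fin n → Dir) : Prop :=
  ∃ p q : Fin n, q.val = p.val + 1 ∧ Leading g (q.val + 1) ∧ d p = .right ∧ d q = .left

/-- The leftmost robot that is not single has its left face outside, so its leader is bound to the
left. The robots from there up to the leader are stuck to it by convexity. -/
lemma Valid.exists_leftBlock (hv : Valid r x c) (h : ∃ j, c.mode j ≠ .single) :
    ∃ a, LeftBlock c a := by
  obtain ⟨p, hp, hmin⟩ := Finset.exists_min_image
    ((Set.toFinite {j : Fin n | c.mode j ≠ .single}).toFinset) id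
    (by obtain ⟨j, hj⟩ := h; exact ⟨j, by simpa using hj⟩)
  simp only [Set.Finite.mem_toFinset, Set.mem_ofPred_eq, id] at hp hmin
  have hsingle : ∀ j < p, c.mode j = .single := fun j hj => by
    by_contra hs; exact absurd (hmin j hs) (not_le.2 hj)
  have hface : (lmode c p).leftFace = false := by
    rcases Nat.eq_zero_or_pos p.val with h0 | h0
    · exact hv.first h0
    · have hs := hsingle ⟨p.val - 1, by omega⟩ (Fin.lt_def.2 (by simp; omega))
      rcases hv.edge (j := ⟨p.val - 1, by omega⟩) (k := p) (by simp; omega) with h1 | h1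
      · rw [leader_single hs] at h1
        have := hv.eq_of_leader_single hs h1.symm
        rw [this] at hp; exact absurd hs hp
      · rw [← h1, lmode_single hs]; rfl
  have hbound : c.mode (leader c p) = .bound .left := by
    rcases hv.leader_cases p with ⟨-, h1⟩ | ⟨-, h1⟩ | ⟨δ, h1⟩
    · exact absurd h1 hp
    · rw [lmode_internal h1] at hface; simp [Mode.leftFace] at hface
    · rw [lmode, h1] at hface
      cases δ
      · exact h1
      · simp [Mode.leftFace] at hface
  have hle : p ≤ leader c p := hmin _ (by rw [hbound]; simp)
  refine ⟨leader c p, hbound, fun j hj => ?_⟩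
  rcases lt_or_ge j p with h1 | h1
  · exact .inl (hsingle j h1)
  · have h2 := hv.between h1 hj.le
    rcases leader_eq_or c j with h3 | h3
    · exact absurd (h3.symm.trans h2) hj.ne
    · right; rw [h3, h2]

lemma LeftBlock.leading (h : LeftBlock c a) (hv : Valid r x c) (hj : j < a)
    (hs : c.mode j = .single) : Leading c.mode (j.val + 1) := by
  intro i hi
  have hij : i ≤ j := Fin.le_def.2 (by omega)
  rcases h.below i (hij.trans_lt hj) with h1 | h1
  · exact h1
  · have := hv.between hij (by rw [leader_stuck h1]; exact hj.le)
    rw [leader_stuck h1, leader_single hs] at this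
    exact absurd this hj.ne

/-- Without a turn no two single robots below `a` meet in phase one, so `a` completes its way to `x
a - u`. A robot below it that remained single and went right would have ended up on its right. -/
lemma IsRound.half (h : IsRound r x c e m e') (hx : StrictMono x) (hb : LeftBlock c a)
    (hd : ¬ Turn c.mode c.dir) (hgap : ∀ i j, x j - x i < 2 * r ^ (2 * c.round)) :
    Half x (r ^ (2 * c.round)) m.timeLeft (Inbound m) a m := by
  have hblock : ∀ c', Micros r x c c' → LeftBlock c' a := by
    intro c' hm
    induction hm with
    | refl => exact hb
    | @tail c' c'' hm hstep ih =>
      have hv := Micros.valid hm h.valid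
      refine ih.micro hv hstep fun p q hc hp hq hlt => ?_
      obtain ⟨d1, d2⟩ := hv.heading_of_contact hx hc hp hq
      rw [h.heading_one hm] at d1 d2
      exact absurd ⟨p, q, hc.1, hb.leading h.valid hlt (Micros.single hm hq), d1, d2⟩ hd
  have he := hblock e h.path
  have hda := h.bound_dir hb.bound
  have hpos : ∀ j, Inbound m j → m.pos j = x j - r ^ (2 * c.round) := by
    intro j hj
    have hdj : c.dir j = .left := by rw [← h.dir_m]; exact hj.1
    rw [h.pos_m, h.pos_e (by rw [hdj, ← h.mode_m]; exact hj.2), hdj]; simp; ring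
  refine ⟨?_, by rw [h.dir_m, hda], fun j hj hs => ?_, fun _ => id, fun j hj => ?_, fun j hj _ => ?_⟩
  · exact ⟨by rw [h.mode_m]; exact he.bound, by rw [h.mode_m]; exact he.below⟩
  · rw [h.dir_m]
    rw [h.mode_m] at hs
    by_contra hne
    have h1 := h.pos_e (.inl hs)
    have h2 := h.pos_e (.inr (by rw [hda]; exact he.bound))
    have h3 := h.valid_e.mono hj.le
    have h4 := hgap j a
    rw [Dir.ne_left.1 hne] at h1
    rw [hda] at h2
    simp at h1 h2; linarith
  · rw [hpos j hj]; linarith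
  · rw [hpos j hj]; ring

lemma IsRound.scene (h : IsRound r x c e m e') (hr : 1 ≤ r) (hx : StrictMono x) {lo hi : ℝ}
    (hlo : ∀ j, lo ≤ x j) (hhi : ∀ j, x j ≤ hi) (h1 : hi - lo < 2 * r ^ (2 * c.round))
    (h2 : hi - lo ≤ r ^ (2 * c.round + 1)) (ha : LeftBlock c a) (hb : LeftBlock (MSR.mir c) b)
    (hda : ¬ Turn c.mode c.dir) (hdb : ¬ Turn (MSR.mir c).mode (MSR.mir c).dir) :
    Scene r x lo hi (r ^ (2 * c.round)) m.timeLeft (Inbound m) (fun j => Inbound (MSR.mir m) j.rev) a b.rev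
      m := by
  have hgap : ∀ i j, x j - x i < 2 * r ^ (2 * c.round) := fun i j => by
    have := hlo i; have := hhi j; linarith
  have hL := h.half hx ha hda hgap
  have hR := h.mir.half (strictMono_mirX hx) hb hdb (fun i j => by
    have := hgap j.rev i.rev; simp only [mirX, mir_round]; linarith)
  refine ⟨h.valid_m hr, h.phase_m, hx, hlo, hhi, ?_, ?_, hL, by simpa using hR⟩
  · rw [h.round_m, reach_two]; exact h2
  · intro y z hy hz
    have e1 := hL.eq y hy (by rw [h.middle]; rfl)
    have e2 := hR.eq z.rev hz (by rw [h.middle]; rfl)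
    simp only [mir_pos, Fin.rev_rev, mirX, mir_round, mir_timeLeft] at e2
    by_contra hlt
    have := (h.valid_m hr).mono (not_lt.1 hlt)
    have := hgap z y
    linarith

/-- If some robots are not single at the beginning of a round, and no single robots on either side
search towards each other, then all robots gather in phase two. -/
theorem RoundStart.exists_gathered (h : RoundStart r x c) (hr : 1 ≤ r) (hx : StrictMono x)
    {lo hi : ℝ} (hlo : ∀ j, lo ≤ x j) (hhi : ∀ j, x j ≤ hi)
    (h1 : hi - lo < 2 * r ^ (2 * c.round)) (h2 : hi - lo ≤ r ^ (2 * c.round + 1))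
    (hs : ∃ j, c.mode j ≠ .single) (hda : ¬ Turn c.mode c.dir)
    (hdb : ¬ Turn (mir c).mode (mir c).dir) :
    ∃ c', Path r x (middle r x c) c' ∧ Gathered c' ∧
      phaseTime r c.round .two - c'.timeLeft ≤ r ^ (2 * c.round) + (hi - lo) := by
  obtain ⟨a, ha⟩ := h.valid.exists_leftBlock hs
  obtain ⟨b, hb⟩ := h.valid.mir.exists_leftBlock (by
    obtain ⟨j, hj⟩ := hs
    exact ⟨j.rev, by simpa using hj⟩)
  have hscene := (h.isRound hr hx).scene hr hx hlo hhi h1 h2 ha hb hda hdb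
  have hT : (middle r x c).timeLeft = phaseTime r c.round .two := by
    rw [← h.round_middle hx]; rfl
  rw [hT] at hscene
  set u := r ^ (2 * c.round)
  set T := phaseTime r c.round .two
  have hstatus : Status lo hi (Inbound (middle r x c)) (fun j => Inbound (mir (middle r x c)) j.rev) a
      b.rev (middle r x c) := .inr (.inl ⟨.inl rfl, .inl rfl⟩)
  -- If the robots do not gather in time, the elapsed time stays below `u + (hi - lo)` throughout
  -- phase two, although that phase lasts at least as long.
  by_contra hcon
  push Not at hcon
  have key : ∀ c', Path r x (middle r x c) c' →
      Scene r x lo hi u T (Inbound (middle r x c)) (fun j => Inbound (mir (middle r x c)) j.rev) a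
        b.rev c' ∧
      Status lo hi (Inbound (middle r x c)) (fun j => Inbound (mir (middle r x c)) j.rev) a
        b.rev c' ∧ T - c'.timeLeft < u + (hi - lo) := by
    intro c' hp
    induction hp with
    | refl =>
      refine ⟨hscene, hstatus, ?_⟩
      have h3 := (hlo a).trans (hhi a)
      have h4 : 0 < u := by positivity
      rw [hT]; linarith
    | @tail c₁ c₂ hp ht ih =>
      obtain ⟨ih1, ih2, ih3⟩ := ih
      refine ⟨ih1.micro ht.1, ih1.status_micro ht.1 ih2, ?_⟩
      have hp₂ : Path r x (middle r x c) c₂ := hp.tail ht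
      have hvalid₂ := (ih1.micro ht.1).valid
      cases ht.1 with
      | settle => exact ih3
      | meet p q _ hc hm => rw [hm.timeLeft_eq]; exact ih3
      | advance τ hn harr hτ =>
        by_contra hge
        have hge : u + (hi - lo) ≤ T - (c₁.timeLeft - τ) := not_lt.1 hge
        -- The critical instant lies within this advance, which is cut there.
        set τ₀ := u + (hi - lo) - (T - c₁.timeLeft) with hτ₀
        have h5 : 0 < τ₀ := by linarith
        have h6 : τ₀ ≤ τ := by linarith
        have hbe : BeforeEvents r x c₁ τ₀ := by
          refine ⟨h5.le, h6.trans hτ.2.1, fun j hj => h6.trans (hτ.2.2.1 j hj), fun j k hjk hv => ?_⟩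
          exact (mul_le_mul_of_nonneg_right h6 (by linarith)).trans (hτ.2.2.2 j k hjk hv)
        have hmic : Micro r x c₁ (advance c₁ τ₀) := .advance τ₀ hn harr hbe
        have hg : Gathered (advance c₁ τ₀) := (ih1.micro hmic).gathered (ih1.status_micro hmic ih2)
          (by simp only [advance]; linarith)
        rcases h6.lt_or_eq with h7 | h7
        -- Positions are linear in time and ordered at both ends of the advance. Two robots that
        -- coincide at an interior instant therefore coincide throughout, so the robots had gathered
        -- at `c₁` already, which is a configuration of the run.
        · have hg₁ : ∀ j k, j ≤ k → c₁.pos j = c₁.pos k := by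
            intro j k hjk
            have m1 := ih1.valid.mono hjk
            have m2 := hvalid₂.mono hjk
            have m3 := hg j k
            simp only [advance] at m2 m3
            refine le_antisymm m1 ?_
            have m4 : 0 ≤ (τ - τ₀) * (vel c₁ k - vel c₁ j) := by nlinarith
            have m5 : 0 ≤ vel c₁ k - vel c₁ j := nonneg_of_mul_nonneg_right m4 (by linarith)
            nlinarith
          have := hcon c₁ hp fun j k => by
            rcases le_total j k with hjk | hjk
            · exact hg₁ j k hjk
            · exact (hg₁ k j hjk).symm
          linarith
        · have := hcon _ hp₂ (by rw [← h7]; exact hg)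
          simp only [advance] at this; linarith
  have h3 := (key _ (h.path_middle hr hx)).2.2
  have h4 := (h.phaseEnd_roundEnd hr hx).2.2
  have h5 : T = u + r ^ (2 * c.round + 1) := phaseTime_two r c.round
  linarith

end MSR

namespace MSR

variable {n : ℕ}

/-! ### Averages over coins -/

/-- The average of a function of finitely many fair coins. -/
noncomputable def avg {ι : Type*} [Fintype ι] [DecidableEq ι] (F : (ι → Bool) → ℝ) : ℝ :=
  (∑ w, F w) / 2 ^ Fintype.card ι

section
variable {ι κ : Type*} [Fintype ι] [DecidableEq ι] [Fintype κ] [DecidableEq κ]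

lemma avg_mono {F F' : (ι → Bool) → ℝ} (h : ∀ w, F w ≤ F' w) : avg F ≤ avg F' := by
  unfold avg; gcongr; exact h _

lemma avg_add (F F' : (ι → Bool) → ℝ) : avg (fun w => F w + F' w) = avg F + avg F' := by
  unfold avg; rw [Finset.sum_add_distrib, add_div]

lemma avg_mul_left (a : ℝ) (F : (ι → Bool) → ℝ) : avg (fun w => a * F w) = a * avg F := by
  unfold avg; rw [← Finset.mul_sum, mul_div_assoc]

lemma avg_const (a : ℝ) : avg (fun _ : ι → Bool => a) = a := by
  unfold avg; simp

lemma avg_nonneg {F : (ι → Bool) → ℝ} (h : ∀ w, 0 ≤ F w) : 0 ≤ avg F :=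
  div_nonneg (Finset.sum_nonneg fun w _ => h w) (by positivity)

/-- A function of some of the coins has the same average over these coins as over all coins. -/
lemma avg_comp_injective (g : κ → ι) (hg : Function.Injective g) (F : (κ → Bool) → ℝ) :
    avg (fun w : ι → Bool => F (w ∘ g)) = avg F := by
  classical
  let E := Equiv.piEquivPiSubtypeProd (fun i => i ∈ Set.range g) (fun _ : ι => Bool)
  let e := Equiv.ofInjective g hg
  have h1 : ∑ w : ι → Bool, F (w ∘ g) =
      ∑ u : {i // i ∈ Set.range g} → Bool, ∑ _v : {i // ¬ i ∈ Set.range g} → Bool, F (u ∘ e) := by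
    rw [← Fintype.sum_prod_type', ← E.symm.sum_comp]
    refine Finset.sum_congr rfl fun z _ => ?_
    congr 1
    funext k
    simp [E, e, Equiv.piEquivPiSubtypeProd]
  have h2 : ∑ u : {i // i ∈ Set.range g} → Bool, F (u ∘ e) = ∑ u : κ → Bool, F u :=
    (e.arrowCongr (Equiv.refl Bool)).symm.sum_comp F
  have h3 : Fintype.card ι = Fintype.card κ + Fintype.card {i // ¬ i ∈ Set.range g} := by
    rw [← Fintype.card_congr (Equiv.sumCompl fun i => i ∈ Set.range g), Fintype.card_sum,
      Fintype.card_congr e]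
  unfold avg
  rw [h1, h3, pow_add]
  simp only [Finset.sum_const, Finset.card_univ, nsmul_eq_mul]
  rw [← Finset.mul_sum, h2, Fintype.card_fun, Fintype.card_bool]
  push_cast
  field_simp

/-- Functions of disjoint sets of coins are independent. -/
lemma avg_mul_sum (F : (ι → Bool) → ℝ) (F' : (κ → Bool) → ℝ) :
    avg (fun w : ι ⊕ κ → Bool => F (w ∘ Sum.inl) * F' (w ∘ Sum.inr)) = avg F * avg F' := by
  unfold avg
  rw [Fintype.card_sum, pow_add, div_mul_div_comm, Finset.sum_mul_sum]
  congr 1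
  rw [← Fintype.sum_prod_type', ← (Equiv.sumArrowEquivProdArrow ι κ Bool).sum_comp]
  rfl

lemma avg_not (F : (ι → Bool) → ℝ) : avg (fun w => F (fun i => !w i)) = avg F := by
  unfold avg
  congr 1
  exact (Equiv.arrowCongr (Equiv.refl ι) Equiv.boolNot).sum_comp F

end

/-! ### Patterns of coins of the single robots on one side -/

/-- Some robot flips heads and its right neighbour flips tails. -/
def Pattern.turn {p : ℕ} (u : Fin p → Bool) : Bool :=
  decide (∃ i j : Fin p, j.val = i.val + 1 ∧ u i = true ∧ u j = false)

/-- Necessary condition for `s` robots to remain single. -/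
def Pattern.alive {p : ℕ} (u : Fin p → Bool) (s : ℕ) : Bool :=
  decide (s ≤ p) && (decide (∀ i j : Fin p, i.val < s → j.val < s → u i = u j) &&
    (!(Pattern.turn u) || (decide (s < p) &&
      decide (∀ i j : Fin p, i.val ≤ s → j.val ≤ s → u i = u j))))

/-- The contribution, in thousandths, of the `s`-th single robot on one side to the potential. -/
def increment : ℕ → ℕ
  | 2 => 222
  | 3 => 222
  | 4 => 190
  | 5 => 506
  | _ => 0

/-- A bound for the contribution of one side to the potential after the round. -/
def Pattern.next {p : ℕ} (u : Fin p → Bool) : ℕ :=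
  ∑ s ∈ Finset.range 6, if Pattern.alive u s then increment s else 0

/-- Whether the round is regarded as unsuccessful on this side. -/
def Pattern.bad {p : ℕ} (u : Fin p → Bool) : Bool := decide (p = 5) || Pattern.turn u

/-- The expected contribution of one side to the next potential is at most `0.15`, whatever the
number of single robots there. At most `2 ^ 5` patterns are enumerated in integer arithmetic. -/
lemma Pattern.sum_next_le {p : ℕ} (hp : p ≤ 5) :
    ∑ u : Fin p → Bool, Pattern.next u ≤ 150 * 2 ^ p := by
  interval_cases p <;> decide +kernel

/-- This is the one-sided supermartingale inequality of `avg_bad_le`, scaled by `10 ^ 7`. The values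
of `increment` make it nearly tight for `p = 2, 3, 4`. At `p = 5`, where the count is capped, every
pattern is regarded as bad. -/
lemma Pattern.sum_bad_le {p : ℕ} (hp : p ≤ 5) :
    ∑ u : Fin p → Bool, (if Pattern.bad u then 8841600 + 16384 * Pattern.next u else 0) ≤
      10000 * (∑ s ∈ Finset.range (p + 1), increment s) * 2 ^ p := by
  interval_cases p <;> decide +kernel

end MSR

namespace MSR

variable {n : ℕ}

/-! ### The potential -/

section Potential
open Classical

/-- The `s` leftmost robots have the property `G` (of being single). -/
def Lead (G : Fin n → Prop) (s : ℕ) : Prop := ∀ j : Fin n, j.val < s → G j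

/-- The coins as seen from the other side. -/
def mirCoin (w : Fin n → Bool) : Fin n → Bool := fun j => !w j.rev

/-- The property `G` as seen from the other side. -/
def mirSet (G : Fin n → Prop) : Fin n → Prop := fun j => G j.rev

/-- The number of the leftmost robots with the property `G`, capped at five. -/
noncomputable def width (G : Fin n → Prop) : ℕ := Nat.findGreatest (Lead G) (min 5 n)

lemma width_le (G : Fin n → Prop) : width G ≤ n := (Nat.findGreatest_le _).trans (min_le_right _ _)
lemma width_le_five (G : Fin n → Prop) : width G ≤ 5 :=
  (Nat.findGreatest_le _).trans (min_le_left _ _)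
lemma lead_width (G : Fin n → Prop) : Lead G (width G) :=
  Nat.findGreatest_spec (P := Lead G) (m := 0) (Nat.zero_le _) (fun _ h => by simp at h)
lemma le_width {G : Fin n → Prop} {s : ℕ} (h5 : s ≤ 5) (hn : s ≤ n) (h : Lead G s) : s ≤ width G :=
  Nat.le_findGreatest (le_min h5 hn) h

lemma Lead.anti {G : Fin n → Prop} {s t : ℕ} (h : Lead G s) (hts : t ≤ s) : Lead G t :=
  fun j hj => h j (hj.trans_le hts)

/-- The pattern of the coins of the leftmost robots with the property `G`. -/
noncomputable def pat (G : Fin n → Prop) (w : Fin n → Bool) : Fin (width G) → Bool :=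
  w ∘ Fin.castLE (width_le G)

/-- The contribution of the left side to the potential. -/
noncomputable def sidePotential (G : Fin n → Prop) : ℝ :=
  ∑ s ∈ Finset.range 6, if Lead G s then (increment s : ℝ) / 1000 else 0

/-- A bound for the expectation, from the present round on, of the sum of `1.6384 ^ i` over the
unsuccessful rounds and the first successful one, if the robots in `G` are single. -/
noncomputable def potential (G : Fin n → Prop) : ℝ :=
  if ∀ j, G j then 3.3 else 1 + sidePotential G + sidePotential (mirSet G)

/-- A bound for the contribution of the left side to the potential in the next round. -/
noncomputable def sideNext (G : Fin n → Prop) (w : Fin n → Bool) : ℝ :=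
  (Pattern.next (pat G w) : ℝ) / 1000

/-- A bound for the potential in the next round, in terms of the coins `w` of this round. -/
noncomputable def potentialNext (G : Fin n → Prop) (w : Fin n → Bool) : ℝ :=
  1 + sideNext G w + sideNext (mirSet G) (mirCoin w) +
    if (∀ j, G j) ∧ ∀ i j, w i = w j then 2.3 else 0

/-- Two neighbours among the leftmost robots in `G` search towards each other. -/
def HeadTail (G : Fin n → Prop) (w : Fin n → Bool) : Prop :=
  ∃ p q : Fin n, q.val = p.val + 1 ∧ Lead G (q.val + 1) ∧ w p = true ∧ w q = false

/-- The round leads to rendezvous. -/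
def Success (G : Fin n → Prop) (w : Fin n → Bool) : Prop :=
  (∃ j, ¬ G j) ∧ ¬ HeadTail G w ∧ ¬ HeadTail (mirSet G) (mirCoin w)

/-- How the set of single robots may change in a round, on the left side. -/
structure Transition (G : Fin n → Prop) (w : Fin n → Bool) (G' : Fin n → Prop) : Prop where
  mono : ∀ s, Lead G' s → Lead G s
  eq : ∀ s, Lead G' s → ∀ i j : Fin n, i.val < s → j.val < s → w i = w j
  turn : ∀ M s, Lead G M → Lead G' s → ∀ p q : Fin n, q.val = p.val + 1 → q.val < M →
    w p = true → w q = false → s < M ∧ ∀ i j : Fin n, i.val ≤ s → j.val ≤ s → w i = w j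

lemma sideNext_nonneg (G : Fin n → Prop) (w : Fin n → Bool) : 0 ≤ sideNext G w := by
  unfold sideNext; positivity

lemma sidePotential_nonneg (G : Fin n → Prop) : 0 ≤ sidePotential G :=
  Finset.sum_nonneg fun s _ => by split_ifs <;> positivity

lemma one_le_potential (G : Fin n → Prop) : 1 ≤ potential G := by
  unfold potential
  have := sidePotential_nonneg G
  have := sidePotential_nonneg (mirSet G)
  split_ifs <;> [norm_num; linarith]

lemma potentialNext_nonneg (G : Fin n → Prop) (w : Fin n → Bool) : 0 ≤ potentialNext G w := by
  unfold potentialNext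
  have := sideNext_nonneg G w
  have := sideNext_nonneg (mirSet G) (mirCoin w)
  split_ifs <;> linarith

lemma le_sidePotential (G : Fin n → Prop) :
    ((∑ s ∈ Finset.range (width G + 1), increment s : ℕ) : ℝ) / 1000 ≤ sidePotential G := by
  unfold sidePotential
  push_cast
  rw [Finset.sum_div]
  have hsub : Finset.range (width G + 1) ⊆ Finset.range 6 :=
    Finset.range_subset_range.2 (by have := width_le_five G; omega)
  refine (Finset.sum_le_sum fun s hs => ?_).trans (Finset.sum_le_sum_of_subset_of_nonneg hsub
    (f := fun s => if Lead G s then (increment s : ℝ) / 1000 else 0)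
    fun s _ _ => by split_ifs <;> positivity)
  rw [if_pos ((lead_width G).anti (by rw [Finset.mem_range] at hs; omega))]

/-- The three clauses of `Transition` say that whenever the first `s` robots stay single, their coin
pattern is `Pattern.alive` for `s`. Hence the comparison holds term by term. -/
lemma Transition.sidePotential_le {G G' : Fin n → Prop} {w : Fin n → Bool} (h : Transition G w G')
    (hG' : ∃ j, ¬ G' j) : sidePotential G' ≤ sideNext G w := by
  unfold sidePotential sideNext Pattern.next
  push_cast
  rw [Finset.sum_div]
  refine Finset.sum_le_sum fun s hs => ?_
  rw [Finset.mem_range] at hs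
  by_cases hl : Lead G' s
  swap
  · rw [if_neg hl]; split_ifs <;> positivity
  -- For `s > n` the condition `Lead G' s` would just say that all robots are single, which `hG'`
  -- excludes.
  have hsn : s ≤ n := by
    by_contra hns
    obtain ⟨j, hj⟩ := hG'
    exact hj (hl j (by have := j.2; omega))
  have hsw := le_width (by omega) hsn (h.mono s hl)
  have halive : Pattern.alive (pat G w) s = true := by
    unfold Pattern.alive
    simp only [Bool.and_eq_true, Bool.or_eq_true, decide_eq_true_eq, Bool.not_eq_true']
    refine ⟨hsw, fun i j hi hj => h.eq s hl _ _ hi hj, ?_⟩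
    by_cases ht : Pattern.turn (pat G w) = true
    · right
      obtain ⟨i, j, hij, hi, hj⟩ := of_decide_eq_true ht
      obtain ⟨h1, h2⟩ := h.turn (width G) s (lead_width G) hl _ _ (by simpa using hij)
        (by simp) hi hj
      exact ⟨h1, fun i j hi hj => h2 _ _ hi hj⟩
    · left; simpa using ht
  rw [if_pos hl, if_pos halive]

/-- The bound for the potential in the next round. -/
lemma potential_le_next {G G' : Fin n → Prop} {w : Fin n → Bool} (h : Transition G w G')
    (h' : Transition (mirSet G) (mirCoin w) (mirSet G')) : potential G' ≤ potentialNext G w := by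
  unfold potential potentialNext
  have h1 := sideNext_nonneg G w
  have h2 := sideNext_nonneg (mirSet G) (mirCoin w)
  by_cases hall : ∀ j, G' j
  · have hlead : Lead G' n := fun j _ => hall j
    rw [if_pos hall, if_pos ⟨fun j => h.mono n hlead j j.2, fun i j => h.eq n hlead i j i.2 j.2⟩]
    linarith
  · rw [if_neg hall]
    push Not at hall
    have h3 := h.sidePotential_le hall
    have h4 := h'.sidePotential_le (by
      obtain ⟨j, hj⟩ := hall
      exact ⟨j.rev, by simpa [mirSet] using hj⟩)
    have h5 : (0 : ℝ) ≤ if (∀ j, G j) ∧ ∀ i j, w i = w j then 2.3 else 0 := by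
      split_ifs <;> norm_num
    linarith

/-- A heads-tails pair is visible among the first five coins, or else at least five robots lead and
the capped width is five. -/
lemma HeadTail.bad {G : Fin n → Prop} {w : Fin n → Bool} (h : HeadTail G w) :
    Pattern.bad (pat G w) = true := by
  obtain ⟨p, q, hpq, hl, hp, hq⟩ := h
  unfold Pattern.bad
  rw [Bool.or_eq_true, decide_eq_true_eq]
  by_cases h5 : q.val + 1 ≤ 5
  · have hw := le_width h5 q.2 hl
    right
    exact decide_eq_true ⟨⟨p, by omega⟩, ⟨q, by omega⟩, hpq, hp, hq⟩
  · left
    have := le_width le_rfl (by have := q.2; omega) (hl.anti (by omega : 5 ≤ q.val + 1))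
    have := width_le_five G
    omega

lemma avg_pat (G : Fin n → Prop) (F : (Fin (width G) → Bool) → ℝ) :
    avg (fun w => F (pat G w)) = avg F :=
  avg_comp_injective _ (Fin.castLE_injective _) F

lemma avg_pat_mirCoin (G : Fin n → Prop) (F : (Fin (width G) → Bool) → ℝ) :
    avg (fun w => F (pat G (mirCoin w))) = avg F := by
  rw [← avg_not F]
  exact avg_comp_injective (fun i => (Fin.castLE (width_le G) i).rev)
    (Fin.rev_injective.comp (Fin.castLE_injective _)) (fun u => F fun i => !u i)

/-- If not all robots are in `G`, then the coins on the two sides are independent. -/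
lemma avg_mul_pat {G : Fin n → Prop} (hG : ∃ j, ¬ G j) (F : (Fin (width G) → Bool) → ℝ)
    (F' : (Fin (width (mirSet G)) → Bool) → ℝ) :
    avg (fun w => F (pat G w) * F' (pat (mirSet G) (mirCoin w))) = avg F * avg F' := by
  have hne : ∀ (i : Fin (width G)) (j : Fin (width (mirSet G))),
      Fin.castLE (width_le G) i ≠ (Fin.castLE (width_le (mirSet G)) j).rev := by
    intro i j hij
    obtain ⟨k, hk⟩ := hG
    have hv := congrArg Fin.val hij
    simp only [Fin.val_castLE, Fin.val_rev] at hv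
    have h1 : ¬ k.val < width G := fun h => hk (lead_width G k h)
    have h2 : ¬ k.rev.val < width (mirSet G) := fun h => hk (by
      simpa [mirSet] using lead_width (mirSet G) k.rev h)
    rw [Fin.val_rev] at h2
    have := i.2; have := j.2; have := k.2
    omega
  rw [← avg_not F', ← avg_mul_sum F (fun u => F' fun i => !u i)]
  refine avg_comp_injective (Sum.elim (Fin.castLE (width_le G))
    fun j => (Fin.castLE (width_le (mirSet G)) j).rev) ?_
    (fun z => F (z ∘ Sum.inl) * F' (fun i => !(z ∘ Sum.inr) i))
  exact Function.Injective.sumElim (Fin.castLE_injective _)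
    (Fin.rev_injective.comp (Fin.castLE_injective _)) hne

lemma avg_next_le {p : ℕ} (hp : p ≤ 5) :
    avg (fun u : Fin p → Bool => (Pattern.next u : ℝ) / 1000) ≤ 0.15 := by
  have h : ((∑ u : Fin p → Bool, Pattern.next u : ℕ) : ℝ) ≤ ((150 * 2 ^ p : ℕ) : ℝ) := by
    exact_mod_cast Pattern.sum_next_le hp
  push_cast at h
  unfold avg
  rw [Fintype.card_fin, div_le_iff₀ (by positivity), ← Finset.sum_div]
  linarith

/-- Here `0.88416 = 0.6384 + 1.6384 * 0.15`: the loss `1.6384 - 1` of a failure, plus the mean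
contribution of the other side to the discounted next potential. -/
lemma avg_bad_le {p : ℕ} (hp : p ≤ 5) :
    avg (fun u : Fin p → Bool => (if Pattern.bad u then (1 : ℝ) else 0) *
      (0.88416 + 1.6384 * ((Pattern.next u : ℝ) / 1000))) ≤
      ((∑ s ∈ Finset.range (p + 1), increment s : ℕ) : ℝ) / 1000 := by
  have h : ((∑ u : Fin p → Bool, (if Pattern.bad u then 8841600 + 16384 * Pattern.next u else 0) : ℕ)
      : ℝ) ≤ ((10000 * (∑ s ∈ Finset.range (p + 1), increment s) * 2 ^ p : ℕ) : ℝ) := by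
    exact_mod_cast Pattern.sum_bad_le hp
  have h2 : ((∑ u : Fin p → Bool, (if Pattern.bad u then 8841600 + 16384 * Pattern.next u else 0) : ℕ)
      : ℝ) = 10000000 * ∑ u : Fin p → Bool, (if Pattern.bad u then (1 : ℝ) else 0) *
      (0.88416 + 1.6384 * ((Pattern.next u : ℝ) / 1000)) := by
    rw [Nat.cast_sum, Finset.mul_sum]
    refine Finset.sum_congr rfl fun u _ => ?_
    split_ifs
    · push_cast; ring
    · simp
  rw [h2] at h
  push_cast at h ⊢
  unfold avg
  rw [Fintype.card_fin, div_le_iff₀ (by positivity)]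
  linarith

lemma avg_sideNext_le (G : Fin n → Prop) : avg (fun w => sideNext G w) ≤ 0.15 :=
  (avg_pat G fun u => (Pattern.next u : ℝ) / 1000).trans_le (avg_next_le (width_le_five G))

lemma avg_sideNext_mirCoin_le (G : Fin n → Prop) :
    avg (fun w => sideNext G (mirCoin w)) ≤ 0.15 :=
  (avg_pat_mirCoin G fun u => (Pattern.next u : ℝ) / 1000).trans_le (avg_next_le (width_le_five G))

lemma avg_all_eq_le (hn : 0 < n) (P : Prop) :
    avg (fun w : Fin n → Bool => if P ∧ ∀ i j, w i = w j then (2.3 : ℝ) else 0) ≤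
      2.3 * (2 / 2 ^ n) := by
  have h : ∀ w : Fin n → Bool, (if P ∧ ∀ i j, w i = w j then (2.3 : ℝ) else 0) ≤
      2.3 * ((if w = fun _ => true then 1 else 0) + if w = fun _ => false then 1 else 0) := by
    intro w
    split_ifs with h1 h2 h3 h4 h5 h6
    · norm_num
    · norm_num
    · norm_num
    · exfalso
      cases hw : w ⟨0, hn⟩
      · exact h4 (funext fun i => (h1.2 i ⟨0, hn⟩).trans hw)
      · exact h2 (funext fun i => (h1.2 i ⟨0, hn⟩).trans hw)
    all_goals norm_num
  refine (avg_mono h).trans (le_of_eq ?_)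
  rw [avg_mul_left]
  unfold avg
  rw [Finset.sum_add_distrib, Finset.sum_ite_eq', Finset.sum_ite_eq']
  simp; norm_num

/-- The expected potential after a round. -/
lemma avg_potentialNext_le (hn : 0 < n) (G : Fin n → Prop) :
    avg (potentialNext G) ≤ 1.3 + 2.3 * (2 / 2 ^ n) := by
  have h1 : avg (sideNext G) ≤ 0.15 := avg_sideNext_le G
  have h2 := avg_sideNext_mirCoin_le (mirSet G)
  have h3 : avg (fun w : Fin n → Bool => if (∀ j, G j) ∧ ∀ i j, w i = w j then (2.3 : ℝ) else 0) ≤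
      2.3 * (2 / 2 ^ n) := by
    convert avg_all_eq_le hn (∀ j, G j)
  unfold potentialNext
  rw [avg_add, avg_add, avg_add, avg_const]
  linarith

/-- The potential bounds the contribution of the present round and the expected potential in the
next one. -/
lemma avg_step_le (hn : 2 < n) (G : Fin n → Prop) :
    avg (fun w => if Success G w then 1 else 1.6384 * potentialNext G w) ≤ potential G := by
  by_cases hall : ∀ j, G j
  · have h1 : ∀ w, (if Success G w then 1 else 1.6384 * potentialNext G w) =
        1.6384 * potentialNext G w := fun w => if_neg fun h => by
      obtain ⟨j, hj⟩ := h.1; exact hj (hall j)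
    simp only [h1]
    rw [avg_mul_left, potential, if_pos hall]
    have h2 := avg_potentialNext_le (by omega) G
    -- With `n ≥ 3` the left side is at most `1.6384 * 1.875 < 3.3`, the value of the potential when
    -- all robots are single.
    have h3 : (2 : ℝ) / 2 ^ n ≤ 1 / 4 := by
      rw [div_le_iff₀ (by positivity)]
      have : (2 : ℝ) ^ 3 ≤ 2 ^ n := pow_le_pow_right₀ (by norm_num) hn
      linarith
    linarith
  rw [potential, if_neg hall]
  have hG : ∃ j, ¬ G j := by push Not at hall; exact hall
  let bL : (Fin (width G) → Bool) → ℝ := fun u => if Pattern.bad u then 1 else 0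
  let bR : (Fin (width (mirSet G)) → Bool) → ℝ := fun u => if Pattern.bad u then 1 else 0
  let xL : (Fin (width G) → Bool) → ℝ := fun u => (Pattern.next u : ℝ) / 1000
  let xR : (Fin (width (mirSet G)) → Bool) → ℝ := fun u => (Pattern.next u : ℝ) / 1000
  have hbL : ∀ u, 0 ≤ bL u := fun u => by simp only [bL]; split_ifs <;> norm_num
  have hbR : ∀ u, 0 ≤ bR u := fun u => by simp only [bR]; split_ifs <;> norm_num
  have hxL : ∀ u, 0 ≤ xL u := fun u => by simp only [xL]; positivity
  have hxR : ∀ u, 0 ≤ xR u := fun u => by simp only [xR]; positivity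
  -- A failure is bad on at least one side, so the excess `1.6384 * (1 + xL + xR) - 1` is charged to
  -- the left if `bL = 1` and to the right if `bR = 1`.
  have hpt : ∀ w, (if Success G w then 1 else 1.6384 * potentialNext G w) ≤
      1 + (bL (pat G w) * (0.6384 + 1.6384 * xL (pat G w)) +
        1.6384 * (bL (pat G w) * xR (pat (mirSet G) (mirCoin w))) +
        (bR (pat (mirSet G) (mirCoin w)) * (0.6384 + 1.6384 * xR (pat (mirSet G) (mirCoin w))) +
        1.6384 * (xL (pat G w) * bR (pat (mirSet G) (mirCoin w))))) := by
    intro w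
    have k1 := hbL (pat G w)
    have k2 := hbR (pat (mirSet G) (mirCoin w))
    have k3 := hxL (pat G w)
    have k4 := hxR (pat (mirSet G) (mirCoin w))
    have k5 := mul_nonneg k1 k3
    have k6 := mul_nonneg k2 k3
    have k7 := mul_nonneg k1 k4
    have k8 := mul_nonneg k2 k4
    by_cases hs : Success G w
    · rw [if_pos hs]; linarith
    · rw [if_neg hs]
      have hV : potentialNext G w = 1 + xL (pat G w) + xR (pat (mirSet G) (mirCoin w)) := by
        unfold potentialNext; rw [if_neg fun h => hall h.1, add_zero]; rfl
      rw [hV]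
      have hbad : HeadTail G w ∨ HeadTail (mirSet G) (mirCoin w) := by
        by_contra hcon; push Not at hcon; exact hs ⟨hG, hcon⟩
      rcases hbad with hb | hb
      · have hb1 : bL (pat G w) = 1 := if_pos hb.bad
        rw [hb1] at *; linarith
      · have hb1 : bR (pat (mirSet G) (mirCoin w)) = 1 := if_pos hb.bad
        rw [hb1] at *; linarith
  refine (avg_mono hpt).trans ?_
  rw [avg_add, avg_const, avg_add, avg_add, avg_add, avg_mul_left, avg_mul_left,
    avg_mul_pat hG bL xR, avg_mul_pat hG xL bR,
    avg_pat G fun u => bL u * (0.6384 + 1.6384 * xL u),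
    avg_pat_mirCoin (mirSet G) fun u => bR u * (0.6384 + 1.6384 * xR u)]
  have e1 : avg (fun u => bL u * (0.88416 + 1.6384 * xL u)) =
      avg (fun u => bL u * (0.6384 + 1.6384 * xL u)) + 0.24576 * avg bL := by
    rw [← avg_mul_left, ← avg_add]; congr 1; funext u; ring
  have e2 : avg (fun u => bR u * (0.88416 + 1.6384 * xR u)) =
      avg (fun u => bR u * (0.6384 + 1.6384 * xR u)) + 0.24576 * avg bR := by
    rw [← avg_mul_left, ← avg_add]; congr 1; funext u; ring
  have f1 : avg (fun u => bL u * (0.88416 + 1.6384 * xL u)) ≤ sidePotential G :=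
    (avg_bad_le (width_le_five G)).trans (le_sidePotential G)
  have f2 : avg (fun u => bR u * (0.88416 + 1.6384 * xR u)) ≤ sidePotential (mirSet G) :=
    (avg_bad_le (width_le_five _)).trans (le_sidePotential _)
  have g1 : avg bL * avg xR ≤ avg bL * 0.15 :=
    mul_le_mul_of_nonneg_left (avg_next_le (width_le_five _)) (avg_nonneg hbL)
  have g2 : avg xL * avg bR ≤ 0.15 * avg bR :=
    mul_le_mul_of_nonneg_right (avg_next_le (width_le_five _)) (avg_nonneg hbR)
  linarith

end Potential

end MSR

namespace MSR

variable {n : ℕ}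

/-! ### The coins of different rounds are independent -/

/-- The coins of the rounds before round `i`. -/
def past (n i : ℕ) : Finset (ℕ × Fin n) := Finset.range i ×ˢ Finset.univ

/-- The coins of round `i`. -/
def row (ω : Coins n) (i : ℕ) : Fin n → Bool := fun j => ω (i, j)

lemma mem_past {i : ℕ} {p : ℕ × Fin n} : p ∈ past n i ↔ p.1 < i := by simp [past]

lemma past_mono {i j : ℕ} (h : i ≤ j) : (past n i : Set (ℕ × Fin n)) ⊆ past n j := fun p hp => by
  simp only [Finset.mem_coe, mem_past] at *; omega

instance : IsProbabilityMeasure (coinLaw n) := by unfold coinLaw; infer_instance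

lemma measurable_of_dependsOn {β : Type*} [MeasurableSpace β] [Nonempty β] {f : Coins n → β}
    {I : Finset (ℕ × Fin n)} (h : DependsOn f (I : Set (ℕ × Fin n))) : Measurable f := by
  obtain ⟨g, rfl⟩ := dependsOn_iff_exists_comp.1 h
  have h1 : Measurable g := measurable_of_countable g
  refine h1.comp ?_
  exact measurable_pi_lambda _ fun i => measurable_pi_apply _

lemma coinLaw_row (i : ℕ) (w : Fin n → Bool) : coinLaw n {ω | row ω i = w} = 1 / 2 ^ n := by
  have h1 : {ω : Coins n | row ω i = w} =
      Set.pi (({i} ×ˢ Finset.univ : Finset (ℕ × Fin n)) : Set (ℕ × Fin n)) fun p => {w p.2} := by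
    ext ω
    simp only [Set.mem_ofPred_eq, Set.mem_pi, Finset.mem_coe, Finset.mem_product,
      Finset.mem_singleton, Finset.mem_univ, and_true, Set.mem_singleton_iff, funext_iff, row]
    constructor
    · rintro h ⟨a, b⟩ rfl; exact h b
    · intro h j; exact h (i, j) rfl
  rw [h1, coinLaw, Measure.infinitePi_pi _ (fun _ _ => MeasurableSet.singleton _)]
  simp [ENNReal.inv_pow]

lemma indepFun_past_row {i : ℕ} (g : Coins n → ℝ≥0∞)
    (hg : DependsOn g (past n i : Set (ℕ × Fin n))) (h : (Fin n → Bool) → ℝ≥0∞) :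
    ProbabilityTheory.IndepFun g (fun ω => h (row ω i)) (coinLaw n) := by
  have hd : Disjoint (past n i) ({i} ×ˢ Finset.univ : Finset (ℕ × Fin n)) := by
    rw [Finset.disjoint_left]
    intro p hp hq
    rw [mem_past] at hp
    have := Finset.mem_singleton.1 (Finset.mem_product.1 hq).1
    omega
  have hind := (ProbabilityTheory.iIndepFun_infinitePi (X := fun (_ : ℕ × Fin n) (b : Bool) => b)
    (P := fun _ => (PMF.uniformOfFintype Bool).toMeasure) (fun _ => measurable_id)).indepFun_finset
    _ _ hd (fun i => measurable_pi_apply i)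
  obtain ⟨g', rfl⟩ := dependsOn_iff_exists_comp.1 hg
  exact hind.comp (φ := g')
    (ψ := fun z : ({i} ×ˢ Finset.univ : Finset (ℕ × Fin n)) → Bool => h fun j => z ⟨(i, j), by simp⟩)
    (measurable_of_countable _) (measurable_of_countable _)

/-- Integrating out the coins of round `i`. -/
lemma lintegral_row {i : ℕ} (Ψ : (Fin n → Bool) → Coins n → ℝ≥0∞)
    (hΨ : ∀ w, DependsOn (Ψ w) (past n i : Set (ℕ × Fin n))) :
    ∫⁻ ω, Ψ (row ω i) ω ∂(coinLaw n) = ∫⁻ ω, (∑ w, Ψ w ω) / 2 ^ n ∂(coinLaw n) := by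
  classical
  have hm : ∀ w, Measurable (Ψ w) := fun w => measurable_of_dependsOn (hΨ w)
  have hrow : Measurable fun ω : Coins n => row ω i :=
    measurable_pi_lambda _ fun j => measurable_pi_apply _
  have h1 : ∀ w, Measurable fun ω : Coins n => if row ω i = w then (1 : ℝ≥0∞) else 0 := fun w =>
    (measurable_of_countable fun z : Fin n → Bool => if z = w then (1 : ℝ≥0∞) else 0).comp hrow
  -- Splitting by the value of the row separates the dependence on round `i` from that on the past.
  have h2 : ∀ ω, Ψ (row ω i) ω = ∑ w, Ψ w ω * if row ω i = w then 1 else 0 := fun ω => by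
    simp
  have h3 : ∀ w, ∫⁻ ω, (if row ω i = w then (1 : ℝ≥0∞) else 0) ∂(coinLaw n) = 1 / 2 ^ n := fun w => by
    have h : MeasurableSet {ω : Coins n | row ω i = w} := hrow (MeasurableSet.singleton w)
    rw [← coinLaw_row i w, ← lintegral_indicator_one h]
    exact lintegral_congr fun ω => by simp [Set.indicator]
  have h4 : ∀ w, Measurable fun ω : Coins n => Ψ w ω * if row ω i = w then (1 : ℝ≥0∞) else 0 :=
    fun w => (hm w).mul (h1 w)
  simp only [h2]
  rw [lintegral_finsetSum _ fun w _ => h4 w]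
  simp only [div_eq_mul_inv]
  rw [lintegral_mul_const _ (Finset.measurable_fun_sum _ fun w _ => hm w),
    lintegral_finsetSum _ fun w _ => hm w, Finset.sum_mul]
  refine Finset.sum_congr rfl fun w _ => ?_
  rw [ProbabilityTheory.lintegral_mul_eq_lintegral_mul_lintegral_of_indepFun'' (hm w).aemeasurable
    (h1 w).aemeasurable (indepFun_past_row (Ψ w) (hΨ w) fun z => if z = w then 1 else 0), h3, one_div]

lemma sum_ofReal_div {F : (Fin n → Bool) → ℝ} (hF : ∀ w, 0 ≤ F w) :
    (∑ w, ENNReal.ofReal (F w)) / 2 ^ n = ENNReal.ofReal (avg F) := by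
  rw [← ENNReal.ofReal_sum_of_nonneg fun w _ => hF w, avg, Fintype.card_fin,
    ENNReal.ofReal_div_of_pos (by positivity), ENNReal.ofReal_pow (by norm_num)]
  norm_num

/-! ### The number of unsuccessful rounds -/

section
open Classical

variable {m : ℕ} (G : ℕ → Coins n → Fin n → Prop)

/-- Round `m + k` leads to rendezvous. -/
def SuccessAt (m : ℕ) (k : ℕ) (ω : Coins n) : Prop := Success (G k ω) (row ω (m + k))

/-- The `k` rounds from round `m` on do not lead to rendezvous. -/
def Fails (m : ℕ) (k : ℕ) (ω : Coins n) : Prop := ∀ j < k, ¬ SuccessAt G m j ω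

/-- Round `m + k` is the first one from round `m` on that leads to rendezvous. -/
def FirstSuccess (m : ℕ) (k : ℕ) (ω : Coins n) : Prop := Fails G m k ω ∧ SuccessAt G m k ω

variable {G} (hG : ∀ k, DependsOn (G k) (past n (m + k) : Set (ℕ × Fin n)))

include hG in
lemma dependsOn_successAt (k : ℕ) :
    DependsOn (SuccessAt G m k) (past n (m + k + 1) : Set (ℕ × Fin n)) := by
  intro ω ω' h
  have h1 : G k ω = G k ω' := hG k fun p hp => h p (past_mono (by omega) hp)
  have h2 : row ω (m + k) = row ω' (m + k) := funext fun j =>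
    h (m + k, j) (by simp [mem_past])
  simp only [SuccessAt, h1, h2]

include hG in
lemma dependsOn_fails (k : ℕ) : DependsOn (Fails G m k) (past n (m + k) : Set (ℕ × Fin n)) := by
  intro ω ω' h
  have : ∀ j < k, SuccessAt G m j ω = SuccessAt G m j ω' := fun j hj =>
    dependsOn_successAt hG j fun p hp => h p (past_mono (by omega) hp)
  simp only [Fails, eq_iff_iff]
  exact forall₂_congr fun j hj => by rw [this j hj]

include hG in
lemma measurableSet_firstSuccess (k : ℕ) : MeasurableSet {ω | FirstSuccess G m k ω} := by
  have h : DependsOn (FirstSuccess G m k) (past n (m + k + 1) : Set (ℕ × Fin n)) := by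
    intro ω ω' h
    have h1 := dependsOn_fails hG k fun p hp => h p (past_mono (by omega) hp)
    have h2 := dependsOn_successAt hG k h
    simp only [FirstSuccess, h1, h2]
  exact measurableSet_setOfPred.2 (measurable_of_dependsOn h)

include hG in
lemma measurableSet_fails (k : ℕ) : MeasurableSet {ω | Fails G m k ω} :=
  measurableSet_setOfPred.2 (measurable_of_dependsOn (dependsOn_fails hG k))

variable (hstep : ∀ k ω, potential (G (k + 1) ω) ≤ potentialNext (G k ω) (row ω (m + k)))

-- The supermartingale inequality, iterated: the weights of the first successes so far plus the
-- discounted potential on the event of no success never exceed the initial expected potential.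
include hG hstep in
lemma sum_firstSuccess_add_le (hn : 2 < n) (N : ℕ) :
    ∑ k ∈ Finset.range N, ENNReal.ofReal 1.6384 ^ k * coinLaw n {ω | FirstSuccess G m k ω} +
      ENNReal.ofReal 1.6384 ^ N * ∫⁻ ω, (if Fails G m N ω then 1 else 0) *
        ENNReal.ofReal (potential (G N ω)) ∂(coinLaw n) ≤
      ∫⁻ ω, ENNReal.ofReal (potential (G 0 ω)) ∂(coinLaw n) := by
  induction N with
  | zero => simp [Fails]
  | succ N ih =>
    refine le_trans ?_ ih
    rw [Finset.sum_range_succ, add_assoc, pow_succ, mul_assoc, ← mul_add]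
    gcongr
    let F : (Fin n → Prop) → (Fin n → Bool) → ℝ := fun g w =>
      if Success g w then 1 else 1.6384 * potentialNext g w
    have hF : ∀ g w, 0 ≤ F g w := fun g w => by
      simp only [F]; have := potentialNext_nonneg g w; split_ifs <;> positivity
    have hdep : ∀ w, DependsOn (fun ω => (if Fails G m N ω then (1 : ℝ≥0∞) else 0) *
        ENNReal.ofReal (F (G N ω) w)) (past n (m + N) : Set (ℕ × Fin n)) := by
      intro w ω ω' h
      simp only [hG N h, dependsOn_fails hG N h]
    have h1 : ∫⁻ ω, (if Fails G m N ω then (1 : ℝ≥0∞) else 0) *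
        ENNReal.ofReal (F (G N ω) (row ω (m + N))) ∂(coinLaw n) ≤
        ∫⁻ ω, (if Fails G m N ω then 1 else 0) * ENNReal.ofReal (potential (G N ω)) ∂(coinLaw n) := by
      rw [lintegral_row (fun w ω => (if Fails G m N ω then (1 : ℝ≥0∞) else 0) *
        ENNReal.ofReal (F (G N ω) w)) hdep]
      refine lintegral_mono fun ω => ?_
      rw [← Finset.mul_sum, mul_div_assoc, sum_ofReal_div (hF _)]
      gcongr
      exact avg_step_le hn (G N ω)
    refine le_trans ?_ h1
    rw [← lintegral_indicator_one (measurableSet_firstSuccess hG N),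
      ← lintegral_const_mul' _ _ ENNReal.ofReal_ne_top,
      ← lintegral_add_left (measurable_one.indicator (measurableSet_firstSuccess hG N))]
    refine lintegral_mono fun ω => ?_
    by_cases hf : Fails G m N ω
    swap
    · have k1 : ¬ FirstSuccess G m N ω := fun h => hf h.1
      have k2 : ¬ Fails G m (N + 1) ω := fun h => hf fun j hj => h j (by omega)
      simp [k1, k2]
    by_cases hs : SuccessAt G m N ω
    · have k1 : FirstSuccess G m N ω := ⟨hf, hs⟩
      have k2 : ¬ Fails G m (N + 1) ω := fun h => h N (by omega) hs
      have k3 : F (G N ω) (row ω (m + N)) = 1 := if_pos hs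
      simp [k1, k2, hf, k3]
    · have k1 : ¬ FirstSuccess G m N ω := fun h => hs h.2
      have k2 : Fails G m (N + 1) ω := fun j hj => by
        rcases Nat.lt_succ_iff_lt_or_eq.1 hj with h | rfl
        · exact hf j h
        · exact hs
      have k3 : F (G N ω) (row ω (m + N)) = 1.6384 * potentialNext (G N ω) (row ω (m + N)) :=
        if_neg hs
      simp only [Set.indicator, Set.mem_ofPred_eq, k1, if_false, k2, if_true, hf, k3, one_mul, zero_add]
      rw [ENNReal.ofReal_mul (by norm_num)]
      gcongr
      exact hstep N ω

include hG hstep in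
lemma tsum_firstSuccess_le (hn : 2 < n) :
    ∑' k, ENNReal.ofReal 1.6384 ^ k * coinLaw n {ω | FirstSuccess G m k ω} ≤
      ∫⁻ ω, ENNReal.ofReal (potential (G 0 ω)) ∂(coinLaw n) :=
  ENNReal.tsum_le_of_sum_range_le fun N =>
    le_self_add.trans (sum_firstSuccess_add_le hG hstep hn N)

include hG hstep in
/-- Almost surely, some round leads to rendezvous. -/
lemma ae_exists_firstSuccess (hn : 2 < n)
    (hfin : ∫⁻ ω, ENNReal.ofReal (potential (G 0 ω)) ∂(coinLaw n) ≠ ∞) :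
    ∀ᵐ ω ∂(coinLaw n), ∃ k, FirstSuccess G m k ω := by
  set C := ∫⁻ ω, ENNReal.ofReal (potential (G 0 ω)) ∂(coinLaw n) with hC
  have h1 : ∀ N, ENNReal.ofReal 1.6384 ^ N * coinLaw n {ω | Fails G m N ω} ≤ C := by
    intro N
    refine le_trans ?_ (le_add_self.trans (sum_firstSuccess_add_le hG hstep hn N))
    gcongr
    rw [← lintegral_indicator_one (measurableSet_fails hG N)]
    refine lintegral_mono fun ω => ?_
    by_cases hf : Fails G m N ω
    · simp only [Set.indicator, Set.mem_ofPred_eq, hf, if_true, one_mul, Pi.one_apply]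
      rw [← ENNReal.ofReal_one]
      exact ENNReal.ofReal_le_ofReal (one_le_potential _)
    · simp [Set.indicator, hf]
  have h2 : coinLaw n {ω | ∀ k, ¬ FirstSuccess G m k ω} = 0 := by
    have hsub : ∀ N, {ω | ∀ k, ¬ FirstSuccess G m k ω} ⊆ {ω : Coins n | Fails G m N ω} := by
      intro N ω hω j _ hs
      have hex : ∃ j, SuccessAt G m j ω := ⟨j, hs⟩
      exact hω (Nat.find hex) ⟨fun i hi => Nat.find_min hex hi, Nat.find_spec hex⟩
    -- The event of no success at all lies in every failure event, so its probability is at most `C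
    -- / 1.6384 ^ N` for all `N`.
    have h3 : ∀ N, ENNReal.ofReal 1.6384 ^ N *
        coinLaw n {ω | ∀ k, ¬ FirstSuccess G m k ω} ≤ C := fun N =>
      (mul_le_mul_right (measure_mono (hsub N)) _).trans (h1 N)
    by_contra hne
    have h4 : Tendsto (fun N : ℕ => ENNReal.ofReal 1.6384 ^ N *
        coinLaw n {ω | ∀ k, ¬ FirstSuccess G m k ω}) atTop (𝓝 (∞ * coinLaw n
          {ω | ∀ k, ¬ FirstSuccess G m k ω})) := by
      refine ENNReal.Tendsto.mul_const (ENNReal.tendsto_pow_atTop_nhds_top_iff.2 ?_) (.inl (by simp))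
      rw [← ENNReal.ofReal_one]
      exact (ENNReal.ofReal_lt_ofReal_iff (by norm_num)).2 (by norm_num)
    rw [ENNReal.top_mul hne] at h4
    exact hfin (top_le_iff.1 (le_of_tendsto' h4 h3))
  rw [ae_iff]
  simpa using h2

end

end MSR

namespace MSR

variable {n : ℕ} {r : ℝ} {x : Fin n → ℝ} {c c' e m e' : Config n} {ω : Coins n}

/-! ### The single robots during a round -/

/-- The single robots. -/
def singles (c : Config n) : Fin n → Prop := fun j => c.mode j = .single

lemma singles_mir (c : Config n) : singles (mir c) = mirSet (singles c) := by
  funext j; simp [singles, mirSet]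

/-- In phase one, single robots search to the right on heads and to the left on tails. -/
def Follows (c : Config n) (w : Fin n → Bool) : Prop :=
  ∀ j, c.mode j = .single → (c.dir j = .right ↔ w j = true)

lemma Follows.mir {w : Fin n → Bool} (h : Follows c w) : Follows (mir c) (mirCoin w) := by
  intro j hj
  have h1 := h j.rev (by simpa using hj)
  cases hw : w j.rev <;> cases hd : c.dir j.rev <;> simp_all [mirCoin, Dir.opp]

lemma Follows.left {w : Fin n → Bool} (h : Follows c w) {j : Fin n} (hj : c.mode j = .single) :
    c.dir j = .left ↔ w j = false := by
  have := h j hj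
  cases hw : w j <;> cases hd : c.dir j <;> simp_all

lemma Follows.eq {w : Fin n → Bool} (h : Follows c w) {i j : Fin n} (hi : c.mode i = .single)
    (hj : c.mode j = .single) (hd : c.dir i = c.dir j) : w i = w j := by
  have h1 := h i hi
  have h2 := h j hj
  rw [hd] at h1
  have := h1.symm.trans h2
  cases hw : w i <;> cases hw' : w j <;> simp_all

lemma Follows.headTail {w : Fin n → Bool} (h : Follows c w) (ht : Turn c.mode c.dir) :
    HeadTail (singles c) w := by
  obtain ⟨p, q, hpq, hl, hp, hq⟩ := ht
  exact ⟨p, q, hpq, hl, (h p (hl p (by omega))).1 hp, (h.left (hl q (by omega))).1 hq⟩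

lemma IsRound.transition (h : IsRound r x c e m e') (hr : 1 ≤ r) (hx : StrictMono x) (hn : 2 < n)
    (hgap : Narrow x (2 * r ^ (2 * c.round))) {w : Fin n → Bool} (hw : Follows c w) :
    Transition (singles c) w (singles e') := by
  have hmono : ∀ s, Lead (singles e') s → Lead (singles c) s := fun s hs j hj => h.single_c (hs j hj)
  refine ⟨hmono, fun s hs i j hi hj => ?_, fun M s hM hs p q hpq hq hp hqf => ?_⟩
  · exact hw.eq (hmono s hs i hi) (hmono s hs j hj) (h.dir_eq_of_leading hr hn hgap hs hi hj)
  · obtain ⟨h1, h2⟩ := h.dir_eq_of_turn hr hx hn hgap hM hpq hq ((hw p (hM p (by omega))).2 hp)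
      ((hw.left (hM q hq)).2 hqf) hs
    exact ⟨h1, fun i j hi hj => hw.eq (hM i (by omega)) (hM j (by omega)) (h2 i j hi hj)⟩

lemma narrow_mirX {D : ℝ} (h : Narrow x D) : Narrow (mirX x) D := by
  intro i j hij hc
  have h1 := h j.rev i.rev (Fin.rev_lt_rev.2 hij) (by
    have := i.2; have := j.2; simp only [Fin.val_rev]; omega)
  simp only [mirX]; linarith

lemma follows_start (ω : Coins n) (i : ℕ) : Follows (start r x ω i) (row ω i) := by
  intro j hj
  rw [start_dir, hj]
  simp only [roundDir, row]
  cases ω (i, j) <;> simp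

/-- Both sides of the potential are controlled by `IsRound.transition`, applied to the round and to
its reflection. -/
lemma potential_start_le (hr : 1 ≤ r) (hx : StrictMono x) (hn : 2 < n) (i : ℕ)
    (hgap : Narrow x (2 * r ^ (2 * i))) (ω : Coins n) :
    potential (singles (start r x ω (i + 1))) ≤ potentialNext (singles (start r x ω i)) (row ω i) := by
  have h := (roundStart_start hr hx ω i).isRound hr hx
  have hw := follows_start (r := r) (x := x) ω i
  refine potential_le_next (h.transition hr hx hn (by rwa [start_round]) hw) ?_
  have h2 := h.mir.transition hr (strictMono_mirX hx) hn
    (by rw [mir_round, start_round]; exact narrow_mirX hgap) hw.mir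
  rw [singles_mir, singles_mir] at h2
  exact h2

lemma dependsOn_singles_start (i : ℕ) :
    DependsOn (fun ω : Coins n => singles (start r x ω i)) (past n i : Set (ℕ × Fin n)) := by
  intro ω ω' h
  have := (start_congr (r := r) (x := x) (i := i) (ω := ω) (ω' := ω') fun m hm j =>
    h (m, j) (mem_past.2 hm)).2.2
  funext j
  simp only [singles, this]

/-- A successful round leads to rendezvous. -/
lemma cost_le_of_success (hr : 1 ≤ r) (hx : StrictMono x) {lo hi : ℝ} (hlo : ∀ j, lo ≤ x j)
    (hhi : ∀ j, x j ≤ hi) {i : ℕ} (h1 : hi - lo < 2 * r ^ (2 * i)) (h2 : hi - lo ≤ r ^ (2 * i + 1))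
    (hs : Success (singles (start r x ω i)) (row ω i)) (j : Fin n) :
    Rendezvous r x ω ∧ cost r x ω j ≤
      ENNReal.ofReal (beginTime r i + phaseTime r i .one + (r ^ (2 * i) + (hi - lo))) := by
  have hw := follows_start (r := r) (x := x) ω i
  obtain ⟨c', hp, hg, ht⟩ := (roundStart_start hr hx ω i).exists_gathered hr hx hlo hhi
    (by rwa [start_round]) (by rwa [start_round]) hs.1 (fun h => hs.2.1 (hw.headTail h))
    (fun h => hs.2.2 (by have := hw.mir.headTail h; rwa [singles_mir] at this))
  rw [start_round] at ht
  obtain ⟨k1, k2⟩ := cost_le_of_gathered hr hx ω i hp hg j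
  exact ⟨k1, k2.trans (ENNReal.ofReal_le_ofReal (by linarith))⟩

/-! ### The numerical estimates -/

/-- The constant solves `C + (1 + r) ^ 2 = r ^ 2 * C`, so `C = (r + 1) / (r - 1) = 57 / 7` for `r =
1.28`. -/
lemma beginTime_add_le (i : ℕ) :
    beginTime 1.28 i + phaseTime 1.28 i .one ≤ 57 / 7 * (1.28 : ℝ) ^ (2 * i) := by
  induction i with
  | zero => rw [phaseTime_one_zero]; norm_num [beginTime]
  | succ i ih =>
    rw [beginTime, phaseTime_one_succ, phaseTime_two]
    have h : (0 : ℝ) < 1.28 ^ (2 * i) := by positivity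
    have e1 : (1.28 : ℝ) ^ (2 * i + 1) = 1.28 * 1.28 ^ (2 * i) := by ring
    have e2 : (1.28 : ℝ) ^ (2 * i + 2) = 1.6384 * 1.28 ^ (2 * i) := by ring
    have e3 : (1.28 : ℝ) ^ (2 * (i + 1)) = 1.6384 * 1.28 ^ (2 * i) := by ring
    rw [e1, e2, e3]
    linarith

/-- The first round in which the search radius is at least half of the initial distance. -/
lemma exists_threshold {d : ℝ} (hd : 1.28 < d) :
    ∃ S : ℕ, d ≤ 2 * (1.28 : ℝ) ^ (2 * S) ∧ (1.28 : ℝ) ^ (2 * (S + 1)) ≤ 1.34217728 * d := by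
  have hex : ∃ S : ℕ, d ≤ 2 * (1.28 : ℝ) ^ (2 * S) := by
    obtain ⟨S, hS⟩ := pow_unbounded_of_one_lt d (by norm_num : (1 : ℝ) < 1.28)
    refine ⟨S, ?_⟩
    have : (1.28 : ℝ) ^ S ≤ 1.28 ^ (2 * S) := pow_le_pow_right₀ (by norm_num) (by omega)
    have : (0 : ℝ) < 1.28 ^ (2 * S) := by positivity
    linarith
  classical
  refine ⟨Nat.find hex, Nat.find_spec hex, ?_⟩
  rcases h : Nat.find hex with _ | S
  -- For threshold round zero the bound is `1.6384 ≤ 1.34217728 * d`, which uses `d > 1.28`.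
  · norm_num; linarith
  -- By minimality `2 * r ^ (2 * (S - 1)) < d` at the threshold round `S`, and `r ^ 4 / 2 =
  -- 1.34217728`.
  · have h1 := Nat.find_min hex (m := S) (by omega)
    have e : (1.28 : ℝ) ^ (2 * (S + 1 + 1)) = 2.68435456 * 1.28 ^ (2 * S) := by ring
    rw [e]; linarith

/-! ### The expected cost and the competitive ratio -/

/-- The bound for the competitive ratio. -/
noncomputable def ratioBound (n : ℕ) : ℝ := 34.154 + 164.624 / 2 ^ n

theorem main_of_threshold (hx : StrictMono x) (hn : 2 < n) {lo hi : ℝ} (hlo : ∀ j, lo ≤ x j)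
    (hhi : ∀ j, x j ≤ hi) (hgap : Narrow x (hi - lo)) (hd : 1.28 < hi - lo) :
    (∀ᵐ ω ∂(coinLaw n), Rendezvous 1.28 x ω) ∧ ∀ j,
      ∫⁻ ω, cost 1.28 x ω j ∂(coinLaw n) ≤
        ENNReal.ofReal (ratioBound n) * ENNReal.ofReal ((hi - lo) / 2) := by
  obtain ⟨S, hS, hS'⟩ := exists_threshold hd
  set d := hi - lo with hdd
  have hr : (1 : ℝ) ≤ 1.28 := by norm_num
  have hpow : ∀ k, (1.28 : ℝ) ^ (2 * (S + 1 + k)) = 1.6384 * 1.28 ^ (2 * S) * 1.6384 ^ k := by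
    intro k
    rw [mul_add, pow_add, mul_add, pow_add, pow_mul _ 2 k]; norm_num; ring
  have hq : ∀ k, (1 : ℝ) ≤ 1.6384 ^ k := fun k => one_le_pow₀ (by norm_num)
  have hlarge : ∀ k, d < 2 * (1.28 : ℝ) ^ (2 * (S + 1 + k)) ∧
      d ≤ (1.28 : ℝ) ^ (2 * (S + 1 + k) + 1) := by
    intro k
    have h0 : (0 : ℝ) < 1.28 ^ (2 * S) := by positivity
    rw [pow_succ, hpow]
    have := hq k
    -- From `d ≤ 2 * r ^ (2 * S)`, the second bound needs `r ^ 3 ≥ 2`; indeed `1.28 ^ 3 = 2.097152`.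
    constructor <;> nlinarith
  have hnarrow : ∀ k, Narrow x (2 * 1.28 ^ (2 * (S + 1 + k))) := fun k i j hij hc =>
    (hgap i j hij hc).trans (hlarge k).1
  let G : ℕ → Coins n → Fin n → Prop := fun k ω => singles (start 1.28 x ω (S + 1 + k))
  have hG : ∀ k, DependsOn (G k) (past n (S + 1 + k) : Set (ℕ × Fin n)) := fun k =>
    dependsOn_singles_start _
  have hstep : ∀ k ω, potential (G (k + 1) ω) ≤ potentialNext (G k ω) (row ω (S + 1 + k)) :=
    fun k ω => potential_start_le hr hx hn (S + 1 + k) (hnarrow k) ω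
  set Γ : ℝ := 1.3 + 2.3 * (2 / 2 ^ n) with hΓ
  have hΓ0 : 0 ≤ Γ := by positivity
  -- Round `S` only serves to thin out the single robots: whatever the state at its beginning, its
  -- fresh coins bring the expected potential below `Γ`. Successes are counted from round `S + 1`
  -- on.
  have hpot : ∫⁻ ω, ENNReal.ofReal (potential (G 0 ω)) ∂(coinLaw n) ≤ ENNReal.ofReal Γ := by
    calc ∫⁻ ω, ENNReal.ofReal (potential (G 0 ω)) ∂(coinLaw n)
        ≤ ∫⁻ ω, ENNReal.ofReal (potentialNext (singles (start 1.28 x ω S)) (row ω S))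
          ∂(coinLaw n) := by
          refine lintegral_mono fun ω => ENNReal.ofReal_le_ofReal ?_
          exact potential_start_le hr hx hn S
            (fun i j hij hc => (hgap i j hij hc).trans_le hS) ω
      _ = ∫⁻ ω, (∑ w, ENNReal.ofReal (potentialNext (singles (start 1.28 x ω S)) w)) / 2 ^ n
          ∂(coinLaw n) :=
          lintegral_row (fun w ω => ENNReal.ofReal (potentialNext (singles (start 1.28 x ω S)) w))
            fun w ω ω' h => by
              have := dependsOn_singles_start (r := 1.28) (x := x) S h
              simp only at this ⊢
              rw [this]
      _ ≤ ∫⁻ _, ENNReal.ofReal Γ ∂(coinLaw n) := by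
          refine lintegral_mono fun ω => ?_
          rw [sum_ofReal_div (potentialNext_nonneg _)]
          exact ENNReal.ofReal_le_ofReal (avg_potentialNext_le (by omega) _)
      _ = ENNReal.ofReal Γ := by simp
  have hae := ae_exists_firstSuccess hG hstep hn (hpot.trans_lt ENNReal.ofReal_lt_top).ne
  have hcost : ∀ k ω, FirstSuccess G (S + 1) k ω → ∀ j, Rendezvous 1.28 x ω ∧
      cost 1.28 x ω j ≤ ENNReal.ofReal (64 / 7 * 1.34217728 * d) * ENNReal.ofReal 1.6384 ^ k +
        ENNReal.ofReal d := by
    intro k ω h j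
    obtain ⟨h1, h2⟩ := cost_le_of_success hr hx hlo hhi (hlarge k).1 (hlarge k).2 h.2 j
    refine ⟨h1, h2.trans ?_⟩
    rw [← ENNReal.ofReal_pow (by norm_num), ← ENNReal.ofReal_mul (by linarith),
      ← ENNReal.ofReal_add (by have := hq k; nlinarith) (by linarith)]
    refine ENNReal.ofReal_le_ofReal ?_
    have h3 := beginTime_add_le (S + 1 + k)
    have h4 : (1.28 : ℝ) ^ (2 * (S + 1 + k)) ≤ 1.34217728 * d * 1.6384 ^ k := by
      have e : (1.28 : ℝ) ^ (2 * (S + 1 + k)) = 1.28 ^ (2 * (S + 1)) * 1.6384 ^ k := by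
        rw [mul_add, pow_add, pow_mul _ 2 k]; norm_num
      rw [e]
      exact mul_le_mul_of_nonneg_right hS' (by positivity)
    linarith
  refine ⟨?_, fun j => ?_⟩
  · filter_upwards [hae] with ω hω
    obtain ⟨k, hk⟩ := hω
    exact (hcost k ω hk ⟨0, by omega⟩).1
  have hmeas : ∀ k, MeasurableSet {ω | FirstSuccess G (S + 1) k ω} := measurableSet_firstSuccess hG
  have hdisj : Pairwise (Function.onFun Disjoint fun k => {ω | FirstSuccess G (S + 1) k ω}) := by
    intro k l hkl
    refine Set.disjoint_left.2 fun ω hk hl => ?_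
    rcases lt_or_gt_of_ne hkl with h | h
    · exact hl.1 k h hk.2
    · exact hk.1 l h hl.2
  have hsum1 : ∑' k, coinLaw n {ω | FirstSuccess G (S + 1) k ω} ≤ 1 := by
    rw [← measure_iUnion hdisj hmeas]; exact prob_le_one
  have hsum2 := (tsum_firstSuccess_le hG hstep hn).trans hpot
  set A := ENNReal.ofReal (64 / 7 * 1.34217728 * d)
  have hunion : ∀ᵐ ω ∂(coinLaw n), ω ∈ ⋃ k, {ω | FirstSuccess G (S + 1) k ω} := by
    filter_upwards [hae] with ω hω
    simpa using hω
  -- The expectation is split according to the first successful round. The term growing with the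
  -- round is controlled by the potential, and the constant `d` by the total probability.
  calc ∫⁻ ω, cost 1.28 x ω j ∂(coinLaw n)
      = ∫⁻ ω in ⋃ k, {ω | FirstSuccess G (S + 1) k ω}, cost 1.28 x ω j ∂(coinLaw n) := by
        rw [Measure.restrict_eq_self_of_ae_mem hunion]
    _ = ∑' k, ∫⁻ ω in {ω | FirstSuccess G (S + 1) k ω}, cost 1.28 x ω j ∂(coinLaw n) :=
        lintegral_iUnion hmeas hdisj _
    _ ≤ ∑' k, (A * (ENNReal.ofReal 1.6384 ^ k * coinLaw n {ω | FirstSuccess G (S + 1) k ω}) +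
          ENNReal.ofReal d * coinLaw n {ω | FirstSuccess G (S + 1) k ω}) := by
        refine ENNReal.tsum_le_tsum fun k => ?_
        refine (setLIntegral_mono' (hmeas k) fun ω hω => (hcost k ω hω j).2).trans ?_
        rw [setLIntegral_const, add_mul, mul_assoc]
    _ = A * ∑' k, (ENNReal.ofReal 1.6384 ^ k * coinLaw n {ω | FirstSuccess G (S + 1) k ω}) +
          ENNReal.ofReal d * ∑' k, coinLaw n {ω | FirstSuccess G (S + 1) k ω} := by
        rw [ENNReal.tsum_add, ENNReal.tsum_mul_left, ENNReal.tsum_mul_left]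
    _ ≤ A * ENNReal.ofReal Γ + ENNReal.ofReal d * 1 := by gcongr
    _ ≤ ENNReal.ofReal (ratioBound n) * ENNReal.ofReal (d / 2) := by
        -- With `c = 64 / 7 * 1.34217728`, about `12.2713`, the ratio is at most `2 * (1.3 * c +
        -- 1)`, about `33.91`, plus `9.2 * c / 2 ^ n`, about `112.9 / 2 ^ n`. The constants of
        -- `ratioBound` are larger; `164.624 = 8 * (54.732 - 34.154)` gives the stated value at `n =
        -- 3`.
        have h2n : (0 : ℝ) ≤ 1 / 2 ^ n := by positivity
        have e1 : Γ = 1.3 + 4.6 * (1 / 2 ^ n) := by rw [hΓ]; ring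
        have e2 : ratioBound n = 34.154 + 164.624 * (1 / 2 ^ n) := by rw [ratioBound]; ring
        rw [mul_one, ← ENNReal.ofReal_mul (by linarith), ← ENNReal.ofReal_add (by nlinarith)
          (by linarith), ← ENNReal.ofReal_mul (by linarith)]
        refine ENNReal.ofReal_le_ofReal ?_
        rw [e1, e2]
        nlinarith [mul_nonneg h2n (by linarith : (0 : ℝ) ≤ d)]

end MSR

theorem theorem1 :
    (∀ (n : ℕ) (x : Fin n → ℝ), 2 < n → MSR.Admissible 1.28 x →
      ∀ᵐ ω ∂(MSR.coinLaw n), MSR.Rendezvous 1.28 x ω) ∧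
    ∃ B : ℕ → ℝ,
      (∀ n : ℕ, 2 < n → MSR.competitiveRatio 1.28 n ≤ ENNReal.ofReal (B n)) ∧
      (∀ n : ℕ, 2 < n → B n ≤ B 3) ∧
      B 3 = 54.732 ∧
      Tendsto B atTop (𝓝 34.154) := by
  have main : ∀ (n : ℕ) (x : Fin n → ℝ), 2 < n → MSR.Admissible 1.28 x →
      0 < MSR.span x ∧ (∀ᵐ ω ∂(MSR.coinLaw n), MSR.Rendezvous 1.28 x ω) ∧ ∀ j,
      ∫⁻ ω, MSR.cost 1.28 x ω j ∂(MSR.coinLaw n) ≤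
        ENNReal.ofReal (MSR.ratioBound n) * ENNReal.ofReal (MSR.offlineCost x) := by
    rintro n x hn ⟨hx, k, δ, hk, hδ, hspan⟩
    have hlo : ∀ j, ⨅ j, x j ≤ x j := fun j => ciInf_le (Set.finite_range x).bddBelow j
    have hhi : ∀ j, x j ≤ ⨆ j, x j := fun j => le_ciSup (Set.finite_range x).bddAbove j
    have hd : 1.28 < (⨆ j, x j) - ⨅ j, x j := by
      change 1.28 < MSR.span x
      rw [hspan]
      nth_rewrite 1 [← Real.rpow_one (1.28 : ℝ)]
      refine Real.rpow_lt_rpow_of_exponent_lt (by norm_num) ?_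
      have h1 : (1 : ℝ) ≤ k := by exact_mod_cast hk
      linarith [hδ.1]
    refine ⟨lt_trans (by norm_num) hd, MSR.main_of_threshold hx hn hlo hhi ?_ hd⟩
    -- A pair other than the two extremes leaves a robot strictly outside on one side, so its
    -- distance is strictly less than the span.
    intro i j hij hc
    rcases hc with hc | hc
    · have h1 := hx (show j < ⟨n - 1, by omega⟩ from Fin.lt_def.2 (by simp; omega))
      have := hhi ⟨n - 1, by omega⟩
      have := hlo i
      linarith
    · have h1 := hx (show ⟨0, by omega⟩ < i from Fin.lt_def.2 hc)
      have := hlo ⟨0, by omega⟩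
      have := hhi j
      linarith
  refine ⟨fun n x hn hx => (main n x hn hx).2.1, MSR.ratioBound, fun n hn => ?_, fun n hn => ?_, ?_, ?_⟩
  · refine iSup_le fun x => iSup_le fun hx => iSup_le fun j => ?_
    obtain ⟨h1, -, h2⟩ := main n x hn hx
    have h3 : 0 < MSR.offlineCost x := half_pos h1
    exact (ENNReal.div_le_iff (by simpa using h3) ENNReal.ofReal_ne_top).2 (h2 j)
  · unfold MSR.ratioBound
    have : (2 : ℝ) ^ 3 ≤ 2 ^ n := pow_le_pow_right₀ (by norm_num) hn
    gcongr
  · norm_num [MSR.ratioBound]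
  · unfold MSR.ratioBound
    have h := (tendsto_pow_atTop_atTop_of_one_lt (by norm_num : (1 : ℝ) < 2)).const_div_atTop 164.624
    simpa using h.const_add 34.154
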